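/- Consider a downlink $K$-tier network in $\mathbb{R}^2$ with a typical user at the origin. The base stations (BSs) of tier $t\in\{1,\dots,K\}$ have transmit power $P_t>0$ and form independent homogeneous Poisson point processes (PPPs) $\Phi_t$ of densities $\lambda_t>0$. The path loss is $d^{-\alpha}$ with $\alpha>2$, and the power gains of all links to the typical user are i.i.d. exponential with mean $1$, independent of all locations. With $D_t$ the distance from the origin to the nearest BS of tier $t$, the serving BS is the nearest BS of the tier $k$ maximizing $P_tD_t^{-\alpha}$; $r$ denotes its distance. Scheduled users transmit with power $P_U\ge 0$ and jammers with power $P_J>0$. The residual self-interference is $N_S=\beta P_U$ ($\beta\ge0$) and the thermal noise is $N_0\ge 0$. Let $\theta_c>0$, $\tau>0$ and $R_\tau=(P_J/\tau)^{1/\alpha}$. Modelling assumptions. Given the BSs, with serving tier $k$ and serving distance $r$: the (interfering) scheduled users of tier $t$ form a PPP with intensity at distance $y$ from the origin $$\lambda^s_{U,t}(r,y)=\lambda_t\Big(1-\exp\big(-\pi(r+y)^2\lambda_t(P_t/P_k)^{2/\alpha}\big)\Big),\qquad \lambda_U^s=\sum_t\lambda_{U,t}^s;$$ the jammers form a homogeneous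 PPP of density $\lambda_J>0$; the hole centres form a process with the same conditional law as the scheduled users; and all these processes are independent (so the correlation between interference from users and from jammers is neglected). A jammer is active if it lies outside the open disc of radius $R_\tau$ around the origin and outside the open disc of radius $R_\tau$ around the hole centre closest to the origin (all other holes are ignored). Let $I_B$, $I_U$, $I_J$ be the total powers received at the origin from all BSs except the serving one, from the scheduled users, and from the active jammers; let $\mathrm{SINR}$ be the power received from the serving BS divided by $I_B+I_U+I_J+N_S+N_0$, and $\mathcal{P}_c(\theta_c,\tau)=\mathbb{P}(\mathrm{SINR}\ge\theta_c)$. Theorem. Put $\Xi=\sum_t\lambda_tP_t^{2/\alpha}$, $\zeta_k(r)=\theta_cr^\alpha/P_k$, $\Delta_{k,t}=r(P_t/P_k)^{1/\alpha}$, $\mathcal{A}_k=\lambda_kP_k^{2/\alpha}/\Xi$, $f_{D_k}(r)=\frac{2\pi\lambda_kr}{\mathcal{A}_k}\exp\big(-\pi r^2\,\Xi/P_k^{2/\alpha}\big)$, and $$\mathcal{L}_{I_B}(s)=\prod_t\exp\Big(-2\pi\lambda_t\frac{sP_t\Delta_{k,t}^{2-\alpha}}{\alpha-2}\,{}_2F_1\big(1,1-\tfrac2\alpha;2-\tfrac2\alpha;-\tfrac{sP_t}{\Delta_{k,t}^\alpha}\big)\Big),$$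 $$\mathcal{L}_{I_U}(s)=\prod_t\exp\Big(-2\pi\int_0^\infty\lambda^s_{U,t}(r,y)\Big(1-\frac1{1+sP_Uy^{-\alpha}}\Big)y\,dy\Big),$$ $$\mathcal{L}_{I_J}(s)=\exp\Big(-2\pi\lambda_J\frac{sP_JR_\tau^{2-\alpha}}{\alpha-2}\,{}_2F_1\big(1,1-\tfrac2\alpha;2-\tfrac2\alpha;-\tfrac{sP_J}{R_\tau^\alpha}\big)\Big)\int_0^\infty H(v,s)f(v)\,dv,$$ where $$H(v,s)=\exp\Big(\int_{\max\{v-R_\tau,R_\tau\}}^{v+R_\tau}\frac{2y\,\lambda_J\arccos\big(\frac{y^2+v^2-R_\tau^2}{2yv}\big)}{1+y^\alpha/(sP_J)}\,dy\Big),\qquad f(v)=2\pi\lambda_U^s(r,v)\,v\,\exp\Big(-2\pi\int_0^v\lambda_U^s(r,y)\,y\,dy\Big).$$ Then $\mathcal{A}_k$ is the probability that the serving tier is $k$; $f_{D_k}$ on $(0,\infty)$ is the density of the serving distance given serving tier $k$; for every $s>0$, $\mathcal{L}_{I_B}(s)$, $\mathcal{L}_{I_U}(s)$, $\mathcal{L}_{I_J}(s)$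 are the conditional Laplace transforms of $I_B$, $I_U$, $I_J$ given the serving tier $k$ and serving distance $r$; and $$\mathcal{P}_c(\theta_c,\tau)=\sum_{k=1}^K\mathcal{A}_k\int_0^\infty e^{-(N_S+N_0)\zeta_k(r)}\,\mathcal{L}_{I_B}(\zeta_k(r))\,\mathcal{L}_{I_U}(\zeta_k(r))\,\mathcal{L}_{I_J}(\zeta_k(r))\,f_{D_k}(r)\,dr,$$ the integrands being integrable. -/

import Mathlib

open MeasureTheory ProbabilityTheory Set Filter
open scoped ENNReal NNReal

noncomputable section

namespace HetNet

/-- The two-dimensional plane with its Euclidean norm. -/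
abbrev Plane : Type := EuclideanSpace ℝ (Fin 2)

/-! ### Deterministic parameters of the network -/

/-- The parameters of a `K`-tier network: path loss exponent `α`, transmit powers of the base
stations of each tier, of the users and of the jammers, densities of the base stations of each tier
and of the jammers, self-interference cancellation capacity `β`, thermal noise power. -/
structure Params (K : ℕ) where
  α : ℝ
  power : Fin K → ℝ
  powerU : ℝ
  powerJ : ℝ
  dens : Fin K → ℝ
  densJ : ℝ
  β : ℝ
  noise : ℝ
  two_lt_α : 2 < α
  power_pos : ∀ t, 0 < power t
  powerU_nonneg : 0 ≤ powerU
  powerJ_pos : 0 < powerJ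
  dens_pos : ∀ t, 0 < dens t
  densJ_pos : 0 < densJ
  β_nonneg : 0 ≤ β
  noise_nonneg : 0 ≤ noise

/-! ### Poisson point processes

A point process is given by a measurable enumeration `X 0, X 1, …` of its (infinitely many)
points. -/

section Poisson

variable {Ω : Type*}

/-- The number of points of the enumerated point process `X` in the set `B`. -/
def count (X : ℕ → Ω → Plane) (B : Set Plane) (ω : Ω) : ℕ∞ :=
  {i : ℕ | X i ω ∈ B}.encard

/-- Conditionally on the sub-σ-algebra `m`, the point processes `X p`, `p : ι`, are independent
Poisson point processes with (possibly random) intensity measures `Λ p`: conditionally on `m`, the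
numbers of points in bounded Borel sets are independent across the processes and across disjoint
sets, and the number of points of `X p` in `B` is Poisson with mean `Λ p B`.
For `m = ⊥` this is the unconditional notion. -/
def IsCondPoisson (m : MeasurableSpace Ω) [mΩ : MeasurableSpace Ω] (P : Measure Ω) {ι : Type*}
    (X : ι → ℕ → Ω → Plane) (Λ : ι → Ω → Measure Plane) : Prop :=
  (∀ p i, Measurable[mΩ] (X p i)) ∧
  ∀ (n : ℕ) (p : Fin n → ι) (B : Fin n → Set Plane) (c : Fin n → ℕ),
    (∀ a, MeasurableSet (B a)) → (∀ a, Bornology.IsBounded (B a)) →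
    (∀ a b, a ≠ b → p a = p b → Disjoint (B a) (B b)) →
    P⟦{ω | ∀ a, count (X (p a)) (B a) ω = (c a : ℕ∞)} | m⟧ =ᵐ[P]
      fun ω => ∏ a, (poissonMeasure (Λ (p a) ω (B a)).toNNReal).real {c a}

end Poisson

/-! ### Special functions and the analytic expressions -/

/-- The Gauss hypergeometric function `₂F₁(a, b; c; z)` for real `0 < b < c` and `z < 1`, through
Euler's integral (the power series diverges for `z < -1`). -/
def hyp2F1 (a b c z : ℝ) : ℝ :=
  Real.Gamma c / (Real.Gamma b * Real.Gamma (c - b)) *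
    ∫ t in Ioo (0 : ℝ) 1, t ^ (b - 1) * (1 - t) ^ (c - b - 1) * (1 - z * t) ^ (-a)

namespace Params

variable {K : ℕ} (q : Params K)

/-- Residual self-interference `N_S = β P_U`. -/
def selfInterference : ℝ := q.β * q.powerU

/-- `Ξ = ∑ₜ λₜ Pₜ^{2/α}`. -/
def Xi : ℝ := ∑ t, q.dens t * q.power t ^ (2 / q.α)

/-- The association probability `𝒜ₖ`. -/
def assocProb (k : Fin K) : ℝ := q.dens k * q.power k ^ (2 / q.α) / q.Xi

/-- The density `f_{D_k}(r)` of the distance to the serving base station in tier `k`. -/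
def distDensity (k : Fin K) (r : ℝ) : ℝ :=
  2 * Real.pi * q.dens k * r / q.assocProb k *
    Real.exp (-(Real.pi * r ^ 2 / q.power k ^ (2 / q.α) * q.Xi))

/-- `Δ_{k,t} = r (Pₜ / Pₖ)^{1/α}`. -/
def Del (k : Fin K) (r : ℝ) (t : Fin K) : ℝ := r * (q.power t / q.power k) ^ (1 / q.α)

/-- The Laplace transform `ℒ_{I_B}(s)`, given serving tier `k` and serving distance `r`. -/
def laplaceB (k : Fin K) (r s : ℝ) : ℝ :=
  ∏ t, Real.exp (-(2 * Real.pi * q.dens t *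
    (s * q.power t * q.Del k r t ^ (2 - q.α) / (q.α - 2)) *
    hyp2F1 1 (1 - 2 / q.α) (2 - 2 / q.α) (-(s * q.power t / q.Del k r t ^ q.α))))

/-- The intensity `λ_{U,t}^s(r, y)` of the scheduled users of tier `t` at distance `y` from the
typical user, given serving tier `k` and serving distance `r`. -/
def userDensity (k : Fin K) (r : ℝ) (t : Fin K) (y : ℝ) : ℝ :=
  q.dens t * (1 - Real.exp (-(Real.pi * (r + y) ^ 2 * q.dens t *
    (q.power t / q.power k) ^ (2 / q.α))))

/-- `λ_U^s(r, y) = ∑ₜ λ_{U,t}^s(r, y)`. -/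
def userDensityTotal (k : Fin K) (r y : ℝ) : ℝ := ∑ t, q.userDensity k r t y

/-- The Laplace transform `ℒ_{I_U}(s)`, given serving tier `k` and serving distance `r`. -/
def laplaceU (k : Fin K) (r s : ℝ) : ℝ :=
  ∏ t, Real.exp (-(2 * Real.pi *
    ∫ y in Ioi (0 : ℝ), q.userDensity k r t y *
      (1 - 1 / (1 + s * q.powerU * y ^ (-q.α))) * y))

/-- The radius `R_τ = (P_J / τ)^{1/α}` of the guard zones. -/
def guardRadius (τ : ℝ) : ℝ := (q.powerJ / τ) ^ (1 / q.α)

/-- `λ_J'(y)` (it depends on `v` too). -/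
def jamDensity' (τ v y : ℝ) : ℝ :=
  q.densJ * Real.arccos ((y ^ 2 + v ^ 2 - q.guardRadius τ ^ 2) / (2 * y * v))

/-- The function `H(v, s)`. -/
def H (τ v s : ℝ) : ℝ :=
  Real.exp (∫ y in (max (v - q.guardRadius τ) (q.guardRadius τ))..(v + q.guardRadius τ),
    2 * y * q.jamDensity' τ v y / (1 + y ^ q.α / (s * q.powerJ)))

/-- The density `f(v)` of the distance to the closest (other) hole centre. -/
def holeDensity (k : Fin K) (r v : ℝ) : ℝ :=
  2 * Real.pi * q.userDensityTotal k r v * v *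
    Real.exp (-(2 * Real.pi * ∫ y in (0 : ℝ)..v, q.userDensityTotal k r y * y))

/-- The Laplace transform `ℒ_{I_J}(s)`, given serving tier `k` and serving distance `r`. -/
def laplaceJ (τ : ℝ) (k : Fin K) (r s : ℝ) : ℝ :=
  Real.exp (-(2 * Real.pi * q.densJ *
    (s * q.powerJ * q.guardRadius τ ^ (2 - q.α) / (q.α - 2)) *
    hyp2F1 1 (1 - 2 / q.α) (2 - 2 / q.α) (-(s * q.powerJ / q.guardRadius τ ^ q.α)))) *
  ∫ v in Ioi (0 : ℝ), q.H τ v s * q.holeDensity k r v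

/-- `ζₖ(r) = θ r^α / Pₖ`. -/
def zeta (θ : ℝ) (k : Fin K) (r : ℝ) : ℝ := θ * r ^ q.α / q.power k

/-- The integrand of the connection probability for serving tier `k`. -/
def connIntegrand (θ τ : ℝ) (k : Fin K) (r : ℝ) : ℝ :=
  Real.exp (-((q.selfInterference + q.noise) * q.zeta θ k r)) *
    q.laplaceB k r (q.zeta θ k r) * q.laplaceU k r (q.zeta θ k r) *
    q.laplaceJ τ k r (q.zeta θ k r) * q.distDensity k r

end Params

/-! ### The random network seen from the typical user at the origin -/

/-- The point processes other than the base stations: the jammers, the scheduled users of each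
tier, and the hole centres of each tier (a copy of the scheduled users, used to place the holes). -/
inductive Proc (K : ℕ) : Type
  | jammer : Proc K
  | user (t : Fin K) : Proc K
  | centre (t : Fin K) : Proc K

/-- The transmitters: the `i`-th base station or scheduled user of tier `t`, or the `i`-th
jammer. -/
inductive Node (K : ℕ) : Type
  | bs (t : Fin K) (i : ℕ) : Node K
  | user (t : Fin K) (i : ℕ) : Node K
  | jammer (i : ℕ) : Node K

/-- The intensity measures given serving tier `k` and serving distance `r`: homogeneous for the
jammers, rotation invariant for the scheduled users and for the hole centres. -/
def Params.intensity {K : ℕ} (q : Params K) (k : Fin K) (r : ℝ) : Proc K → Measure Plane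
  | .jammer => ENNReal.ofReal q.densJ • volume
  | .user t => volume.withDensity fun x => ENNReal.ofReal (q.userDensity k r t ‖x‖)
  | .centre t => volume.withDensity fun x => ENNReal.ofReal (q.userDensity k r t ‖x‖)

/-- The σ-algebra generated by the locations of all base stations. -/
abbrev sigmaBS {K : ℕ} {Ω : Type*} (bs : Fin K → ℕ → Ω → Plane) : MeasurableSpace Ω :=
  MeasurableSpace.comap (fun ω t i => bs t i ω) inferInstance

/-- The distance `Dₜ` from the origin to the nearest point of an enumerated point process. -/
def nearestDist {Ω : Type*} (X : ℕ → Ω → Plane) (ω : Ω) : ℝ := ⨅ i, ‖X i ω‖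

/-- The stochastic model of the network, with the typical user at the origin:
* the base stations of the tiers are independent homogeneous Poisson processes;
* the serving base station is the nearest one of a tier `k` maximizing `Pₜ Dₜ^{-α}`;
* given the base stations, hence given the serving tier `k` and the serving distance `r`, the
  jammers, the scheduled users of each tier and the hole centres of each tier are independent
  Poisson processes, the jammers homogeneous and the others with intensity `λ_{U,t}^s(r, ‖x‖)`.
  The hole centres are an independent copy of the scheduled users, so that the correlation between
  the interference from scheduled users and from active jammers is neglected;
* the power gains of the links to the typical user are i.i.d. unit mean exponential (Rayleigh
  fading), independent of all locations. -/
structure Model {K : ℕ} (q : Params K) (Ω : Type*) [MeasurableSpace Ω] (P : Measure Ω) where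
  bs : Fin K → ℕ → Ω → Plane
  proc : Proc K → ℕ → Ω → Plane
  fading : Node K → Ω → ℝ
  serving : Ω → Fin K × ℕ
  bs_poisson : IsCondPoisson ⊥ P bs fun t _ => ENNReal.ofReal (q.dens t) • volume
  measurable_serving : Measurable serving
  serving_tier : ∀ᵐ ω ∂P, ∀ t : Fin K,
    q.power t * nearestDist (bs t) ω ^ (-q.α) ≤
      q.power (serving ω).1 * nearestDist (bs (serving ω).1) ω ^ (-q.α)
  serving_nearest : ∀ᵐ ω ∂P,
    ‖bs (serving ω).1 (serving ω).2 ω‖ = nearestDist (bs (serving ω).1) ω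
  proc_poisson : IsCondPoisson (sigmaBS bs) P proc fun p ω =>
    q.intensity (serving ω).1 ‖bs (serving ω).1 (serving ω).2 ω‖ p
  measurable_fading : ∀ l, Measurable (fading l)
  fading_law : ∀ l, P.map (fading l) = expMeasure 1
  fading_indep : iIndepFun fading P
  fading_indep_locations : IndepFun (fun ω l => fading l ω)
    (fun ω => ((fun t i => bs t i ω : Fin K → ℕ → Plane),
      (fun p i => proc p i ω : Proc K → ℕ → Plane))) P

namespace Model

variable {K : ℕ} {q : Params K} {Ω : Type*} [MeasurableSpace Ω] {P : Measure Ω} (M : Model q Ω P)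

/-- The tier of the serving base station. -/
def tier (ω : Ω) : Fin K := (M.serving ω).1

/-- The distance to the serving base station. -/
def dist (ω : Ω) : ℝ := ‖M.bs (M.serving ω).1 (M.serving ω).2 ω‖

/-- The power received at the origin through a link with transmit power `p` and gain `h` from a
transmitter at `x`. -/
def received (α p h : ℝ) (x : Plane) : ℝ≥0∞ := ENNReal.ofReal (p * h * ‖x‖ ^ (-α))

/-- `I_B`: the interference from all base stations but the serving one. -/
def interferenceB (ω : Ω) : ℝ≥0∞ :=
  ∑ t, ∑' i, if (t, i) = M.serving ω then 0 else
    received q.α (q.power t) (M.fading (.bs t i) ω) (M.bs t i ω)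

/-- `I_U`: the interference from the scheduled users. -/
def interferenceU (ω : Ω) : ℝ≥0∞ :=
  ∑ t, ∑' i, received q.α q.powerU (M.fading (.user t i) ω) (M.proc (.user t) i ω)

/-- `M.Closest t i ω`: the `i`-th hole centre of tier `t` is the closest one to the origin. -/
def Closest (t : Fin K) (i : ℕ) (ω : Ω) : Prop :=
  ∀ (t' : Fin K) (i' : ℕ), ‖M.proc (.centre t) i ω‖ ≤ ‖M.proc (.centre t') i' ω‖

/-- The `j`-th jammer is active: it lies neither in the open guard zone around the typical user nor
in the open guard zone around the closest hole centre (the other holes are ignored). -/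
def Active (τ : ℝ) (j : ℕ) (ω : Ω) : Prop :=
  M.proc .jammer j ω ∉ Metric.ball (0 : Plane) (q.guardRadius τ) ∧
  ∀ (t : Fin K) (i : ℕ), M.Closest t i ω →
    M.proc .jammer j ω ∉ Metric.ball (M.proc (.centre t) i ω) (q.guardRadius τ)

open Classical in
/-- `I_J`: the interference from the active jammers. -/
def interferenceJ (τ : ℝ) (ω : Ω) : ℝ≥0∞ :=
  ∑' j, if M.Active τ j ω then
    received q.α q.powerJ (M.fading (.jammer j) ω) (M.proc .jammer j ω) else 0

/-- The signal-to-interference-plus-noise ratio of the typical user. -/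
def sinr (τ : ℝ) (ω : Ω) : ℝ≥0∞ :=
  received q.α (q.power (M.serving ω).1) (M.fading (.bs (M.serving ω).1 (M.serving ω).2) ω)
      (M.bs (M.serving ω).1 (M.serving ω).2 ω) /
    (M.interferenceB ω + M.interferenceU ω + M.interferenceJ τ ω +
      ENNReal.ofReal (q.selfInterference + q.noise))

/-- The connection probability `𝒫_c(θ, τ)`. -/
def connProb (θ τ : ℝ) : ℝ := P.real {ω | ENNReal.ofReal θ ≤ M.sinr τ ω}

/-- The σ-algebra generated by the serving tier and the serving distance. -/
abbrev sigmaServing : MeasurableSpace Ω :=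
  MeasurableSpace.comap (fun ω => (M.tier ω, M.dist ω)) inferInstance

end Model

/-- `e^{-x}` for `x` in `[0, ∞]`, with `e^{-∞} = 0`. -/
def expNeg (x : ℝ≥0∞) : ℝ := if x = ⊤ then 0 else Real.exp (-x.toReal)

/-- Given the serving tier `k` and the serving distance `r`, the function `L k r` is the Laplace
transform of `I` on `(0, ∞)`. -/
def Model.IsCondLaplace {K : ℕ} {q : Params K} {Ω : Type*} [MeasurableSpace Ω] {P : Measure Ω}
    (M : Model q Ω P) (I : Ω → ℝ≥0∞) (L : Fin K → ℝ → ℝ → ℝ) : Prop :=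
  ∀ s : ℝ, 0 < s → P[fun ω => expNeg (ENNReal.ofReal s * I ω) | M.sigmaServing] =ᵐ[P]
    fun ω => L (M.tier ω) (M.dist ω) s

end HetNet

end

open scoped Topology

noncomputable section

/-! ### The exponential on `[0, ∞]` and Laplace functionals -/

namespace HetNet

/-! Everything is computed with Laplace functionals. For a Poisson process with intensity measure Λ,
the mean of `exp (-∑ g)` over its points is `exp (-∫ (1 - e^{-g}) dΛ)`. For bounded intensity
densities this follows from the Poisson counts by approximating `g` with simple functions
(`HasPoissonCounts.hasLaplace`), and it persists, in integrated form, when Λ is random. Conditioning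
on a σ-algebra is expressed by restricting the probability to each of its events.

Differentiating the functional in `g` gives a Mecke formula (`HasLaplace.mecke_indicator`): the sum
over points `z` of `f z * exp (-∑ g)` has an explicit mean. The selection of a distinguished point
requires `g` to depend on `z`; this is reached for dependence through countable unions of measurable
rectangles (`HasLaplace.meckeHolds_rectangles`). Since `nexp ∞ = 0`, an infinite `g` on the points
better than `z` encodes the event that `z` is the best point, so void probabilities and Laplace
transforms are treated at once.

The formula is used twice. For the base stations (`lintegral_strongest`) the exponent splits into a
disc free of stronger stations, which yields the law of the serving tier and distance, and its
exterior, which yields the transform of `I_B` (`bsExponent_eq`). Given the base stations, it is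
applied to users, jammers and hole centres jointly (`lintegral_closest`): the users contribute an
independent factor, and the jammers an average over the position of the closest hole centre. In both
cases, setting all Laplace parameters to zero shows that the mean number of best points is one; as
there is almost surely at least one, the best point is almost surely unique.

A unit exponential gain `h` satisfies `E e^{-ch} = 1 / (1 + c)` and `P (h ≥ z) = e^{-z}`. The first
identity eliminates the fading of the interferers, and the second turns the connection event into
the Laplace transform of noise plus interference at `ζ_k(r)`. Given tier and distance this transform
is a product (`lintegral_nexp_interference`); the random argument `ζ_k(r)` is reached by dyadic
approximation (`lintegral_nexp_mul_interference`). Polar coordinates then produce the closed forms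
(`integral_tail_eq_hyp2F1`, `holeExponent_polarPoint`). -/

/-- `e^{-x}` for `x` in `[0, ∞]`, as an extended nonnegative number. -/
def nexp (x : ℝ≥0∞) : ℝ≥0∞ := EReal.exp (-(x : EReal))

lemma continuous_nexp : Continuous nexp :=
  ENNReal.continuous_exp.comp (continuous_neg.comp continuous_coe_ennreal_ereal)

@[fun_prop]
lemma measurable_nexp : Measurable nexp := continuous_nexp.measurable

@[simp] lemma nexp_zero : nexp 0 = 1 := by simp [nexp]

@[simp] lemma nexp_top : nexp ∞ = 0 := by simp [nexp]

lemma nexp_add (x y : ℝ≥0∞) : nexp (x + y) = nexp x * nexp y := by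
  rw [nexp, nexp, nexp, ← EReal.exp_add, EReal.coe_ennreal_add, EReal.neg_add, sub_eq_add_neg]
  · left; exact EReal.coe_ennreal_ne_bot x
  · right; exact EReal.coe_ennreal_ne_bot y

lemma nexp_antitone : Antitone nexp := fun x y h => by
  simpa [nexp] using h

lemma nexp_le_one (x : ℝ≥0∞) : nexp x ≤ 1 := by
  simpa using nexp_antitone (zero_le (a := x))

lemma nexp_ne_top (x : ℝ≥0∞) : nexp x ≠ ∞ := ((nexp_le_one x).trans_lt ENNReal.one_lt_top).ne

lemma nexp_ofReal {x : ℝ} (hx : 0 ≤ x) : nexp (ENNReal.ofReal x) = ENNReal.ofReal (Real.exp (-x))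
    := by
  rw [nexp, EReal.coe_ennreal_ofReal, max_eq_left hx, ← EReal.coe_neg, EReal.exp_coe]

lemma nexp_eq_ofReal {x : ℝ≥0∞} (hx : x ≠ ∞) : nexp x = ENNReal.ofReal (Real.exp (-x.toReal)) := by
  rw [← nexp_ofReal ENNReal.toReal_nonneg, ENNReal.ofReal_toReal hx]

lemma nexp_ne_zero {x : ℝ≥0∞} (hx : x ≠ ∞) : nexp x ≠ 0 := by
  simp [nexp, hx]

lemma toReal_nexp (x : ℝ≥0∞) : (nexp x).toReal = expNeg x := by
  unfold expNeg
  split_ifs with h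
  · simp [h]
  · rw [nexp_eq_ofReal h, ENNReal.toReal_ofReal (Real.exp_pos _).le]

lemma nexp_sum {κ : Type*} (s : Finset κ) (f : κ → ℝ≥0∞) :
    nexp (∑ a ∈ s, f a) = ∏ a ∈ s, nexp (f a) := by
  classical
  induction s using Finset.induction_on with
  | empty => simp
  | insert a s ha ih => rw [Finset.sum_insert ha, Finset.prod_insert ha, nexp_add, ih]

lemma nexp_natCast_mul (n : ℕ) (x : ℝ≥0∞) : nexp (n * x) = nexp x ^ n := by
  induction n with
  | zero => simp
  | succ n ih => rw [Nat.cast_succ, add_mul, one_mul, nexp_add, ih, pow_succ]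

lemma one_sub_nexp_le (x : ℝ≥0∞) : 1 - nexp x ≤ x := by
  by_cases hx : x = ∞
  · simp [hx]
  rw [nexp_eq_ofReal hx, ← ENNReal.ofReal_one, ← ENNReal.ofReal_sub _ (Real.exp_pos _).le]
  refine ENNReal.ofReal_le_of_le_toReal ?_
  linarith [Real.add_one_le_exp (-x.toReal)]

lemma nexp_mul_one_sub (x y : ℝ≥0∞) : nexp x * (1 - nexp y) = nexp x - nexp (x + y) := by
  rw [ENNReal.mul_sub (fun _ _ => nexp_ne_top x), mul_one, nexp_add]

/-- `log (1 + a)` for `a` in `[0, ∞]`. -/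
def logAdd (a : ℝ≥0∞) : ℝ≥0∞ := (ENNReal.log (1 + a)).toENNReal

@[fun_prop]
lemma measurable_logAdd : Measurable logAdd := by
  unfold logAdd
  fun_prop

/-- This identity is the purpose of `logAdd`: averaging over a unit exponential gain with
coefficient `a` gives `(1 + a)⁻¹`, so once the fading is integrated out a transmitter enters the
exponent through `logAdd a`. -/
lemma nexp_logAdd (a : ℝ≥0∞) : nexp (logAdd a) = (1 + a)⁻¹ := by
  rw [nexp, logAdd, EReal.coe_toENNReal, EReal.exp_neg, ENNReal.exp_log]
  rw [ENNReal.zero_le_log_iff]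
  exact le_self_add

@[simp] lemma logAdd_zero : logAdd 0 = 0 := by simp [logAdd]

lemma logAdd_ne_top {a : ℝ≥0∞} (ha : a ≠ ∞) : logAdd a ≠ ∞ := by
  intro h
  have := nexp_logAdd a
  rw [h, nexp_top] at this
  have := ENNReal.inv_eq_zero.1 this.symm
  simp [ha] at this

/-- The random counting measure of a family of random points. -/
def pointMeasure {J Ω Y : Type*} [MeasurableSpace Y] (y : J → Ω → Y) (ω : Ω) : Measure Y :=
  Measure.sum fun j => Measure.dirac (y j ω)

lemma lintegral_pointMeasure {J Ω Y : Type*} [MeasurableSpace Y] (y : J → Ω → Y) (ω : Ω)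
    {g : Y → ℝ≥0∞} (hg : Measurable g) : ∫⁻ z, g z ∂pointMeasure y ω = ∑' j, g (y j ω) := by
  rw [pointMeasure, lintegral_sum_measure]
  exact tsum_congr fun j => lintegral_dirac' _ hg

/-- The point process `y` is, under the measure `ν`, a mixed Poisson process with random density
`ρ` with respect to `κ`, in terms of its Laplace functional. -/
def HasLaplace {J Ω Y : Type*} [MeasurableSpace Ω] [MeasurableSpace Y] (ν : Measure Ω)
    (y : J → Ω → Y) (κ : Measure Y) (ρ : Ω → Y → ℝ≥0∞) : Prop :=
  ∀ g : Y → ℝ≥0∞, Measurable g →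
    ∫⁻ ω, nexp (∑' j, g (y j ω)) ∂ν = ∫⁻ ω, nexp (∫⁻ z, ρ ω z * (1 - nexp (g z)) ∂κ) ∂ν

end HetNet

/-! ### From Poisson counts to Laplace functionals -/

namespace HetNet

/-- The generating function of the Poisson law, `∑ e^{-a} (a x)^c / c! = e^{-a (1 - x)}`, taken at
`x = nexp v`. The value `v = ∞` is allowed and gives `x = 0`. -/
lemma tsum_nexp_mul_poisson {a : ℝ≥0∞} (ha : a ≠ ∞) (v : ℝ≥0∞) :
    ∑' c : ℕ, nexp (c * v) * ENNReal.ofReal ((poissonMeasure a.toNNReal).real {c}) =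
      nexp (a * (1 - nexp v)) := by
  set x : ℝ := (nexp v).toReal with hx
  have hx0 : 0 ≤ x := ENNReal.toReal_nonneg
  have hx1 : x ≤ 1 := ENNReal.toReal_le_of_le_ofReal zero_le_one (by simpa using nexp_le_one v)
  have hvx : nexp v = ENNReal.ofReal x := (ENNReal.ofReal_toReal (nexp_ne_top v)).symm
  have hs : HasSum (fun c : ℕ => Real.exp (-a.toReal) * ((a.toReal * x) ^ c / c.factorial))
      (Real.exp (-a.toReal) * Real.exp (a.toReal * x)) := by
    refine HasSum.mul_left _ ?_
    rw [Real.exp_eq_exp_ℝ]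
    exact NormedSpace.expSeries_div_hasSum_exp _
  have hterm : ∀ c : ℕ, nexp (c * v) * ENNReal.ofReal ((poissonMeasure a.toNNReal).real {c}) =
      ENNReal.ofReal (Real.exp (-a.toReal) * ((a.toReal * x) ^ c / c.factorial)) := by
    intro c
    rw [nexp_natCast_mul, hvx, ← ENNReal.ofReal_pow hx0, ← ENNReal.ofReal_mul (by positivity),
      poissonMeasure_real_singleton, ENNReal.coe_toNNReal_eq_toReal]
    congr 1
    ring
  rw [tsum_congr hterm, ← ENNReal.ofReal_tsum_of_nonneg _ hs.summable, hs.tsum_eq, hvx,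
    ← ENNReal.ofReal_one, ← ENNReal.ofReal_sub _ hx0, ← Real.exp_add]
  · conv_rhs => rw [← ENNReal.ofReal_toReal ha, ← ENNReal.ofReal_mul ENNReal.toReal_nonneg]
    rw [nexp_ofReal (mul_nonneg ENNReal.toReal_nonneg (by linarith))]
    congr 2
    ring
  · intro n
    have : 0 ≤ a.toReal := ENNReal.toReal_nonneg
    positivity

lemma tsum_prod_fin_fun {n : ℕ} (F : Fin n → ℕ → ℝ≥0∞) :
    ∑' c : Fin n → ℕ, ∏ a, F a (c a) = ∏ a, ∑' c, F a c := by
  induction n with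
  | zero => simp
  | succ n ih =>
    rw [Fin.prod_univ_succ, ← ih, ← (Fin.consEquiv fun _ => ℕ).tsum_eq]
    rw [ENNReal.tsum_prod', ← ENNReal.tsum_mul_right]
    refine tsum_congr fun c => ?_
    rw [← ENNReal.tsum_mul_left]
    refine tsum_congr fun d => ?_
    rw [Fin.prod_univ_succ]
    simp [Fin.consEquiv]

variable {Ω : Type*} [MeasurableSpace Ω]

omit [MeasurableSpace Ω] in
lemma toENNReal_count (X : ℕ → Ω → Plane) (B : Set Plane) (ω : Ω) :
    ((count X B ω : ℕ∞) : ℝ≥0∞) = ∑' i, B.indicator (fun _ => 1) (X i ω) := by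
  classical
  rw [count, ← ENNReal.tsum_set_one, tsum_subtype {i | X i ω ∈ B} (fun _ => (1 : ℝ≥0∞))] 
  refine tsum_congr fun i => ?_
  simp [indicator]

lemma measurable_count {X : ℕ → Ω → Plane} (hX : ∀ i, Measurable (X i)) {B : Set Plane}
    (hB : MeasurableSet B) : Measurable fun ω => ((count X B ω : ℕ∞) : ℝ≥0∞) := by
  simp_rw [toENNReal_count]
  exact Measurable.tsum fun i => (measurable_const.indicator hB).comp (hX i)

/-- Under the measure `ν`, the numbers of points in disjoint bounded sets are mixed Poisson. -/
def HasPoissonCounts {ι : Type*} (ν : Measure Ω) (X : ι → ℕ → Ω → Plane)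
    (Λ : ι → Ω → Measure Plane) : Prop :=
  ∀ (n : ℕ) (p : Fin n → ι) (B : Fin n → Set Plane) (c : Fin n → ℕ),
    (∀ a, MeasurableSet (B a)) → (∀ a, Bornology.IsBounded (B a)) →
    (∀ a b, a ≠ b → p a = p b → Disjoint (B a) (B b)) →
    ν {ω | ∀ a, count (X (p a)) (B a) ω = (c a : ℕ∞)} =
      ∫⁻ ω, ∏ a, ENNReal.ofReal ((poissonMeasure (Λ (p a) ω (B a)).toNNReal).real {c a}) ∂ν

section

variable {ι : Type*} {ν : Measure Ω} [IsFiniteMeasure ν] {X : ι → ℕ → Ω → Plane}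
  {Λ : ι → Ω → Measure Plane}

/-- Split the space according to the vector `c` of counts: on each event `S c` the integrand is
constant, and the sum over `c` of products of Poisson weights factors into one generating function
per set. -/
lemma HasPoissonCounts.lintegral_nexp_sum_fin (h : HasPoissonCounts ν X Λ)
    (hX : ∀ p i, Measurable (X p i))
    (hΛ : ∀ p B, MeasurableSet B → Measurable fun ω => Λ p ω B)
    (hΛf : ∀ p ω B, Bornology.IsBounded B → Λ p ω B ≠ ∞)
    {n : ℕ} (p : Fin n → ι) (B : Fin n → Set Plane)
    (hB : ∀ a, MeasurableSet (B a)) (hBb : ∀ a, Bornology.IsBounded (B a))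
    (hd : ∀ a b, a ≠ b → p a = p b → Disjoint (B a) (B b)) (v : Fin n → ℝ≥0∞) :
    ∫⁻ ω, nexp (∑ a, ((count (X (p a)) (B a) ω : ℕ∞) : ℝ≥0∞) * v a) ∂ν =
      ∫⁻ ω, nexp (∑ a, Λ (p a) ω (B a) * (1 - nexp (v a))) ∂ν := by
  set S : (Fin n → ℕ) → Set Ω := fun c => {ω | ∀ a, count (X (p a)) (B a) ω = (c a : ℕ∞)} with hS
  have hSm : ∀ c, MeasurableSet (S c) := by
    intro c
    have : S c = ⋂ a, (fun ω => ((count (X (p a)) (B a) ω : ℕ∞) : ℝ≥0∞)) ⁻¹' {(c a : ℝ≥0∞)} := by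
      ext ω
      simp only [hS, mem_ofPred_eq, mem_iInter, mem_preimage, mem_singleton_iff]
      refine forall_congr' fun a => ?_
      rw [← ENat.toENNReal_coe, ENat.toENNReal_inj]
    rw [this]
    exact MeasurableSet.iInter fun a => measurable_count (hX _) (hB a) (measurableSet_singleton _)
  have hSd : Pairwise (Function.onFun Disjoint S) := by
    intro c d hcd
    refine Set.disjoint_left.2 fun ω h1 h2 => hcd (funext fun a => ?_)
    have := (h1 a).symm.trans (h2 a)
    exact_mod_cast this
  have hpm : ∀ c : Fin n → ℕ, ∀ a, Measurable fun ω =>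
      ENNReal.ofReal ((poissonMeasure (Λ (p a) ω (B a)).toNNReal).real {c a}) := by
    intro c a
    simp_rw [poissonMeasure_real_singleton]
    have := hΛ (p a) (B a) (hB a)
    fun_prop
  have hfac : ∀ (w : Fin n → ℝ≥0∞) (c : Fin n → ℕ), (∏ a, nexp (c a * w a)) * ν (S c) =
      ∫⁻ ω, ∏ a, nexp (c a * w a) *
        ENNReal.ofReal ((poissonMeasure (Λ (p a) ω (B a)).toNNReal).real {c a}) ∂ν := by
    intro w c
    rw [h n p B c hB hBb hd, ← lintegral_const_mul _ (Finset.measurable_prod _ fun a _ => hpm c a)]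
    simp_rw [Finset.prod_mul_distrib]
  have key : ∀ w : Fin n → ℝ≥0∞, ∑' c : Fin n → ℕ, (∏ a, nexp (c a * w a)) * ν (S c) =
      ∫⁻ ω, nexp (∑ a, Λ (p a) ω (B a) * (1 - nexp (w a))) ∂ν := by
    intro w
    simp_rw [hfac]
    rw [← lintegral_tsum fun c => (Finset.measurable_prod _ fun a _ =>
      (hpm c a).const_mul _).aemeasurable]
    refine lintegral_congr fun ω => ?_
    rw [tsum_prod_fin_fun (fun a c => nexp (c * w a) *
      ENNReal.ofReal ((poissonMeasure (Λ (p a) ω (B a)).toNNReal).real {c})), nexp_sum]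
    exact Finset.prod_congr rfl fun a _ => tsum_nexp_mul_poisson (hΛf _ _ _ (hBb a)) _
  -- Counts take values in `ℕ∞`, so an infinite count must be excluded. The case `w = 0` of `key`
  -- says that the events with finite counts carry the full mass.
  have huniv : (⋃ c, S c) =ᵐ[ν] univ := by
    rw [ae_eq_univ_iff_measure_eq (MeasurableSet.iUnion hSm).nullMeasurableSet,
      measure_iUnion hSd hSm]
    simpa using key 0
  rw [← setLIntegral_univ, ← setLIntegral_congr huniv, lintegral_iUnion hSm hSd, ← key]
  refine tsum_congr fun c => ?_
  rw [← setLIntegral_const]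
  refine setLIntegral_congr_fun (hSm c) fun ω hω => ?_
  rw [nexp_sum]
  refine Finset.prod_congr rfl fun a _ => ?_
  rw [hω a, ENat.toENNReal_coe]

lemma HasPoissonCounts.lintegral_nexp_sum (h : HasPoissonCounts ν X Λ)
    (hX : ∀ p i, Measurable (X p i))
    (hΛ : ∀ p B, MeasurableSet B → Measurable fun ω => Λ p ω B)
    (hΛf : ∀ p ω B, Bornology.IsBounded B → Λ p ω B ≠ ∞)
    {A : Type*} [Fintype A] (p : A → ι) (B : A → Set Plane)
    (hB : ∀ a, MeasurableSet (B a)) (hBb : ∀ a, Bornology.IsBounded (B a))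
    (hd : ∀ a b, a ≠ b → p a = p b → Disjoint (B a) (B b)) (v : A → ℝ≥0∞) :
    ∫⁻ ω, nexp (∑ a, ((count (X (p a)) (B a) ω : ℕ∞) : ℝ≥0∞) * v a) ∂ν =
      ∫⁻ ω, nexp (∑ a, Λ (p a) ω (B a) * (1 - nexp (v a))) ∂ν := by
  have e := (Fintype.equivFin A).symm
  have := h.lintegral_nexp_sum_fin hX hΛ hΛf (p ∘ e) (B ∘ e) (fun a => hB _) (fun a => hBb _)
    (fun a b hab => hd _ _ (e.injective.ne hab)) (v ∘ e)
  simp_rw [Function.comp_apply] at this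
  simp_rw [← e.sum_comp]
  exact this

/-- Poisson counts determine the Laplace functional. -/
lemma HasPoissonCounts.hasLaplace [Fintype ι] [MeasurableSpace ι] [MeasurableSingletonClass ι]
    {ρ : Ω → ι × Plane → ℝ≥0∞} (hρ : Measurable (Function.uncurry ρ)) {C : ℝ≥0}
    (hC : ∀ ω z, ρ ω z ≤ C)
    (h : HasPoissonCounts ν X fun p ω => volume.withDensity fun x => ρ ω (p, x))
    (hX : ∀ p i, Measurable (X p i)) :
    HasLaplace ν (fun (j : ι × ℕ) ω => (j.1, X j.1 j.2 ω)) (Measure.count.prod volume) ρ := by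
  classical
  intro g hg
  set D : ℕ → Set Plane := fun N => Metric.closedBall 0 N
  have hDm : ∀ N, MeasurableSet (D N) := fun N => Metric.isClosed_closedBall.measurableSet
  have hy : ∀ j : ι × ℕ, Measurable fun ω => ((j.1, X j.1 j.2 ω) : ι × Plane) := fun j =>
    measurable_const.prodMk (hX _ _)
  have hρ' : ∀ ω, Measurable (ρ ω) := fun ω => hρ.of_uncurry_left
  have hρp : ∀ ω p, Measurable fun x => ρ ω (p, x) := fun ω p =>
    (hρ' ω).comp measurable_prodMk_left
  have hΛapply : ∀ p ω B, MeasurableSet B → (volume.withDensity fun x => ρ ω (p, x)) B =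
      ∫⁻ x, B.indicator (fun x => ρ ω (p, x)) x := by
    intro p ω B hB
    rw [withDensity_apply _ hB, lintegral_indicator hB]
  have hΛm : ∀ p B, MeasurableSet B →
      Measurable fun ω => (volume.withDensity fun x => ρ ω (p, x)) B := by
    intro p B hB
    simp_rw [withDensity_apply _ hB]
    refine Measurable.lintegral_prod_right' (f := fun q : Ω × Plane => ρ q.1 (p, q.2)) ?_
    exact hρ.comp (measurable_fst.prodMk (measurable_const.prodMk measurable_snd))
  have hΛf : ∀ p ω B, Bornology.IsBounded B →
      (volume.withDensity fun x => ρ ω (p, x)) B ≠ ∞ := by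
    intro p ω B hB
    refine ne_top_of_le_ne_top ?_ (withDensity_mono (g := fun _ => (C : ℝ≥0∞))
      (Eventually.of_forall fun x => hC ω (p, x)) B)
    rw [withDensity_const]
    exact ENNReal.mul_ne_top ENNReal.coe_ne_top hB.measure_lt_top.ne
  -- approximation by simple functions with bounded support
  set φ : ℕ → SimpleFunc (ι × Plane) ℝ≥0∞ := fun N => SimpleFunc.eapprox g N
  set gN : ℕ → ι × Plane → ℝ≥0∞ := fun N => (Prod.snd ⁻¹' D N).indicator (φ N) with hgN
  have hDp : ∀ N, MeasurableSet (Prod.snd ⁻¹' D N : Set (ι × Plane)) := fun N =>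
    measurable_snd (hDm N)
  have hgNm : ∀ N, Measurable (gN N) := fun N => (φ N).measurable.indicator (hDp N)
  have hmono : Monotone gN := by
    intro N M hNM z
    simp only [hgN, indicator]
    split_ifs with h1 h2
    · exact SimpleFunc.monotone_eapprox g hNM z
    · exact absurd (Metric.closedBall_subset_closedBall (by exact_mod_cast hNM) h1) h2
    · exact zero_le
    · exact le_rfl
  have hsup : ∀ z, ⨆ N, gN N z = g z := by
    intro z
    refine le_antisymm (iSup_le fun N => ?_) ?_
    · refine (indicator_le_self _ _ _).trans ?_
      rw [← SimpleFunc.iSup_eapprox_apply hg]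
      exact le_iSup (fun N => SimpleFunc.eapprox g N z) N
    · rw [← SimpleFunc.iSup_eapprox_apply hg]
      refine iSup_le fun N => ?_
      obtain ⟨M, hM⟩ := exists_nat_ge ‖z.2‖
      refine le_iSup_of_le (max N M) ?_
      have : z ∈ (Prod.snd ⁻¹' D (max N M) : Set (ι × Plane)) := by
        simp only [D, mem_preimage, mem_closedBall_zero_iff]
        exact hM.trans (by exact_mod_cast le_max_right N M)
      rw [hgN]
      dsimp only
      rw [indicator_of_mem this]
      exact SimpleFunc.monotone_eapprox g (le_max_left N M) z
  have hstep : ∀ N, ∫⁻ ω, nexp (∑' j : ι × ℕ, gN N (j.1, X j.1 j.2 ω)) ∂ν =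
      ∫⁻ ω, nexp (∫⁻ z, ρ ω z * (1 - nexp (gN N z)) ∂(Measure.count.prod volume)) ∂ν := by
    intro N
    -- The approximating function is constant on each of these finitely many disjoint bounded sets,
    -- so its sum over the points is a linear combination of counts.
    set B : ι × (φ N).range → Set Plane := fun a => D N ∩ {x | φ N (a.1, x) = a.2} with hBdef
    have hB : ∀ a, MeasurableSet (B a) := fun a => (hDm N).inter
      (((φ N).measurable.comp measurable_prodMk_left) (measurableSet_singleton _))
    have hBb : ∀ a, Bornology.IsBounded (B a) := fun a =>
      Metric.isBounded_closedBall.subset inter_subset_left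
    -- Used for two functions vanishing at `0`: the identity for the sum over the points, and `1 -
    -- nexp` for the intensity integral.
    have hrep : ∀ (ψ : ℝ≥0∞ → ℝ≥0∞), ψ 0 = 0 → ∀ p x, ψ (gN N (p, x)) =
        ∑ v : (φ N).range, (B (p, v)).indicator (fun _ => 1) x * ψ v := by
      intro ψ hψ p x
      by_cases hx : x ∈ D N
      · have h1 : gN N (p, x) = φ N (p, x) := indicator_of_mem (by exact hx) _
        rw [h1, Finset.sum_eq_single (⟨φ N (p, x), (φ N).mem_range_self _⟩ : (φ N).range)]
        · rw [indicator_of_mem (by exact ⟨hx, rfl⟩), one_mul]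
        · intro v _ hv
          rw [indicator_of_notMem, zero_mul]
          rintro ⟨-, h2⟩
          exact hv (Subtype.ext h2.symm)
        · simp
      · have h1 : gN N (p, x) = 0 := indicator_of_notMem (by exact hx) _
        rw [h1, hψ]
        refine (Finset.sum_eq_zero fun v _ => ?_).symm
        rw [indicator_of_notMem (fun h => hx h.1), zero_mul]
    have hl := h.lintegral_nexp_sum hX hΛm hΛf (A := ι × (φ N).range) (fun a => a.1) B hB hBb
      (by
        rintro ⟨p, v⟩ ⟨p', v'⟩ hne (rfl : p = p')
        refine Set.disjoint_left.2 fun x h1 h2 => hne ?_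
        have : (v : ℝ≥0∞) = v' := h1.2.symm.trans h2.2
        rw [Subtype.ext this]) (fun a => a.2)
    convert hl using 4 with ω ω
    · rw [ENNReal.tsum_prod', tsum_fintype, Fintype.sum_prod_type]
      refine Finset.sum_congr rfl fun p _ => ?_
      simp_rw [toENNReal_count, ← ENNReal.tsum_mul_right]
      rw [← Summable.tsum_finsetSum fun _ _ => ENNReal.summable]
      exact tsum_congr fun i => hrep id rfl p _
    · rw [lintegral_prod (fun z => ρ ω z * (1 - nexp (gN N z))) ((hρ' ω).mul
        (measurable_const.sub (measurable_nexp.comp (hgNm N)))).aemeasurable, lintegral_count,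
            tsum_fintype,
        Fintype.sum_prod_type]
      refine Finset.sum_congr rfl fun p _ => ?_
      simp_rw [hrep (fun v => 1 - nexp v) (by simp) p, Finset.mul_sum]
      rw [lintegral_finsetSum]
      · refine Finset.sum_congr rfl fun v _ => ?_
        rw [hΛapply _ _ _ (hB _), ← lintegral_mul_const _ ((hρp ω p).indicator (hB _))]
        refine lintegral_congr fun x => ?_
        by_cases hx : x ∈ B (p, v) <;> simp [hx]
      · intro v _
        exact (hρp ω p).mul ((measurable_const.indicator (hB _)).mul_const _)
  -- passage to the limit
  have hL : Tendsto (fun N => ∫⁻ ω, nexp (∑' j : ι × ℕ, gN N (j.1, X j.1 j.2 ω)) ∂ν) atTop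
      (𝓝 (∫⁻ ω, nexp (∑' j : ι × ℕ, g (j.1, X j.1 j.2 ω)) ∂ν)) := by
    refine tendsto_lintegral_of_dominated_convergence 1
      (fun N => measurable_nexp.comp (Measurable.tsum fun j => (hgNm N).comp (hy j)))
      (fun N => Eventually.of_forall fun ω => nexp_le_one _) (by simp)
      (Eventually.of_forall fun ω => (continuous_nexp.tendsto _).comp ?_)
    -- Sums over the points become integrals against `pointMeasure`, so that monotone convergence
    -- applies to them.
    simp_rw [← lintegral_pointMeasure (fun (j : ι × ℕ) ω => ((j.1, X j.1 j.2 ω) : ι × Plane)) ω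
      (hgNm _)]
    rw [← lintegral_pointMeasure (fun (j : ι × ℕ) ω => ((j.1, X j.1 j.2 ω) : ι × Plane)) ω hg]
    refine lintegral_tendsto_of_tendsto_of_monotone (fun N => (hgNm N).aemeasurable)
      (Eventually.of_forall fun z N M hNM => hmono hNM z) (Eventually.of_forall fun z => ?_)
    rw [← hsup z]
    exact tendsto_atTop_iSup fun N M hNM => hmono hNM z
  have hR : Tendsto (fun N => ∫⁻ ω, nexp (∫⁻ z, ρ ω z * (1 - nexp (gN N z))
      ∂(Measure.count.prod volume)) ∂ν) atTop
      (𝓝 (∫⁻ ω, nexp (∫⁻ z, ρ ω z * (1 - nexp (g z)) ∂(Measure.count.prod volume)) ∂ν)) := by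
    refine tendsto_lintegral_of_dominated_convergence 1
      (fun N => measurable_nexp.comp (Measurable.lintegral_prod_right'
        (f := fun q : Ω × (ι × Plane) => ρ q.1 q.2 * (1 - nexp (gN N q.2))) ?_))
      (fun N => Eventually.of_forall fun ω => nexp_le_one _) (by simp)
      (Eventually.of_forall fun ω => (continuous_nexp.tendsto _).comp ?_)
    · exact hρ.mul (measurable_const.sub (measurable_nexp.comp ((hgNm N).comp measurable_snd)))
    refine lintegral_tendsto_of_tendsto_of_monotone (fun N => ((hρ' ω).mul (measurable_const.sub
      (measurable_nexp.comp (hgNm N)))).aemeasurable)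
      (Eventually.of_forall fun z N M hNM => ?_) (Eventually.of_forall fun z => ?_)
    · exact mul_le_mul_right (tsub_le_tsub_left (nexp_antitone (hmono hNM z)) _) _
    · have h1 : Tendsto (fun N => gN N z) atTop (𝓝 (g z)) := by
        rw [← hsup z]
        exact tendsto_atTop_iSup fun N M hNM => hmono hNM z
      refine ENNReal.Tendsto.const_mul ?_ (Or.inr (ne_top_of_le_ne_top ENNReal.coe_ne_top (hC ω z)))
      exact ENNReal.Tendsto.sub tendsto_const_nhds ((continuous_nexp.tendsto _).comp h1)
        (Or.inl ENNReal.one_ne_top)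
  exact tendsto_nhds_unique hL (hR.congr fun N => (hstep N).symm)

end

end HetNet

/-! ### The Mecke formula from the Laplace functional -/

namespace HetNet

/-- This is `1 + x ≤ e^x` multiplied by `e^{-x}`. Together with `one_sub_nexp_le` it squeezes the
difference quotient of `1 - e^{-x}` at zero. -/
lemma mul_nexp_le_one_sub_nexp (x : ℝ≥0∞) : x * nexp x ≤ 1 - nexp x := by
  by_cases hx : x = ∞
  · simp [hx]
  have hx0 : 0 ≤ x.toReal := ENNReal.toReal_nonneg
  rw [nexp_eq_ofReal hx, ← ENNReal.ofReal_one, ← ENNReal.ofReal_sub _ (Real.exp_pos _).le]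
  nth_rewrite 1 [← ENNReal.ofReal_toReal hx]
  rw [← ENNReal.ofReal_mul hx0]
  refine ENNReal.ofReal_le_ofReal ?_
  have h1 := Real.add_one_le_exp x.toReal
  have h2 : Real.exp x.toReal * Real.exp (-x.toReal) = 1 := by rw [← Real.exp_add]; simp
  nlinarith [Real.exp_pos (-x.toReal)]

lemma tendsto_mul_one_sub_nexp {K δ : ℕ → ℝ≥0∞} (hK : Tendsto (fun n => K n * δ n) atTop (𝓝 1))
    (hδ : Tendsto δ atTop (𝓝 0)) {x : ℝ≥0∞} (hx : x ≠ ∞) :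
    Tendsto (fun n => K n * (1 - nexp (δ n * x))) atTop (𝓝 x) := by
  have hδx : Tendsto (fun n => δ n * x) atTop (𝓝 0) := by
    simpa using ENNReal.Tendsto.mul_const hδ (Or.inr hx)
  have hu : Tendsto (fun n => K n * δ n * x) atTop (𝓝 x) := by
    simpa using ENNReal.Tendsto.mul_const hK (Or.inr hx)
  have hl : Tendsto (fun n => K n * δ n * x * nexp (δ n * x)) atTop (𝓝 x) := by
    have h1 : Tendsto (fun n => nexp (δ n * x)) atTop (𝓝 1) := by
      simpa [Function.comp_def] using (continuous_nexp.tendsto 0).comp hδx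
    simpa using ENNReal.Tendsto.mul hu (Or.inr ENNReal.one_ne_top) h1 (Or.inr hx)
  refine tendsto_of_tendsto_of_tendsto_of_le_of_le hl hu (fun n => ?_) (fun n => ?_)
  · dsimp only
    rw [mul_assoc (K n), mul_assoc (K n)]
    exact mul_le_mul_right (mul_nexp_le_one_sub_nexp _) _
  · dsimp only
    rw [mul_assoc (K n)]
    exact mul_le_mul_right (one_sub_nexp_le _) _

/-- The difference quotients of the concave function `1 - e^{-εx}` increase as ε is halved: with `a
= nexp u` the step is `1 - a² ≤ 2 (1 - a)`. Dyadic ε thus allow monotone convergence. -/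
lemma monotone_two_pow_mul_one_sub_nexp (x : ℝ≥0∞) :
    Monotone fun n : ℕ => (2 : ℝ≥0∞) ^ n * (1 - nexp (2⁻¹ ^ n * x)) := by
  refine monotone_nat_of_le_succ fun n => ?_
  set u := (2⁻¹ : ℝ≥0∞) ^ (n + 1) * x with hu
  have h1 : (2⁻¹ : ℝ≥0∞) ^ n * x = u + u := by
    rw [hu, ← add_mul, pow_succ, ← mul_add, ENNReal.inv_two_add_inv_two, mul_one]
  rw [h1, nexp_add, pow_succ, mul_assoc]
  refine mul_le_mul_right ?_ _
  have h2 : 1 - nexp u * nexp u ≤ (1 - nexp u) + (1 - nexp u) := by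
    have h3 : nexp u * (1 - nexp u) = nexp u - nexp u * nexp u := by
      rw [nexp_mul_one_sub, nexp_add]
    have h4 : 1 - nexp u * nexp u = (1 - nexp u) + (nexp u - nexp u * nexp u) :=
      (tsub_add_tsub_cancel (nexp_le_one u) (mul_le_of_le_one_left' (nexp_le_one u))).symm
    rw [h4, ← h3]
    gcongr
    exact mul_le_of_le_one_left' (nexp_le_one u)
  rwa [two_mul]

lemma two_pow_mul_two_inv_pow (n : ℕ) : (2 : ℝ≥0∞) ^ n * 2⁻¹ ^ n = 1 := by
  rw [← mul_pow, ENNReal.mul_inv_cancel two_ne_zero ENNReal.ofNat_ne_top, one_pow]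

lemma tendsto_two_inv_pow : Tendsto (fun n : ℕ => (2⁻¹ : ℝ≥0∞) ^ n) atTop (𝓝 0) :=
  ENNReal.tendsto_pow_atTop_nhds_zero_of_lt_one (by simp)

lemma tendsto_two_pow_mul_one_sub_nexp (x : ℝ≥0∞) :
    Tendsto (fun n : ℕ => (2 : ℝ≥0∞) ^ n * (1 - nexp (2⁻¹ ^ n * x))) atTop (𝓝 x) := by
  by_cases hx : x = ∞
  · have : ∀ n : ℕ, (2⁻¹ : ℝ≥0∞) ^ n * ∞ = ∞ := fun n =>
      ENNReal.mul_top (pow_ne_zero _ (by simp))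
    simp only [hx, this, nexp_top, tsub_zero, mul_one]
    exact ENNReal.tendsto_pow_atTop_nhds_top_iff.2 (by norm_num)
  · exact tendsto_mul_one_sub_nexp (by simp [two_pow_mul_two_inv_pow]) tendsto_two_inv_pow hx

section Mecke

variable {J Ω Y : Type*} [Countable J] [MeasurableSpace Ω] [MeasurableSpace Y] {ν : Measure Ω}
  {y : J → Ω → Y} {κ : Measure Y} [SigmaFinite κ] {ρ : Ω → Y → ℝ≥0∞}

/-- As functions of `f`, both sides are integrals against measures `M₁` and `M₂` on `Y`. These agree
on sets of finite `κ`-measure, which exhaust `Y`. Hence a Mecke formula need only be checked for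
indicators of such sets. -/
lemma lintegral_tsum_eq_of_finite [SFinite ν] (hy : ∀ j, Measurable (y j))
    (hρ : Measurable (Function.uncurry ρ)) {H G : Ω → Y → ℝ≥0∞}
    (hH : Measurable (Function.uncurry H)) (hG : Measurable (Function.uncurry G))
    (hfin : ∀ B, MeasurableSet B → κ B ≠ ∞ →
      ∫⁻ ω, ∑' j, B.indicator 1 (y j ω) * H ω (y j ω) ∂ν =
        ∫⁻ ω, ∫⁻ z, ρ ω z * (B.indicator 1 z * G ω z) ∂κ ∂ν)
    {f : Y → ℝ≥0∞} (hf : Measurable f) :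
    ∫⁻ ω, ∑' j, f (y j ω) * H ω (y j ω) ∂ν = ∫⁻ ω, ∫⁻ z, ρ ω z * (f z * G ω z) ∂κ ∂ν := by
  have hHy : ∀ j, Measurable fun ω => H ω (y j ω) := fun j =>
    hH.comp (measurable_id.prodMk (hy j))
  have hRm : Measurable fun q : Y × Ω => ρ q.2 q.1 * G q.2 q.1 :=
    (hρ.comp measurable_swap).mul (hG.comp measurable_swap)
  set M₁ : Measure Y := Measure.sum fun j => (ν.withDensity fun ω => H ω (y j ω)).map (y j)
  set M₂ : Measure Y := κ.withDensity fun z => ∫⁻ ω, ρ ω z * G ω z ∂ν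
  have h1 : ∀ f : Y → ℝ≥0∞, Measurable f →
      ∫⁻ ω, ∑' j, f (y j ω) * H ω (y j ω) ∂ν = ∫⁻ z, f z ∂M₁ := by
    intro f hf
    rw [lintegral_tsum (f := fun j ω => f (y j ω) * H ω (y j ω))
      fun j => ((hf.comp (hy j)).mul (hHy j)).aemeasurable, lintegral_sum_measure]
    refine tsum_congr fun j => ?_
    have hfy : Measurable fun ω => f (y j ω) := hf.comp (hy j)
    rw [lintegral_map hf (hy j), lintegral_withDensity_eq_lintegral_mul _ (hHy j) hfy]
    exact lintegral_congr fun ω => mul_comm _ _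
  have h2 : ∀ f : Y → ℝ≥0∞, Measurable f →
      ∫⁻ ω, ∫⁻ z, ρ ω z * (f z * G ω z) ∂κ ∂ν = ∫⁻ z, f z ∂M₂ := by
    intro f hf
    rw [lintegral_withDensity_eq_lintegral_mul _ hRm.lintegral_prod_right' hf,
      lintegral_lintegral_swap]
    · refine lintegral_congr fun z => ?_
      have hz : Measurable fun ω => ρ ω z * G ω z := hRm.comp (measurable_prodMk_left (x := z))
      rw [Pi.mul_apply, ← lintegral_mul_const _ hz]
      exact lintegral_congr fun ω => by ring
    · exact (hρ.mul ((hf.comp measurable_snd).mul hG)).aemeasurable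
  rw [h1 f hf, h2 f hf]
  congr 1
  refine (Measure.ext_iff_of_iUnion_eq_univ (iUnion_spanningSets κ)).2 fun n => ?_
  refine Measure.ext fun B hB => ?_
  rw [Measure.restrict_apply hB, Measure.restrict_apply hB]
  have hBn := hB.inter (measurableSet_spanningSets κ n)
  have := hfin _ hBn (((measure_mono inter_subset_right).trans_lt
    (measure_spanningSets_lt_top κ n)).ne)
  rw [h1 _ (measurable_one.indicator hBn), h2 _ (measurable_one.indicator hBn),
    lintegral_indicator_one hBn, lintegral_indicator_one hBn] at this
  exact this

variable [IsFiniteMeasure ν]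

/-- The Laplace functional is differentiated at `g` in the direction of the indicator of `B`,
through the increments `2⁻¹ ^ n`. The derivative of the left side brings down the number of points
in `B`, that of the right side the integral over `B`. -/
lemma HasLaplace.mecke_indicator (h : HasLaplace ν y κ ρ) (hy : ∀ j, Measurable (y j))
    (hρ : Measurable (Function.uncurry ρ)) {C : ℝ≥0} (hC : ∀ ω z, ρ ω z ≤ C) {g : Y → ℝ≥0∞}
    (hg : Measurable g) {B : Set Y} (hB : MeasurableSet B) (hκB : κ B ≠ ∞) :
    ∫⁻ ω, (∑' j, B.indicator 1 (y j ω)) * nexp (∑' j, g (y j ω)) ∂ν =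
      ∫⁻ ω, (∫⁻ z, ρ ω z * (B.indicator 1 z * nexp (g z)) ∂κ) *
        nexp (∫⁻ z, ρ ω z * (1 - nexp (g z)) ∂κ) ∂ν := by
  set N : Ω → ℝ≥0∞ := fun ω => ∑' j, B.indicator 1 (y j ω) with hN
  set Φ : Ω → ℝ≥0∞ := fun ω => ∑' j, g (y j ω) with hΦ
  set b : Ω → ℝ≥0∞ := fun ω => ∫⁻ z, ρ ω z * (B.indicator 1 z * nexp (g z)) ∂κ with hb
  set A : Ω → ℝ≥0∞ := fun ω => ∫⁻ z, ρ ω z * (1 - nexp (g z)) ∂κ with hA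
  have h1B : Measurable (B.indicator (1 : Y → ℝ≥0∞)) := measurable_one.indicator hB
  have hNm : Measurable N := Measurable.tsum fun j => h1B.comp (hy j)
  have hΦm : Measurable Φ := Measurable.tsum fun j => hg.comp (hy j)
  have hbm : Measurable b := Measurable.lintegral_prod_right'
    (f := fun q : Ω × Y => ρ q.1 q.2 * (B.indicator 1 q.2 * nexp (g q.2)))
    (hρ.mul ((h1B.mul (measurable_nexp.comp hg)).comp measurable_snd))
  have hAm : Measurable A := Measurable.lintegral_prod_right'
    (f := fun q : Ω × Y => ρ q.1 q.2 * (1 - nexp (g q.2)))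
    (hρ.mul ((measurable_const.sub (measurable_nexp.comp hg)).comp measurable_snd))
  have hbC : ∀ ω, b ω ≤ C * κ B := by
    intro ω
    rw [← setLIntegral_const, ← lintegral_indicator hB]
    refine lintegral_mono fun z => ?_
    by_cases hz : z ∈ B
    · simp only [hz, indicator_of_mem, Pi.one_apply, one_mul]
      exact (mul_le_mul' (hC ω z) (nexp_le_one _)).trans (mul_one _).le
    · simp [hz]
  -- Since the indicator has values `0` and `1`, adding `2⁻¹ ^ n` on `B` changes the exponent by
  -- exactly `δ n * b ω`.
  set δ : ℕ → ℝ≥0∞ := fun n => 1 - nexp (2⁻¹ ^ n) with hδ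
  have hstep : ∀ n : ℕ, ∫⁻ ω, nexp (Φ ω) * (2 ^ n * (1 - nexp (2⁻¹ ^ n * N ω))) ∂ν =
      ∫⁻ ω, nexp (A ω) * (2 ^ n * (1 - nexp (δ n * b ω))) ∂ν := by
    intro n
    have hgn : Measurable fun z => g z + 2⁻¹ ^ n * B.indicator 1 z := hg.add (h1B.const_mul _)
    have e0 := h g hg
    have e1 := h _ hgn
    have hΦn : ∀ ω, ∑' j, (g (y j ω) + 2⁻¹ ^ n * B.indicator 1 (y j ω)) = Φ ω + 2⁻¹ ^ n * N ω := by
      intro ω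
      rw [ENNReal.tsum_add, ENNReal.tsum_mul_left]
    have hAn : ∀ ω, ∫⁻ z, ρ ω z * (1 - nexp (g z + 2⁻¹ ^ n * B.indicator 1 z)) ∂κ =
        A ω + δ n * b ω := by
      intro ω
      have hρω : Measurable (ρ ω) := hρ.of_uncurry_left
      have m1 : Measurable fun z => ρ ω z * (B.indicator 1 z * nexp (g z)) :=
        hρω.mul (h1B.mul (measurable_nexp.comp hg))
      rw [hb, hA]
      dsimp only
      rw [← lintegral_const_mul _ m1, ← lintegral_add_right _ (m1.const_mul _)]
      refine lintegral_congr fun z => ?_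
      have : 1 - nexp (g z + 2⁻¹ ^ n * B.indicator 1 z) =
          (1 - nexp (g z)) + δ n * (B.indicator 1 z * nexp (g z)) := by
        rw [← tsub_add_tsub_cancel (nexp_le_one (g z)) (nexp_antitone le_self_add),
          ← nexp_mul_one_sub]
        by_cases hz : z ∈ B <;> simp [hz, hδ, mul_comm]
      rw [this]
      ring
    simp_rw [hΦn, hAn] at e1
    have hsub : ∀ (a d : Ω → ℝ≥0∞), Measurable a → Measurable d →
        ∫⁻ ω, nexp (a ω) * (2 ^ n * (1 - nexp (d ω))) ∂ν =
          2 ^ n * (∫⁻ ω, nexp (a ω) ∂ν - ∫⁻ ω, nexp (a ω + d ω) ∂ν) := by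
      intro a d ha hd
      have hm : Measurable fun ω => nexp (a ω + d ω) := by fun_prop
      have hm' : Measurable fun ω => nexp (a ω) := by fun_prop
      have hm'' : Measurable fun ω => nexp (a ω) - nexp (a ω + d ω) := hm'.sub hm
      rw [← lintegral_sub hm, ← lintegral_const_mul _ hm'']
      · refine lintegral_congr fun ω => ?_
        rw [← nexp_mul_one_sub]
        ring
      · refine ne_top_of_le_ne_top (measure_ne_top ν univ) ?_
        rw [← lintegral_one]
        exact lintegral_mono fun ω => nexp_le_one _
      · exact Eventually.of_forall fun ω => nexp_antitone le_self_add
    rw [hsub Φ _ hΦm (hNm.const_mul _), hsub A _ hAm (hbm.const_mul _), e1, e0]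
  -- Integrability of the number `N` of points in `B` is not yet available, so this side uses
  -- monotone convergence; on the other side `b` is bounded by `C * κ B` and dominated convergence
  -- applies.
  have hl : Tendsto (fun n : ℕ => ∫⁻ ω, nexp (Φ ω) * (2 ^ n * (1 - nexp (2⁻¹ ^ n * N ω))) ∂ν)
      atTop (𝓝 (∫⁻ ω, nexp (Φ ω) * N ω ∂ν)) := by
    refine lintegral_tendsto_of_tendsto_of_monotone (fun n => ?_)
      (Eventually.of_forall fun ω n m hnm => ?_) (Eventually.of_forall fun ω => ?_)
    · fun_prop
    · exact mul_le_mul_right (monotone_two_pow_mul_one_sub_nexp (N ω) hnm) _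
    · exact ENNReal.Tendsto.const_mul (tendsto_two_pow_mul_one_sub_nexp _) (Or.inr (nexp_ne_top _))
  have hδ1 : Tendsto (fun n : ℕ => 2 ^ n * δ n) atTop (𝓝 1) := by
    simpa using tendsto_two_pow_mul_one_sub_nexp 1
  have hδ0 : Tendsto δ atTop (𝓝 0) :=
    tendsto_of_tendsto_of_tendsto_of_le_of_le tendsto_const_nhds tendsto_two_inv_pow
      (fun _ => zero_le) (fun n => one_sub_nexp_le _)
  have hr : Tendsto (fun n : ℕ => ∫⁻ ω, nexp (A ω) * (2 ^ n * (1 - nexp (δ n * b ω))) ∂ν)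
      atTop (𝓝 (∫⁻ ω, nexp (A ω) * b ω ∂ν)) := by
    refine tendsto_lintegral_of_dominated_convergence (fun _ => C * κ B) (fun n => by fun_prop)
      (fun n => Eventually.of_forall fun ω => ?_) ?_ (Eventually.of_forall fun ω => ?_)
    · calc nexp (A ω) * (2 ^ n * (1 - nexp (δ n * b ω))) ≤ 1 * (2 ^ n * (2⁻¹ ^ n * b ω)) := by
            gcongr
            · exact nexp_le_one _
            · exact (one_sub_nexp_le _).trans (mul_le_mul_left (one_sub_nexp_le _) _)
        _ = b ω := by rw [one_mul, ← mul_assoc, two_pow_mul_two_inv_pow, one_mul]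
        _ ≤ _ := hbC ω
    · rw [lintegral_const]
      exact ENNReal.mul_ne_top (ENNReal.mul_ne_top ENNReal.coe_ne_top hκB) (measure_ne_top _ _)
    · refine ENNReal.Tendsto.const_mul ?_ (Or.inr (nexp_ne_top _))
      exact tendsto_mul_one_sub_nexp hδ1 hδ0
        (ne_top_of_le_ne_top (ENNReal.mul_ne_top ENNReal.coe_ne_top hκB) (hbC ω))
  have := tendsto_nhds_unique hl (hr.congr fun n => (hstep n).symm)
  calc _ = ∫⁻ ω, nexp (Φ ω) * N ω ∂ν := lintegral_congr fun ω => mul_comm _ _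
    _ = ∫⁻ ω, nexp (A ω) * b ω ∂ν := this
    _ = _ := lintegral_congr fun ω => mul_comm _ _

/-- The Mecke formula for functionals `f(x) exp (-∑ g(x, ·))`. -/
structure MeckeHolds (ν : Measure Ω) (y : J → Ω → Y) (κ : Measure Y) (ρ : Ω → Y → ℝ≥0∞)
    (g : Y → Y → ℝ≥0∞) : Prop where
  measurable : Measurable (Function.uncurry g)
  eq : ∀ f : Y → ℝ≥0∞, Measurable f →
    ∫⁻ ω, ∑' j, f (y j ω) * nexp (∑' i, g (y j ω) (y i ω)) ∂ν =
      ∫⁻ ω, ∫⁻ z, ρ ω z * (f z * (nexp (g z z) *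
        nexp (∫⁻ w, ρ ω w * (1 - nexp (g z w)) ∂κ))) ∂κ ∂ν

/-- The base case of the constructions below. The factor `nexp (g z z)` in `MeckeHolds` is there
because the inner sum on the left includes the selected point itself. -/
lemma HasLaplace.meckeHolds_const (h : HasLaplace ν y κ ρ) (hy : ∀ j, Measurable (y j))
    (hρ : Measurable (Function.uncurry ρ)) {C : ℝ≥0} (hC : ∀ ω z, ρ ω z ≤ C) {g : Y → ℝ≥0∞}
    (hg : Measurable g) : MeckeHolds ν y κ ρ fun _ w => g w := by
  refine ⟨hg.comp measurable_snd, fun f hf => ?_⟩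
  have hA : Measurable fun ω => ∫⁻ w, ρ ω w * (1 - nexp (g w)) ∂κ :=
    Measurable.lintegral_prod_right' (f := fun q : Ω × Y => ρ q.1 q.2 * (1 - nexp (g q.2)))
      (hρ.mul ((measurable_const.sub (measurable_nexp.comp hg)).comp measurable_snd))
  refine lintegral_tsum_eq_of_finite hy hρ (H := fun ω _ => nexp (∑' i, g (y i ω)))
    (G := fun ω z => nexp (g z) * nexp (∫⁻ w, ρ ω w * (1 - nexp (g w)) ∂κ)) ?_ ?_ ?_ hf
  · have hS : Measurable fun ω => ∑' i, g (y i ω) := Measurable.tsum fun i => hg.comp (hy i)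
    exact (measurable_nexp.comp hS).comp measurable_fst
  · exact ((measurable_nexp.comp hg).comp measurable_snd).mul
      ((measurable_nexp.comp hA).comp measurable_fst)
  · intro B hB hκ
    have e := h.mecke_indicator hy hρ hC hg hB hκ
    simp_rw [ENNReal.tsum_mul_right]
    rw [e]
    refine lintegral_congr fun ω => ?_
    have hm : Measurable fun z => ρ ω z * (B.indicator 1 z * nexp (g z)) :=
      hρ.of_uncurry_left.mul ((measurable_one.indicator hB).mul (measurable_nexp.comp hg))
    rw [← lintegral_mul_const _ hm]
    exact lintegral_congr fun z => by ring

omit [IsFiniteMeasure ν] in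
lemma measurable_mecke_left (hy : ∀ j, Measurable (y j)) {g : Y → Y → ℝ≥0∞}
    (hg : Measurable (Function.uncurry g)) :
    Measurable (Function.uncurry fun (ω : Ω) (z : Y) => nexp (∑' i, g z (y i ω))) := by
  refine measurable_nexp.comp (Measurable.tsum fun i => ?_)
  exact hg.comp (measurable_snd.prodMk ((hy i).comp measurable_fst))

lemma measurable_mecke_right (hρ : Measurable (Function.uncurry ρ)) {g : Y → Y → ℝ≥0∞}
    (hg : Measurable (Function.uncurry g)) :
    Measurable (Function.uncurry fun (ω : Ω) (z : Y) => nexp (g z z) *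
        nexp (∫⁻ w, ρ ω w * (1 - nexp (g z w)) ∂κ)) := by
  refine Measurable.mul (measurable_nexp.comp (hg.comp (measurable_snd.prodMk measurable_snd)))
    (measurable_nexp.comp ?_)
  refine Measurable.lintegral_prod_right'
    (f := fun q : (Ω × Y) × Y => ρ q.1.1 q.2 * (1 - nexp (g q.1.2 q.2))) ?_
  refine Measurable.mul (hρ.comp ((measurable_fst.comp measurable_fst).prodMk measurable_snd))
    (measurable_const.sub (measurable_nexp.comp ?_))
  exact hg.comp ((measurable_snd.comp measurable_fst).prodMk measurable_snd)

omit [IsFiniteMeasure ν] in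
-- Both sides are additive in `f`, so `f` is split into its restrictions to `S` and to the
-- complement, where `g` equals `g₁` and `g₂` respectively.
lemma MeckeHolds.ite (hy : ∀ j, Measurable (y j)) (hρ : Measurable (Function.uncurry ρ))
    {g₁ g₂ : Y → Y → ℝ≥0∞} (h₁ : MeckeHolds ν y κ ρ g₁) (h₂ : MeckeHolds ν y κ ρ g₂)
    {S : Set Y} (hS : MeasurableSet S) [DecidablePred (· ∈ S)] :
    MeckeHolds ν y κ ρ fun z w => if z ∈ S then g₁ z w else g₂ z w := by
  refine ⟨Measurable.ite (measurable_fst hS) h₁.measurable h₂.measurable, fun f hf => ?_⟩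
  have e₁ := h₁.eq _ (hf.indicator hS)
  have e₂ := h₂.eq _ (hf.indicator hS.compl)
  have m₁ : Measurable fun ω => ∑' j, S.indicator f (y j ω) *
      nexp (∑' i, g₁ (y j ω) (y i ω)) := Measurable.tsum fun j =>
    ((hf.indicator hS).comp (hy j)).mul
      ((measurable_mecke_left hy h₁.measurable).comp (measurable_id.prodMk (hy j)))
  have n₁ : Measurable (Function.uncurry fun ω z => ρ ω z * (S.indicator f z * (nexp (g₁ z z) *
        nexp (∫⁻ w, ρ ω w * (1 - nexp (g₁ z w)) ∂κ)))) :=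
    hρ.mul (((hf.indicator hS).comp measurable_snd).mul (measurable_mecke_right hρ h₁.measurable))
  have n₁' : Measurable fun ω => ∫⁻ z, ρ ω z * (S.indicator f z * (nexp (g₁ z z) *
        nexp (∫⁻ w, ρ ω w * (1 - nexp (g₁ z w)) ∂κ))) ∂κ := n₁.lintegral_prod_right'
  calc _ = ∫⁻ ω, (∑' j, S.indicator f (y j ω) * nexp (∑' i, g₁ (y j ω) (y i ω))) +
        ∑' j, Sᶜ.indicator f (y j ω) * nexp (∑' i, g₂ (y j ω) (y i ω)) ∂ν := by
        refine lintegral_congr fun ω => ?_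
        rw [← ENNReal.tsum_add]
        refine tsum_congr fun j => ?_
        by_cases hj : y j ω ∈ S <;> simp [hj]
    _ = _ := by
        rw [lintegral_add_left m₁, e₁, e₂, ← lintegral_add_left n₁']
        refine lintegral_congr fun ω => ?_
        rw [← lintegral_add_left n₁.of_uncurry_left]
        refine lintegral_congr fun z => ?_
        by_cases hz : z ∈ S <;> simp [hz]

/-- After reduction to `f` the indicator of a set `B` of finite measure, dominated convergence
applies on both sides. The dominating quantity is the number of points in `B`, respectively its
intensity; the mean of the former is finite by the formula for `g = 0`. -/
lemma MeckeHolds.iSup (h0 : HasLaplace ν y κ ρ) (hy : ∀ j, Measurable (y j))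
    (hρ : Measurable (Function.uncurry ρ)) {C : ℝ≥0} (hC : ∀ ω z, ρ ω z ≤ C)
    {g : ℕ → Y → Y → ℝ≥0∞} (h : ∀ n, MeckeHolds ν y κ ρ (g n)) (hmono : Monotone g) :
    MeckeHolds ν y κ ρ fun z w => ⨆ n, g n z w := by
  have hgm : Measurable (Function.uncurry fun z w => ⨆ n, g n z w) :=
    Measurable.iSup fun n => (h n).measurable
  refine ⟨hgm, fun f hf => ?_⟩
  refine lintegral_tsum_eq_of_finite hy hρ (measurable_mecke_left hy hgm)
    (measurable_mecke_right hρ hgm) (fun B hB hκB => ?_) hf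
  have h1B : Measurable (B.indicator (1 : Y → ℝ≥0∞)) := measurable_one.indicator hB
  have hgl : ∀ z w, Tendsto (fun n => g n z w) atTop (𝓝 (⨆ n, g n z w)) := fun z w =>
    tendsto_atTop_iSup fun n m hnm => hmono hnm z w
  have hgz : ∀ n z, Measurable (g n z) := fun n z => (h n).measurable.of_uncurry_left
  have hgz' : ∀ z, Measurable fun w => ⨆ n, g n z w := fun z => Measurable.iSup fun n => hgz n z
  have hρω : ∀ ω, Measurable (ρ ω) := fun ω => hρ.of_uncurry_left
  have hfin : ∫⁻ ω, ∫⁻ z, ρ ω z * B.indicator 1 z ∂κ ∂ν ≠ ∞ := by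
    refine ne_top_of_le_ne_top (b := ∫⁻ ω, C * κ B ∂ν) ?_ (lintegral_mono fun ω => ?_)
    · rw [lintegral_const]
      exact ENNReal.mul_ne_top (ENNReal.mul_ne_top ENNReal.coe_ne_top hκB) (measure_ne_top _ _)
    · rw [← lintegral_indicator_one hB, ← lintegral_const_mul _ h1B]
      exact lintegral_mono fun z => mul_le_mul_left (hC ω z) _
  have hfinN : ∫⁻ ω, ∑' j, B.indicator 1 (y j ω) ∂ν ≠ ∞ := by
    have := (h0.meckeHolds_const hy hρ hC (measurable_const (a := (0 : ℝ≥0∞)))).eq _ h1B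
    simp only [tsum_zero, nexp_zero, mul_one, tsub_self, mul_zero, lintegral_zero] at this
    rwa [this]
  have hl : Tendsto (fun n => ∫⁻ ω, ∑' j, B.indicator 1 (y j ω) *
      nexp (∑' i, g n (y j ω) (y i ω)) ∂ν) atTop
      (𝓝 (∫⁻ ω, ∑' j, B.indicator 1 (y j ω) * nexp (∑' i, ⨆ n, g n (y j ω) (y i ω)) ∂ν)) := by
    refine tendsto_lintegral_of_dominated_convergence (fun ω => ∑' j, B.indicator 1 (y j ω))
      (fun n => Measurable.tsum fun j => (h1B.comp (hy j)).mul
        ((measurable_mecke_left hy (h n).measurable).comp (measurable_id.prodMk (hy j))))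
      (fun n => Eventually.of_forall fun ω => ENNReal.tsum_le_tsum fun j =>
        mul_le_of_le_one_right' (nexp_le_one _)) hfinN ?_
    have hfinω : ∀ᵐ ω ∂ν, ∑' j, B.indicator (1 : Y → ℝ≥0∞) (y j ω) < ∞ :=
      ae_lt_top (Measurable.tsum fun j => h1B.comp (hy j)) hfinN
    filter_upwards [hfinω] with ω hω
    have hm : ∀ n, Measurable fun z => B.indicator (1 : Y → ℝ≥0∞) z *
        nexp (∑' i, g n z (y i ω)) := fun n =>
      h1B.mul (measurable_mecke_left hy (h n).measurable).of_uncurry_left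
    have hm' : Measurable fun z => B.indicator (1 : Y → ℝ≥0∞) z *
        nexp (∑' i, ⨆ n, g n z (y i ω)) :=
      h1B.mul (measurable_mecke_left hy hgm).of_uncurry_left
    simp_rw [← lintegral_pointMeasure y ω (hm _)]
    rw [← lintegral_pointMeasure y ω hm']
    refine tendsto_lintegral_of_dominated_convergence (B.indicator 1) hm
      (fun n => Eventually.of_forall fun z => mul_le_of_le_one_right' (nexp_le_one _)) ?_
      (Eventually.of_forall fun z => ?_)
    · rw [lintegral_pointMeasure y ω h1B]
      exact hω.ne
    · refine ENNReal.Tendsto.const_mul ((continuous_nexp.tendsto _).comp ?_)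
        (Or.inr (by by_cases hz : z ∈ B <;> simp [hz]))
      simp_rw [← lintegral_pointMeasure y ω (hgz _ z)]
      rw [← lintegral_pointMeasure y ω (hgz' z)]
      exact lintegral_tendsto_of_tendsto_of_monotone (fun n => (hgz n z).aemeasurable)
        (Eventually.of_forall fun w n m hnm => hmono hnm z w)
        (Eventually.of_forall fun w => hgl z w)
  have hr : Tendsto (fun n => ∫⁻ ω, ∫⁻ z, ρ ω z * (B.indicator 1 z * (nexp (g n z z) *
      nexp (∫⁻ w, ρ ω w * (1 - nexp (g n z w)) ∂κ))) ∂κ ∂ν) atTop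
      (𝓝 (∫⁻ ω, ∫⁻ z, ρ ω z * (B.indicator 1 z * (nexp (⨆ n, g n z z) *
      nexp (∫⁻ w, ρ ω w * (1 - nexp (⨆ n, g n z w)) ∂κ))) ∂κ ∂ν)) := by
    have hb : ∀ n ω z, ρ ω z * (B.indicator 1 z * (nexp (g n z z) *
        nexp (∫⁻ w, ρ ω w * (1 - nexp (g n z w)) ∂κ))) ≤ ρ ω z * B.indicator 1 z := fun n ω z =>
      mul_le_mul_right (mul_le_of_le_one_right'
        (mul_le_one' (nexp_le_one _) (nexp_le_one _))) _
    have hFm : ∀ n, Measurable (Function.uncurry fun ω z => ρ ω z * (B.indicator 1 z *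
        (nexp (g n z z) * nexp (∫⁻ w, ρ ω w * (1 - nexp (g n z w)) ∂κ)))) := fun n =>
      hρ.mul ((h1B.comp measurable_snd).mul (measurable_mecke_right hρ (h n).measurable))
    have hρB : Measurable fun ω => ∫⁻ z, ρ ω z * B.indicator 1 z ∂κ :=
      Measurable.lintegral_prod_right' (f := fun q : Ω × Y => ρ q.1 q.2 * B.indicator 1 q.2)
        (hρ.mul (h1B.comp measurable_snd))
    refine tendsto_lintegral_of_dominated_convergence (fun ω => ∫⁻ z, ρ ω z * B.indicator 1 z ∂κ)
      (fun n => (hFm n).lintegral_prod_right')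
      (fun n => Eventually.of_forall fun ω => lintegral_mono fun z => hb n ω z) hfin ?_
    filter_upwards [ae_lt_top hρB hfin] with ω hω
    refine tendsto_lintegral_of_dominated_convergence (fun z => ρ ω z * B.indicator 1 z)
      (fun n => (hFm n).of_uncurry_left) (fun n => Eventually.of_forall fun z => hb n ω z) hω.ne
      (Eventually.of_forall fun z => ?_)
    refine ENNReal.Tendsto.const_mul (ENNReal.Tendsto.const_mul (ENNReal.Tendsto.mul
      ((continuous_nexp.tendsto _).comp (hgl z z)) (Or.inr (nexp_ne_top _))
      ((continuous_nexp.tendsto _).comp ?_) (Or.inr (nexp_ne_top _)))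
      (Or.inr (by by_cases hz : z ∈ B <;> simp [hz])))
      (Or.inr (ne_top_of_le_ne_top ENNReal.coe_ne_top (hC ω z)))
    refine lintegral_tendsto_of_tendsto_of_monotone (fun n => ((hρω ω).mul (measurable_const.sub
      (measurable_nexp.comp (hgz n z)))).aemeasurable)
      (Eventually.of_forall fun w n m hnm => ?_) (Eventually.of_forall fun w => ?_)
    · exact mul_le_mul_right (tsub_le_tsub_left (nexp_antitone (hmono hnm z w)) _) _
    · refine ENNReal.Tendsto.const_mul ?_ (Or.inr (ne_top_of_le_ne_top ENNReal.coe_ne_top (hC ω w)))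
      exact ENNReal.Tendsto.sub tendsto_const_nhds ((continuous_nexp.tendsto _).comp (hgl z w))
        (Or.inl ENNReal.one_ne_top)
  exact tendsto_nhds_unique hl (hr.congr fun n => ((h n).eq _ h1B).symm)

/-- The Mecke formula for `g(x, z) = u(z) + v(z) 1_O(x, z)`, where `O` is a countable union of
measurable rectangles. -/
lemma HasLaplace.meckeHolds_rectangles (h0 : HasLaplace ν y κ ρ) (hy : ∀ j, Measurable (y j))
    (hρ : Measurable (Function.uncurry ρ)) {C : ℝ≥0} (hC : ∀ ω z, ρ ω z ≤ C)
    {u v : Y → ℝ≥0∞} (hu : Measurable u) (hv : Measurable v) {A B : ℕ → Set Y}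
    (hA : ∀ n, MeasurableSet (A n)) (hB : ∀ n, MeasurableSet (B n)) :
    MeckeHolds ν y κ ρ fun z w => u w + {w | ∃ n, z ∈ A n ∧ w ∈ B n}.indicator v w := by
  classical
  -- The set `E` is carried through the induction because the last rectangle is removed by a case
  -- distinction on `z`: for `z ∈ A n` it adds the set `B n`, which does not depend on `z` and is
  -- absorbed into `E`.
  have hfin : ∀ n, ∀ E : Set Y, MeasurableSet E → MeckeHolds ν y κ ρ fun z w =>
      u w + (E ∪ {w | ∃ m < n, z ∈ A m ∧ w ∈ B m}).indicator v w := by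
    intro n
    induction n with
    | zero =>
      intro E hE
      simpa using h0.meckeHolds_const hy hρ hC (hu.add (hv.indicator hE))
    | succ n ih =>
      intro E hE
      have := MeckeHolds.ite hy hρ (ih (E ∪ B n) (hE.union (hB n))) (ih E hE) (hA n)
      convert this using 3 with z w
      have hset : ∀ z, (E ∪ {w | ∃ m < n + 1, z ∈ A m ∧ w ∈ B m}) = if z ∈ A n then
          (E ∪ B n) ∪ {w | ∃ m < n, z ∈ A m ∧ w ∈ B m}
          else E ∪ {w | ∃ m < n, z ∈ A m ∧ w ∈ B m} := by
        intro z
        split_ifs with hz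
        · ext w
          simp only [mem_union, mem_ofPred_eq, Nat.lt_succ_iff_lt_or_eq]
          grind
        · ext w
          simp only [mem_union, mem_ofPred_eq, Nat.lt_succ_iff_lt_or_eq]
          grind
      rw [hset]
      split_ifs <;> rfl
  have := MeckeHolds.iSup h0 hy hρ hC (fun n => hfin n ∅ MeasurableSet.empty) ?_
  · convert this using 3 with z w
    rw [← ENNReal.add_iSup]
    congr 1
    by_cases hw : ∃ n, z ∈ A n ∧ w ∈ B n
    · rw [indicator_of_mem (by exact hw)]
      obtain ⟨n, hn⟩ := hw
      refine le_antisymm (le_iSup_of_le (n + 1) ?_) (iSup_le fun m => indicator_le_self _ _ _)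
      rw [indicator_of_mem]
      exact Or.inr ⟨n, n.lt_succ_self, hn⟩
    · rw [indicator_of_notMem (by exact hw)]
      refine (iSup_eq_bot.2 fun m => ?_).symm
      rw [indicator_of_notMem]
      · rfl
      · rintro (h | ⟨n, -, hn⟩)
        · exact h
        · exact hw ⟨n, hn⟩
  · intro n m hnm z w
    refine add_le_add le_rfl (indicator_le_indicator_of_subset ?_ (fun _ => zero_le) w)
    rintro w (h | ⟨k, hk, hh⟩)
    · exact Or.inl h
    · exact Or.inr ⟨k, hk.trans_le hnm, hh⟩

end Mecke
end HetNet

/-! ### Integrating out the exponential fading -/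

namespace HetNet

lemma lintegral_expMeasure_one (g : ℝ → ℝ≥0∞) (hg : Measurable g) :
    ∫⁻ x, g x ∂expMeasure 1 = ∫⁻ x, exponentialPDF 1 x * g x := by
  have hm : Measurable (exponentialPDF 1) :=
    (measurable_exponentialPDFReal 1).ennreal_ofReal
  rw [show expMeasure 1 = volume.withDensity (exponentialPDF 1) from rfl,
    lintegral_withDensity_eq_lintegral_mul _ hm hg]
  rfl

/-- The integrand `e^{-x} e^{-cx}` is `(1 + c)⁻¹` times the exponential density of rate `1 + c`. -/
lemma lintegral_nexp_expMeasure_one {c : ℝ≥0∞} (hc : c ≠ ∞) :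
    ∫⁻ x, nexp (c * ENNReal.ofReal x) ∂expMeasure 1 = (1 + c)⁻¹ := by
  rw [lintegral_expMeasure_one _ (by fun_prop)]
  set a := c.toReal with ha
  have ha0 : 0 ≤ a := ENNReal.toReal_nonneg
  have hca : c = ENNReal.ofReal a := (ENNReal.ofReal_toReal hc).symm
  have hinv : (1 + c)⁻¹ = ENNReal.ofReal (1 + a)⁻¹ := by
    rw [hca, ← ENNReal.ofReal_one, ← ENNReal.ofReal_add zero_le_one ha0,
      ENNReal.ofReal_inv_of_pos (by linarith)]
  have hx : ∀ x, exponentialPDF 1 x * nexp (c * ENNReal.ofReal x) =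
      (1 + c)⁻¹ * exponentialPDF (1 + a) x := by
    intro x
    rcases lt_or_ge x 0 with h | h
    · rw [exponentialPDF_of_neg h, exponentialPDF_of_neg h, zero_mul, mul_zero]
    · rw [exponentialPDF_of_nonneg h, exponentialPDF_of_nonneg h, hinv, hca,
        ← ENNReal.ofReal_mul ha0, nexp_ofReal (by positivity), ← ENNReal.ofReal_mul (by positivity),
        ← ENNReal.ofReal_mul (by positivity), one_mul, one_mul, ← Real.exp_add, ← mul_assoc,
        inv_mul_cancel₀ (by positivity), one_mul]
      congr 2
      ring
  have hm : Measurable (exponentialPDF (1 + a)) :=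
    (measurable_exponentialPDFReal (1 + a)).ennreal_ofReal
  simp_rw [hx]
  rw [lintegral_const_mul _ hm, lintegral_exponentialPDF_eq_one (by linarith), mul_one]

/-- The exponential tail. It makes the probability of being connected, given everything except the
gain of the serving link, an exponential of noise plus interference. -/
lemma expMeasure_one_le_ofReal (z : ℝ≥0∞) : expMeasure 1 {x | z ≤ ENNReal.ofReal x} = nexp z := by
  have := isProbabilityMeasure_expMeasure zero_lt_one
  by_cases hz : z = ∞
  · have : {x : ℝ | z ≤ ENNReal.ofReal x} = ∅ := by
      ext x
      simp [hz]
    rw [this, hz]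
    simp
  -- For `z = 0` the event is the whole line, since `ENNReal.ofReal` sends negative numbers to `0`;
  -- it is not the half-line used below.
  obtain rfl | hz0 := eq_or_ne z 0
  · simp
  have hpos : 0 < z.toReal := ENNReal.toReal_pos hz0 hz
  have hset : {x : ℝ | z ≤ ENNReal.ofReal x} = Ici z.toReal := by
    ext x
    rw [mem_ofPred_eq, mem_Ici]
    conv_lhs => rw [← ENNReal.ofReal_toReal hz]
    exact ENNReal.ofReal_le_ofReal_iff' |>.trans ⟨fun h => h.elim id fun h => absurd h hpos.not_ge,
        Or.inl⟩
  rw [hset, ← lintegral_indicator_one measurableSet_Ici,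
    lintegral_expMeasure_one _ (measurable_one.indicator measurableSet_Ici)]
  have : ∀ x, exponentialPDF 1 x * (Ici z.toReal).indicator 1 x =
      (Ici z.toReal).indicator (fun x => ENNReal.ofReal (Real.exp (-x))) x := by
    intro x
    by_cases hx : x ∈ Ici z.toReal
    · simp [hx, exponentialPDF_of_nonneg (hpos.le.trans hx)]
    · simp [hx]
  simp_rw [this]
  rw [lintegral_indicator measurableSet_Ici, setLIntegral_congr Ioi_ae_eq_Ici.symm,
    ← ofReal_integral_eq_lintegral_ofReal, integral_exp_neg_Ioi, nexp_eq_ofReal hz]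
  · simpa [IntegrableOn] using exp_neg_integrableOn_Ioi z.toReal zero_lt_one
  · exact Eventually.of_forall fun x => (Real.exp_pos _).le

section Fading

variable {N Ω S : Type*} [Countable N] [MeasurableSpace Ω] [MeasurableSpace S] {P : Measure Ω}
  [IsProbabilityMeasure P] {h : N → Ω → ℝ}

/-- Independence factors the transform over finite subfamilies; partial sums over finite sets
converge and `nexp` is bounded by one. -/
lemma lintegral_nexp_tsum_fading (hm : ∀ l, Measurable (h l))
    (hlaw : ∀ l, P.map (h l) = expMeasure 1) (hind : iIndepFun h P) {c : N → ℝ≥0∞}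
    (hc : ∀ l, c l ≠ ∞) :
    ∫⁻ ω, nexp (∑' l, c l * ENNReal.ofReal (h l ω)) ∂P = nexp (∑' l, logAdd (c l)) := by
  have hcm : ∀ l, Measurable fun x => nexp (c l * ENNReal.ofReal x) := fun l => by fun_prop
  have hfin : ∀ s : Finset N, ∫⁻ ω, nexp (∑ l ∈ s, c l * ENNReal.ofReal (h l ω)) ∂P =
      nexp (∑ l ∈ s, logAdd (c l)) := by
    intro s
    simp_rw [nexp_sum, nexp_logAdd]
    rw [lintegral_prod_eq_prod_lintegral_of_indepFun s (fun l ω => nexp (c l * ENNReal.ofReal (h l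
        ω)))
      (hind.comp _ hcm) fun l => (hcm l).comp (hm l)]
    refine Finset.prod_congr rfl fun l _ => ?_
    rw [← lintegral_nexp_expMeasure_one (hc l), ← hlaw l, lintegral_map (hcm l) (hm l)]
  have hl : Tendsto (fun s : Finset N => ∫⁻ ω, nexp (∑ l ∈ s, c l * ENNReal.ofReal (h l ω)) ∂P)
      atTop (𝓝 (∫⁻ ω, nexp (∑' l, c l * ENNReal.ofReal (h l ω)) ∂P)) := by
    refine tendsto_lintegral_filter_of_dominated_convergence 1
      (Eventually.of_forall fun s => by fun_prop)
      (Eventually.of_forall fun s => Eventually.of_forall fun ω => nexp_le_one _) (by simp)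
      (Eventually.of_forall fun ω => (continuous_nexp.tendsto _).comp ENNReal.summable.hasSum)
  refine tendsto_nhds_unique hl ?_
  simp_rw [hfin]
  exact (continuous_nexp.tendsto _).comp ENNReal.summable.hasSum

omit [Countable N] in
-- Fubini for the product of the laws of the gains and of the locations: the locations can be frozen
-- while the gains are averaged.
lemma lintegral_comp_fading_loc (hm : ∀ l, Measurable (h l)) {X : Ω → S} (hX : Measurable X)
    (hind : IndepFun (fun ω l => h l ω) X P) {F : (N → ℝ) → S → ℝ≥0∞}
    (hF : Measurable (Function.uncurry F)) :
    ∫⁻ ω, F (fun l => h l ω) (X ω) ∂P = ∫⁻ ω, ∫⁻ ω', F (fun l => h l ω') (X ω) ∂P ∂P := by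
  have hh : Measurable fun ω l => h l ω := measurable_pi_lambda _ hm
  have e := (indepFun_iff_map_prod_eq_prod_map_map hh.aemeasurable hX.aemeasurable).1 hind
  calc _ = ∫⁻ q, Function.uncurry F q ∂(P.map fun ω => ((fun l => h l ω), X ω)) := by
        rw [lintegral_map hF (hh.prodMk hX)]
        rfl
    _ = _ := by
        have := Measure.isProbabilityMeasure_map hh.aemeasurable (μ := P)
        have := Measure.isProbabilityMeasure_map hX.aemeasurable (μ := P)
        rw [e, lintegral_prod_symm _ hF.aemeasurable, lintegral_map ?_ hX]
        · refine lintegral_congr fun ω => ?_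
          have hF' : Measurable fun x => Function.uncurry F (x, X ω) :=
            hF.comp (measurable_id.prodMk measurable_const)
          rw [lintegral_map hF' hh]
          rfl
        · exact hF.lintegral_prod_left'

lemma lintegral_nexp_fading_loc (hm : ∀ l, Measurable (h l))
    (hlaw : ∀ l, P.map (h l) = expMeasure 1) (hind : iIndepFun h P) {X : Ω → S}
    (hX : Measurable X) (hindX : IndepFun (fun ω l => h l ω) X P) {W : S → ℝ≥0∞}
    (hW : Measurable W) {c : N → S → ℝ≥0∞} (hcm : ∀ l, Measurable (c l)) (hc : ∀ l x, c l x ≠ ∞) :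
    ∫⁻ ω, W (X ω) * nexp (∑' l, c l (X ω) * ENNReal.ofReal (h l ω)) ∂P =
      ∫⁻ ω, W (X ω) * nexp (∑' l, logAdd (c l (X ω))) ∂P := by
  rw [lintegral_comp_fading_loc hm hX hindX
    (F := fun x s => W s * nexp (∑' l, c l s * ENNReal.ofReal (x l)))]
  · refine lintegral_congr fun ω => ?_
    rw [← lintegral_nexp_tsum_fading hm hlaw hind (fun l => hc l (X ω)), lintegral_const_mul]
    fun_prop
  · refine (hW.comp measurable_snd).mul (measurable_nexp.comp (Measurable.tsum fun l => ?_))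
    exact ((hcm l).comp measurable_snd).mul
      (((measurable_pi_apply l).comp measurable_fst).ennreal_ofReal)

/-- The σ-algebra is left arbitrary because the lemma is applied to the one generated by all gains
except that of the serving link; a gain with coefficient zero need not be measurable. -/
lemma measurable_tsum_mul_ofReal {N Ω : Type*} [Countable N] {_ : MeasurableSpace Ω} {h : N → Ω → ℝ}
    {c : N → ℝ≥0∞} (n : ℝ≥0∞) (hm : ∀ l, c l = 0 ∨ Measurable (h l)) :
    Measurable fun ω => ∑' l, c l * ENNReal.ofReal (h l ω) + n := by
  refine Measurable.add_const (Measurable.tsum fun l => ?_) n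
  rcases hm l with hl | hl
  · simp [hl]
  · fun_prop

/-- The coefficient of `l₀` vanishes, so the threshold is a function of the other gains and is
independent of `h l₀`. Integrating the exponential tail against its law gives the result. -/
lemma measure_tsum_add_le_fading (hm : ∀ l, Measurable (h l))
    (hlaw : ∀ l, P.map (h l) = expMeasure 1) (hind : iIndepFun h P) (c : N → ℝ≥0∞) {l₀ : N}
    (hc : c l₀ = 0) (n : ℝ≥0∞) :
    P {ω | ∑' l, c l * ENNReal.ofReal (h l ω) + n ≤ ENNReal.ofReal (h l₀ ω)} =
      ∫⁻ ω, nexp (∑' l, c l * ENNReal.ofReal (h l ω) + n) ∂P := by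
  set Z : Ω → ℝ≥0∞ := fun ω => ∑' l, c l * ENNReal.ofReal (h l ω) + n with hZ
  have hZm : Measurable Z := by fun_prop
  have hi : IndepFun (h l₀) Z P := by
    have h1 := indep_iSup_of_disjoint (fun l => (hm l).comap_le) hind
      (S := {l₀}) (T := {l₀}ᶜ) (disjoint_compl_right)
    refine indep_of_indep_of_le_left (indep_of_indep_of_le_right h1 ?_) ?_
    · refine Measurable.comap_le (measurable_tsum_mul_ofReal n fun l => ?_)
      by_cases hl : l = l₀
      · exact Or.inl (hl ▸ hc)
      · refine Or.inr (Measurable.mono (comap_measurable (h l)) ?_ le_rfl)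
        exact le_iSup₂_of_le l hl le_rfl
    · exact le_iSup₂_of_le l₀ rfl le_rfl
  have e := (indepFun_iff_map_prod_eq_prod_map_map (hm l₀).aemeasurable hZm.aemeasurable).1 hi
  have hS : MeasurableSet {q : ℝ × ℝ≥0∞ | q.2 ≤ ENNReal.ofReal q.1} :=
    measurableSet_le measurable_snd (measurable_fst.ennreal_ofReal)
  have := isProbabilityMeasure_expMeasure zero_lt_one
  have := Measure.isProbabilityMeasure_map hZm.aemeasurable (μ := P)
  calc _ = P.map (fun ω => (h l₀ ω, Z ω)) {q : ℝ × ℝ≥0∞ | q.2 ≤ ENNReal.ofReal q.1} := by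
        rw [Measure.map_apply ((hm l₀).prodMk hZm) hS]
        rfl
    _ = _ := by
        rw [e, hlaw, Measure.prod_apply_symm hS, lintegral_map (measurable_measure_prodMk_right hS)
          hZm]
        refine lintegral_congr fun ω => ?_
        exact expMeasure_one_le_ofReal _

lemma lintegral_indicator_fading_loc (hm : ∀ l, Measurable (h l))
    (hlaw : ∀ l, P.map (h l) = expMeasure 1) (hind : iIndepFun h P) {X : Ω → S}
    (hX : Measurable X) (hindX : IndepFun (fun ω l => h l ω) X P) {W : S → ℝ≥0∞}
    (hW : Measurable W) {c : N → S → ℝ≥0∞} (hcm : ∀ l, Measurable (c l)) {l₀ : N}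
    (hc : ∀ x, c l₀ x = 0) {n : S → ℝ≥0∞} (hn : Measurable n) :
    ∫⁻ ω, W (X ω) * {ω | ∑' l, c l (X ω) * ENNReal.ofReal (h l ω) + n (X ω) ≤
        ENNReal.ofReal (h l₀ ω)}.indicator 1 ω ∂P =
      ∫⁻ ω, W (X ω) * nexp (∑' l, c l (X ω) * ENNReal.ofReal (h l ω) + n (X ω)) ∂P := by
  have hT : Measurable fun q : (N → ℝ) × S => ∑' l, c l q.2 * ENNReal.ofReal (q.1 l) + n q.2 := by
    refine Measurable.add (Measurable.tsum fun l => ?_) (hn.comp measurable_snd)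
    exact ((hcm l).comp measurable_snd).mul
      (((measurable_pi_apply l).comp measurable_fst).ennreal_ofReal)
  have hs : MeasurableSet {q : (N → ℝ) × S | ∑' l, c l q.2 * ENNReal.ofReal (q.1 l) + n q.2 ≤
      ENNReal.ofReal (q.1 l₀)} :=
    measurableSet_le hT ((measurable_pi_apply l₀).comp measurable_fst).ennreal_ofReal
  have e1 := lintegral_comp_fading_loc hm hX hindX
    (F := fun x s => W s * {q : (N → ℝ) × S | ∑' l, c l q.2 * ENNReal.ofReal (q.1 l) + n q.2 ≤
        ENNReal.ofReal (q.1 l₀)}.indicator 1 (x, s))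
    ((hW.comp measurable_snd).mul (measurable_one.indicator hs))
  have e2 := lintegral_comp_fading_loc hm hX hindX
    (F := fun x s => W s * nexp (∑' l, c l s * ENNReal.ofReal (x l) + n s))
    ((hW.comp measurable_snd).mul (measurable_nexp.comp hT))
  rw [e2]
  refine Eq.trans e1 (lintegral_congr fun ω => ?_)
  have hhm : Measurable fun ω' => ((fun l => h l ω'), X ω) :=
    (measurable_pi_lambda _ hm).prodMk measurable_const
  refine (lintegral_const_mul _ ((measurable_one.indicator hs).comp hhm)).trans ?_
  refine Eq.trans ?_ (lintegral_const_mul _ (measurable_nexp.comp (hT.comp hhm))).symm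
  congr 1
  refine Eq.trans ?_ (measure_tsum_add_le_fading hm hlaw hind (fun l => c l (X ω)) (hc _) (n (X ω)))
  exact lintegral_indicator_one (hhm hs)

end Fading
end HetNet

/-! ### Conditioning on a sub-σ-algebra -/

namespace HetNet

/-- Integrating the conditional probabilities over an event `S` of `m` gives mixed Poisson counts
under `P.restrict S`. Results for a finite measure therefore apply, and the conditioning is
recovered by letting `S` vary. -/
lemma IsCondPoisson.hasPoissonCounts {Ω ι : Type*} {m mΩ : MeasurableSpace Ω} {P : Measure Ω}
    [IsFiniteMeasure P] (hm : m ≤ mΩ) {X : ι → ℕ → Ω → Plane} {Λ : ι → Ω → Measure Plane}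
    (h : IsCondPoisson m P X Λ) {S : Set Ω} (hS : MeasurableSet[m] S) :
    HasPoissonCounts (P.restrict S) X Λ := by
  intro n p B c hB hBb hd
  set E : Set Ω := {ω | ∀ a, count (X (p a)) (B a) ω = (c a : ℕ∞)} with hE
  have hEm : MeasurableSet E := by
    have : E = ⋂ a, (fun ω => ((count (X (p a)) (B a) ω : ℕ∞) : ℝ≥0∞)) ⁻¹' {(c a : ℝ≥0∞)} := by
      ext ω
      simp only [hE, mem_ofPred_eq, mem_iInter, mem_preimage, mem_singleton_iff]
      refine forall_congr' fun a => ?_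
      rw [← ENat.toENNReal_coe, ENat.toENNReal_inj]
    rw [this]
    exact MeasurableSet.iInter fun a =>
      measurable_count (h.1 _) (hB a) (measurableSet_singleton _)
  have hc := h.2 n p B c hB hBb hd
  have hi : Integrable (E.indicator fun _ => (1 : ℝ)) P :=
    (integrable_const 1).indicator hEm
  have e1 := setIntegral_condExp hm hi hS
  rw [setIntegral_congr_ae (hm S hS) (hc.mono fun ω hω _ => hω)] at e1
  have hint : Integrable (fun ω => ∏ a, (poissonMeasure (Λ (p a) ω (B a)).toNNReal).real {c a}) P :=
    integrable_condExp.congr hc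
  have hprod : ∀ ω, ∏ a, ENNReal.ofReal ((poissonMeasure (Λ (p a) ω (B a)).toNNReal).real {c a}) =
      ENNReal.ofReal (∏ a, (poissonMeasure (Λ (p a) ω (B a)).toNNReal).real {c a}) := fun ω =>
    (ENNReal.ofReal_prod_of_nonneg fun a _ => measureReal_nonneg).symm
  simp_rw [hprod]
  rw [← ofReal_integral_eq_lintegral_ofReal hint.integrableOn
    (Eventually.of_forall fun ω => Finset.prod_nonneg fun a _ => measureReal_nonneg), e1,
    integral_indicator hEm]
  simp

/-- Equality of integrals over the sets of a sub-σ-algebra extends to weights. -/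
lemma lintegral_mul_eq_of_forall_setLIntegral_eq {Ω : Type*} {m mΩ : MeasurableSpace Ω}
    {P : Measure Ω} (hm : m ≤ mΩ) {F G : Ω → ℝ≥0∞} (hF : Measurable F)
    (hG : Measurable G) (h : ∀ S, MeasurableSet[m] S → ∫⁻ ω in S, F ω ∂P = ∫⁻ ω in S, G ω ∂P)
    {V : Ω → ℝ≥0∞} (hV : Measurable[m] V) : ∫⁻ ω, V ω * F ω ∂P = ∫⁻ ω, V ω * G ω ∂P := by
  have hV' : Measurable V := hV.mono hm le_rfl
  -- The hypothesis says that the measures with densities `F` and `G` coincide on `m`; the integral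
  -- of an `m`-measurable `V` sees only these restrictions.
  have e : (P.withDensity F).trim hm = (P.withDensity G).trim hm := by
    refine @Measure.ext _ m _ _ fun S hS => ?_
    rw [trim_measurableSet_eq hm hS, trim_measurableSet_eq hm hS, withDensity_apply _ (hm S hS),
      withDensity_apply _ (hm S hS), h S hS]
  have key : ∀ F : Ω → ℝ≥0∞, Measurable F →
      ∫⁻ ω, V ω * F ω ∂P = ∫⁻ ω, V ω ∂((P.withDensity F).trim hm) := by
    intro F hF
    rw [lintegral_trim hm hV, lintegral_withDensity_eq_lintegral_mul _ hF hV']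
    exact lintegral_congr fun ω => mul_comm _ _
  rw [key F hF, key G hG, e]

/-! ### Polar coordinates in the plane -/

/-- The point with polar coordinates `(r, φ)`. -/
def polarPoint (r φ : ℝ) : Plane := !₂[r * Real.cos φ, r * Real.sin φ]

lemma measurable_polarPoint : Measurable fun q : ℝ × ℝ => polarPoint q.1 q.2 := by
  refine Continuous.measurable ?_
  refine (PiLp.continuous_toLp 2 fun _ : Fin 2 => ℝ).comp (continuous_pi fun i => ?_)
  fin_cases i
  · simp; fun_prop
  · simp; fun_prop

lemma norm_polarPoint {r : ℝ} (hr : 0 ≤ r) (φ : ℝ) : ‖polarPoint r φ‖ = r := by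
  rw [EuclideanSpace.norm_eq]
  simp only [polarPoint, Fin.sum_univ_two, Real.norm_eq_abs, sq_abs]
  simp only [Matrix.cons_val_zero, Matrix.cons_val_one]
  rw [Real.sqrt_eq_iff_mul_self_eq (by positivity) hr]
  nlinarith [Real.sin_sq_add_cos_sq φ]

/-- Transported from the polar coordinates of `ℂ` by the volume-preserving isometry with the plane.
-/
lemma lintegral_plane_polar {F : Plane → ℝ≥0∞} (hF : Measurable F) :
    ∫⁻ x, F x = ∫⁻ r in Ioi (0 : ℝ), ENNReal.ofReal r *
      ∫⁻ φ in Ioo (-Real.pi) Real.pi, F (polarPoint r φ) := by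
  have mp' : MeasurePreserving (fun z : ℂ => Complex.orthonormalBasisOneI.repr z) volume volume :=
    Complex.orthonormalBasisOneI.measurePreserving_repr
  rw [← mp'.lintegral_comp hF, ← Complex.lintegral_comp_polarCoord_symm,
    polarCoord_target, Measure.volume_eq_prod, ← Measure.prod_restrict]
  have hpt : ∀ p : ℝ × ℝ, F (Complex.orthonormalBasisOneI.repr (Complex.polarCoord.symm p)) =
      F (polarPoint p.1 p.2) := by
    intro p
    congr 1
  simp only [hpt, smul_eq_mul]
  have hm : Measurable fun p : ℝ × ℝ => F (polarPoint p.1 p.2) := hF.comp measurable_polarPoint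
  have hm2 : Measurable fun p : ℝ × ℝ => ENNReal.ofReal p.1 * F (polarPoint p.1 p.2) :=
    measurable_fst.ennreal_ofReal.mul hm
  rw [lintegral_prod _ hm2.aemeasurable]
  refine lintegral_congr fun r => ?_
  have hmr : Measurable fun φ => F (polarPoint r φ) := hm.comp (measurable_prodMk_left (x := r))
  exact lintegral_const_mul (ENNReal.ofReal r) hmr

lemma lintegral_plane_norm {F : ℝ → ℝ≥0∞} (hF : Measurable F) :
    ∫⁻ x : Plane, F ‖x‖ = ∫⁻ r in Ioi (0 : ℝ), ENNReal.ofReal (2 * Real.pi * r) * F r := by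
  rw [lintegral_plane_polar (F := fun x => F ‖x‖) (hF.comp measurable_norm)]
  refine setLIntegral_congr_fun measurableSet_Ioi fun r hr => ?_
  have hr : 0 < r := hr
  simp only [norm_polarPoint hr.le, setLIntegral_const, Real.volume_Ioo]
  rw [mul_comm (F r), ← mul_assoc, ← ENNReal.ofReal_mul hr.le]
  congr 2
  ring

/-! ### Nearest points -/

lemma exists_forall_le_of_finite {J : Type*} [Nonempty J] {w : J → ℝ}
    (h : ∀ q, {j | w j ≤ q}.Finite) : ∃ j, ∀ i, w j ≤ w i := by
  obtain ⟨j₀⟩ := ‹Nonempty J›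
  obtain ⟨j, hj, hmin⟩ := Set.exists_min_image {j | w j ≤ w j₀} w (h _) ⟨j₀, le_refl (w j₀)⟩
  refine ⟨j, fun i => ?_⟩
  rcases le_total (w i) (w j₀) with hi | hi
  · exact hmin i hi
  · exact le_trans hj hi

lemma finite_of_tsum_indicator_lt_top {J Y : Type*} {y : J → Y} {B : Set Y}
    (h : ∑' j, B.indicator (1 : Y → ℝ≥0∞) (y j) ≠ ∞) : {j | y j ∈ B}.Finite := by
  have e : ∑' j, B.indicator (1 : Y → ℝ≥0∞) (y j) = ∑' _ : {j | y j ∈ B}, 1 := by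
    rw [tsum_subtype {j | y j ∈ B} (fun _ => (1 : ℝ≥0∞))]
    exact tsum_congr fun j => by simp [indicator]
  rw [e, ENNReal.tsum_set_one] at h
  exact Set.encard_ne_top_iff.1 (by simpa using h)

section Mecke

variable {J Ω Y : Type*} [Countable J] [MeasurableSpace Ω] [MeasurableSpace Y] {ν : Measure Ω}
  {y : J → Ω → Y} {κ : Measure Y} [SigmaFinite κ] {ρ : Ω → Y → ℝ≥0∞} [IsFiniteMeasure ν]

lemma HasLaplace.meckeHolds_countable_rectangles {I : Type*} [Countable I]
    (h0 : HasLaplace ν y κ ρ) (hy : ∀ j, Measurable (y j))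
    (hρ : Measurable (Function.uncurry ρ)) {C : ℝ≥0} (hC : ∀ ω z, ρ ω z ≤ C)
    {u v : Y → ℝ≥0∞} (hu : Measurable u) (hv : Measurable v) {A B : I → Set Y}
    (hA : ∀ n, MeasurableSet (A n)) (hB : ∀ n, MeasurableSet (B n)) :
    MeckeHolds ν y κ ρ fun z w => u w + {w | ∃ n, z ∈ A n ∧ w ∈ B n}.indicator v w := by
  rcases isEmpty_or_nonempty I with hI | hI
  · simpa using h0.meckeHolds_const hy hρ hC hu
  obtain ⟨e, he⟩ := exists_surjective_nat I
  have := h0.meckeHolds_rectangles hy hρ hC hu hv (fun n => hA (e n)) (fun n => hB (e n))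
  convert this using 6 with z w w
  ext w
  exact ⟨fun ⟨i, hi⟩ => (he i).elim fun n hn => ⟨n, hn ▸ hi⟩, fun ⟨n, hn⟩ => ⟨e n, hn⟩⟩

lemma HasLaplace.lintegral_tsum (h0 : HasLaplace ν y κ ρ) (hy : ∀ j, Measurable (y j))
    (hρ : Measurable (Function.uncurry ρ)) {C : ℝ≥0} (hC : ∀ ω z, ρ ω z ≤ C) {f : Y → ℝ≥0∞}
    (hf : Measurable f) : ∫⁻ ω, ∑' j, f (y j ω) ∂ν = ∫⁻ ω, ∫⁻ z, ρ ω z * f z ∂κ ∂ν := by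
  have := (h0.meckeHolds_const hy hρ hC (measurable_const (a := (0 : ℝ≥0∞)))).eq _ hf
  simpa only [tsum_zero, nexp_zero, mul_one, tsub_self, mul_zero, lintegral_zero] using this

/-- The mean number of points in `B` is at most `C * κ B` times the total mass of `ν`. -/
lemma HasLaplace.ae_finite (h0 : HasLaplace ν y κ ρ) (hy : ∀ j, Measurable (y j))
    (hρ : Measurable (Function.uncurry ρ)) {C : ℝ≥0} (hC : ∀ ω z, ρ ω z ≤ C) {B : Set Y}
    (hB : MeasurableSet B) (hκB : κ B ≠ ∞) : ∀ᵐ ω ∂ν, {j | y j ω ∈ B}.Finite := by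
  have h1B : Measurable (B.indicator (1 : Y → ℝ≥0∞)) := measurable_one.indicator hB
  have e := h0.lintegral_tsum hy hρ hC h1B
  have hfin : ∫⁻ ω, ∑' j, B.indicator (1 : Y → ℝ≥0∞) (y j ω) ∂ν ≠ ∞ := by
    rw [e]
    refine ne_top_of_le_ne_top (b := ∫⁻ ω, C * κ B ∂ν) ?_ (lintegral_mono fun ω => ?_)
    · rw [lintegral_const]
      exact ENNReal.mul_ne_top (ENNReal.mul_ne_top ENNReal.coe_ne_top hκB) (measure_ne_top _ _)
    · rw [← lintegral_indicator_one hB, ← lintegral_const_mul _ h1B]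
      exact lintegral_mono fun z => mul_le_mul_left (hC ω z) _
  filter_upwards [ae_lt_top (Measurable.tsum fun j => h1B.comp (hy j)) hfin] with ω hω
  exact finite_of_tsum_indicator_lt_top hω.ne

lemma HasLaplace.ae_notMem (h0 : HasLaplace ν y κ ρ) (hy : ∀ j, Measurable (y j))
    (hρ : Measurable (Function.uncurry ρ)) {C : ℝ≥0} (hC : ∀ ω z, ρ ω z ≤ C) {B : Set Y}
    (hB : MeasurableSet B) (hκB : κ B = 0) : ∀ᵐ ω ∂ν, ∀ j, y j ω ∉ B := by
  have h1B : Measurable (B.indicator (1 : Y → ℝ≥0∞)) := measurable_one.indicator hB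
  have e := h0.lintegral_tsum hy hρ hC h1B
  have hz : ∀ ω, ∫⁻ z, ρ ω z * B.indicator 1 z ∂κ = 0 := by
    intro ω
    refine le_antisymm ?_ zero_le
    calc _ ≤ ∫⁻ z, C * B.indicator 1 z ∂κ := lintegral_mono fun z => mul_le_mul_left (hC ω z) _
      _ = 0 := by rw [lintegral_const_mul _ h1B, lintegral_indicator_one hB, hκB, mul_zero]
  simp_rw [hz, lintegral_zero] at e
  have hNm : Measurable fun ω => ∑' j, B.indicator (1 : Y → ℝ≥0∞) (y j ω) :=
    Measurable.tsum fun j => h1B.comp (hy j)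
  rw [lintegral_eq_zero_iff hNm] at e
  filter_upwards [e] with ω hω j hj
  have := (ENNReal.tsum_eq_zero.1 hω) j
  simp [hj] at this

end Mecke

end HetNet

/-! ### The strongest base station -/

namespace HetNet

/-- The mean power received through a link from `x`. -/
def gain (α p : ℝ) (x : Plane) : ℝ≥0∞ := ENNReal.ofReal (p * ‖x‖ ^ (-α))

@[fun_prop]
lemma measurable_gain (α p : ℝ) : Measurable (gain α p) := by unfold gain; fun_prop

lemma gain_ne_top (α p : ℝ) (x : Plane) : gain α p x ≠ ∞ := ENNReal.ofReal_ne_top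

lemma received_eq {α p : ℝ} (hp : 0 ≤ p) (h : ℝ) (x : Plane) :
    Model.received α p h x = gain α p x * ENNReal.ofReal h := by
  rw [Model.received, gain, ← ENNReal.ofReal_mul (by positivity)]
  congr 1
  ring

/-- A rational number between the two values writes the relation `w x < w z` as a countable union of
rectangles, the form required by the Mecke formula. -/
lemma iUnion_rat_lt_prod {Y : Type*} (w : Y → ℝ) (z x : Y) :
    (∃ a : ℚ, z ∈ {z | (a : ℝ) < w z} ∧ x ∈ {x | w x < a}) ↔ w x < w z :=
  ⟨fun ⟨_, h1, h2⟩ => lt_trans h2 h1, fun h =>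
    let ⟨a, h1, h2⟩ := exists_rat_btwn h; ⟨a, h2, h1⟩⟩

lemma lintegral_count_prod {ι : Type*} [Fintype ι] [MeasurableSpace ι] [MeasurableSingletonClass ι]
    {F : ι × Plane → ℝ≥0∞} (hF : Measurable F) :
    ∫⁻ z, F z ∂(Measure.count.prod volume) = ∑ p, ∫⁻ x, F (p, x) := by
  rw [lintegral_prod _ hF.aemeasurable, lintegral_count, tsum_fintype]

namespace Params

variable {K : ℕ} (q : Params K)

/-- `Pₜ^{1/α}`. -/
def amp (t : Fin K) : ℝ := q.power t ^ (1 / q.α)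

lemma amp_pos (t : Fin K) : 0 < q.amp t := Real.rpow_pos_of_pos (q.power_pos t) _

lemma α_pos : 0 < q.α := by linarith [q.two_lt_α]

lemma amp_sq (t : Fin K) : q.amp t ^ 2 = q.power t ^ (2 / q.α) := by
  rw [amp, ← Real.rpow_natCast, ← Real.rpow_mul (q.power_pos t).le]
  congr 1
  push_cast
  ring

/-- The distance to a base station, rescaled so that the strongest one minimizes it. -/
def weight (z : Fin K × Plane) : ℝ := ‖z.2‖ / q.amp z.1

lemma measurable_weight : Measurable q.weight :=
  (measurable_norm.comp measurable_snd).div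
    ((measurable_from_top (f := q.amp)).comp measurable_fst)

/-- `l` is a strongest base station in the configuration `b`. -/
def Strongest (b : Fin K → ℕ → Plane) (l : Fin K × ℕ) : Prop :=
  ∀ l' : Fin K × ℕ, q.weight (l.1, b l.1 l.2) ≤ q.weight (l'.1, b l'.1 l'.2)

/-- The exponent of the Laplace functional of the interference from a base station. -/
def bsLog (s : ℝ≥0) (z : Fin K × Plane) : ℝ≥0∞ := logAdd (s * gain q.α (q.power z.1) z.2)

lemma measurable_bsLog (s : ℝ≥0) : Measurable (q.bsLog s) :=
  measurable_from_prod_countable_right fun t =>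
    measurable_logAdd.comp ((measurable_gain q.α (q.power t)).const_mul _)

lemma bsLog_ne_top (s : ℝ≥0) (z : Fin K × Plane) : q.bsLog s z ≠ ∞ :=
  logAdd_ne_top (ENNReal.mul_ne_top ENNReal.coe_ne_top (gain_ne_top _ _ _))

/-- Minus the logarithm of the conditional Laplace transform of the interference from the other
base stations times the probability that there is no stronger one. -/
def bsExponent (s : ℝ≥0) (k : Fin K) (r : ℝ) : ℝ≥0∞ :=
  ∑ t, ENNReal.ofReal (q.dens t) * ∫⁻ x : Plane,
    if ‖x‖ / q.amp t < r / q.amp k then 1 else 1 - (1 + s * gain q.α (q.power t) x)⁻¹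

lemma measurable_bsExponent (s : ℝ≥0) (k : Fin K) : Measurable (q.bsExponent s k) := by
  refine Finset.measurable_sum _ fun t _ => Measurable.const_mul ?_ _
  refine Measurable.lintegral_prod_right' (f := fun p : ℝ × Plane =>
    if ‖p.2‖ / q.amp t < p.1 / q.amp k then (1 : ℝ≥0∞) else
      1 - (1 + s * gain q.α (q.power t) p.2)⁻¹) ?_
  refine Measurable.ite (measurableSet_lt ?_ ?_) measurable_const ?_
  · exact (measurable_norm.comp measurable_snd).div_const _
  · exact measurable_fst.div_const _
  · exact measurable_const.sub ((measurable_const.add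
      ((measurable_gain _ _).comp measurable_snd |>.const_mul _)).inv)

end Params

namespace Model

variable {K : ℕ} {q : Params K} {Ω : Type*} [MeasurableSpace Ω] {P : Measure Ω}
  (M : Model q Ω P)

lemma measurable_bs (t : Fin K) (i : ℕ) : Measurable (M.bs t i) := M.bs_poisson.1 t i

/-- The base stations of all tiers, marked by their tier. -/
def bsPoint (j : Fin K × ℕ) (ω : Ω) : Fin K × Plane := (j.1, M.bs j.1 j.2 ω)

lemma measurable_bsPoint (j : Fin K × ℕ) : Measurable (M.bsPoint j) :=
  measurable_const.prodMk (M.measurable_bs _ _)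

/-- The base stations as a point of the space of configurations. -/
def bsConf (ω : Ω) : Fin K → ℕ → Plane := fun t i => M.bs t i ω

lemma measurable_bsDens : Measurable (Function.uncurry fun (_ : Ω) (z : Fin K × Plane) =>
    ENNReal.ofReal (q.dens z.1)) :=
  (measurable_from_top (f := fun t : Fin K => ENNReal.ofReal (q.dens t))).comp
    (measurable_fst.comp measurable_snd)

/-- A bound for all intensities. -/
def densBound (q : Params K) : ℝ≥0 := Real.toNNReal (q.densJ + ∑ t, q.dens t)

lemma dens_le_densBound (q : Params K) (t : Fin K) : ENNReal.ofReal (q.dens t) ≤ densBound q := by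
  refine ENNReal.ofReal_le_ofReal ?_
  have := Finset.single_le_sum (f := q.dens) (fun t _ => (q.dens_pos t).le) (Finset.mem_univ t)
  linarith [q.densJ_pos]

variable [IsProbabilityMeasure P]

lemma hasLaplace_bs : HasLaplace P M.bsPoint (Measure.count.prod volume)
    fun _ z => ENNReal.ofReal (q.dens z.1) := by
  have h := M.bs_poisson.hasPoissonCounts bot_le MeasurableSet.univ
  rw [Measure.restrict_univ] at h
  refine HasPoissonCounts.hasLaplace (C := densBound q) measurable_bsDens
    (fun _ z => dens_le_densBound q z.1) ?_ M.measurable_bs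
  simpa only [withDensity_const] using h

/-- The infinite value on the stations stronger than `z` annihilates every configuration in which
`z` is not strongest, while `bsLog` carries the interference. -/
lemma meckeHolds_bs (s : ℝ≥0) : MeckeHolds P M.bsPoint (Measure.count.prod volume)
    (fun _ z => ENNReal.ofReal (q.dens z.1))
    fun z x => q.bsLog s x + {x | q.weight x < q.weight z}.indicator (fun _ => ∞) x := by
  have h := M.hasLaplace_bs.meckeHolds_countable_rectangles M.measurable_bsPoint measurable_bsDens
    (fun _ z => dens_le_densBound q z.1) (q.measurable_bsLog s) (v := fun _ => ∞) measurable_const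
    (A := fun a : ℚ => {z | (a : ℝ) < q.weight z}) (B := fun a : ℚ => {x | q.weight x < a})
    (fun a => measurableSet_lt measurable_const q.measurable_weight)
    (fun a => measurableSet_lt q.measurable_weight measurable_const)
  simpa only [iUnion_rat_lt_prod] using h

open Classical in
lemma lintegral_strongest (s : ℝ≥0) {W : Fin K → ℝ → ℝ≥0∞} (hW : ∀ k, Measurable (W k)) :
    ∫⁻ ω, ∑' l : Fin K × ℕ, (if q.Strongest (M.bsConf ω) l then
        W l.1 ‖M.bs l.1 l.2 ω‖ * nexp (∑' l', if l' = l then 0 else q.bsLog s (M.bsPoint l' ω))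
        else 0) ∂P =
      ∑ k, ENNReal.ofReal (q.dens k) * ∫⁻ x : Plane, W k ‖x‖ * nexp (q.bsExponent s k ‖x‖) := by
  have hWm : Measurable fun z : Fin K × Plane => W z.1 ‖z.2‖ :=
    measurable_from_prod_countable_right fun t => (hW t).comp measurable_norm
  -- The inner sum contains the term of the selected station, which does not interfere with itself.
  -- The weight includes the inverse of its factor, which is legitimate because `bsLog` is finite.
  have e := (M.meckeHolds_bs s).eq (fun z => W z.1 ‖z.2‖ * (nexp (q.bsLog s z))⁻¹)
    (hWm.mul (measurable_nexp.comp (q.measurable_bsLog s)).inv)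
  have hcancel : ∀ z, (nexp (q.bsLog s z))⁻¹ * nexp (q.bsLog s z) = 1 := fun z =>
    ENNReal.inv_mul_cancel (nexp_ne_zero (q.bsLog_ne_top s z)) (nexp_ne_top _)
  refine Eq.trans (lintegral_congr fun ω => tsum_congr fun l => ?_) (e.trans ?_)
  · rw [ENNReal.tsum_add, nexp_add]
    by_cases h : q.Strongest (M.bsConf ω) l
    · have h0 : ∀ l', {x | q.weight x < q.weight (M.bsPoint l ω)}.indicator
          (fun _ => (∞ : ℝ≥0∞)) (M.bsPoint l' ω) = 0 := fun l' =>
        indicator_of_notMem (by exact not_lt.2 (h l')) _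
      simp_rw [if_pos h, h0]
      rw [tsum_zero, nexp_zero, mul_one,
        ENNReal.tsum_eq_add_tsum_ite (f := fun l' => q.bsLog s (M.bsPoint l' ω)) l, nexp_add,
        mul_assoc, ← mul_assoc _ (nexp (q.bsLog s _)), hcancel, one_mul]
      refine congrArg (fun a => W l.1 ‖M.bs l.1 l.2 ω‖ * nexp a) (tsum_congr fun l' => ?_)
      split_ifs <;> rfl
    · rw [if_neg h]
      obtain ⟨l', hl'⟩ := not_forall.1 h
      have htop : ∑' l', {x | q.weight x < q.weight (M.bsPoint l ω)}.indicator
          (fun _ => (∞ : ℝ≥0∞)) (M.bsPoint l' ω) = ∞ := by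
        refine ENNReal.tsum_eq_top_of_eq_top ⟨l', ?_⟩
        exact indicator_of_mem (by exact not_le.1 hl') _
      rw [htop, nexp_top, mul_zero, mul_zero]
  · rw [lintegral_const, measure_univ, mul_one]
    have hexp : ∀ z : Fin K × Plane, ∫⁻ x, ENNReal.ofReal (q.dens x.1) * (1 - nexp (q.bsLog s x +
        {x | q.weight x < q.weight z}.indicator (fun _ => ∞) x)) ∂(Measure.count.prod volume) =
        q.bsExponent s z.1 ‖z.2‖ := by
      intro z
      have hm : Measurable fun x => ENNReal.ofReal (q.dens x.1) * (1 - nexp (q.bsLog s x +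
        {x | q.weight x < q.weight z}.indicator (fun _ => ∞) x)) := by
        refine (measurable_bsDens (Ω := Unit)).of_uncurry_left (x := ()) |>.mul
          (measurable_const.sub (measurable_nexp.comp ((q.measurable_bsLog s).add
            (measurable_const.indicator ?_))))
        exact measurableSet_lt q.measurable_weight measurable_const
      rw [lintegral_count_prod hm, Params.bsExponent]
      refine Finset.sum_congr rfl fun t _ => ?_
      rw [← lintegral_const_mul']
      · refine lintegral_congr fun x => ?_
        congr 1
        have hmem : ((t, x) ∈ {x | q.weight x < q.weight z}) ↔
            ‖x‖ / q.amp t < ‖z.2‖ / q.amp z.1 := Iff.rfl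
        by_cases hx : ‖x‖ / q.amp t < ‖z.2‖ / q.amp z.1
        · rw [if_pos hx, indicator_of_mem (hmem.2 hx), add_top, nexp_top, tsub_zero]
        · rw [if_neg hx, indicator_of_notMem (fun h => hx (hmem.1 h)), add_zero, Params.bsLog,
            nexp_logAdd]
      · exact ENNReal.ofReal_ne_top
    simp_rw [hexp]
    have hself : ∀ z : Fin K × Plane, {x | q.weight x < q.weight z}.indicator
        (fun _ => (∞ : ℝ≥0∞)) z = 0 := fun z => indicator_of_notMem (by simp) _
    simp_rw [hself, add_zero]
    have hred : ∀ z : Fin K × Plane, ENNReal.ofReal (q.dens z.1) * (W z.1 ‖z.2‖ *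
        (nexp (q.bsLog s z))⁻¹ * (nexp (q.bsLog s z) * nexp (q.bsExponent s z.1 ‖z.2‖))) =
        ENNReal.ofReal (q.dens z.1) * (W z.1 ‖z.2‖ * nexp (q.bsExponent s z.1 ‖z.2‖)) := by
      intro z
      rw [mul_assoc (W z.1 ‖z.2‖), ← mul_assoc _ (nexp (q.bsLog s z)), hcancel, one_mul]
    simp_rw [hred]
    rw [lintegral_count_prod]
    · exact Finset.sum_congr rfl fun t _ =>
        lintegral_const_mul' (ENNReal.ofReal (q.dens t)) _ ENNReal.ofReal_ne_top
    · exact measurable_from_prod_countable_right fun t => Measurable.const_mul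
        (((hW t).comp measurable_norm).mul (measurable_nexp.comp
          ((q.measurable_bsExponent s t).comp measurable_norm))) (ENNReal.ofReal (q.dens t))

end Model
end HetNet

/-! ### The law of the serving tier and distance -/

namespace HetNet

/-- A hazard rate with infinite total mass defines a probability density. -/
lemma lintegral_hazard {G g : ℝ → ℝ} (hG0 : G 0 = 0) (hG : ∀ r, 0 ≤ r → HasDerivAt G (g r) r)
    (hg : ∀ r, 0 < r → 0 ≤ g r) (htop : Tendsto G atTop atTop) :
    ∫⁻ r in Ioi (0 : ℝ), ENNReal.ofReal (g r * Real.exp (-G r)) = 1 := by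
  have hF : ∀ r ∈ Ici (0 : ℝ), HasDerivAt (fun r => -Real.exp (-G r)) (g r * Real.exp (-G r)) r :=
      by
    intro r hr
    have := ((hG r hr).neg.exp).neg
    convert! this using 1
    simp only [Pi.neg_apply]
    ring
  have hnn : ∀ r ∈ Ioi (0 : ℝ), 0 ≤ g r * Real.exp (-G r) := fun r hr =>
    mul_nonneg (hg r hr) (Real.exp_pos _).le
  have hlim : Tendsto (fun r => -Real.exp (-G r)) atTop (𝓝 0) := by
    have := (Real.tendsto_exp_neg_atTop_nhds_zero.comp htop).neg
    simpa [Function.comp_def] using this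
  have hint := integrableOn_Ioi_deriv_of_nonneg' hF hnn hlim
  have hval := integral_Ioi_of_hasDerivAt_of_nonneg' hF hnn hlim
  rw [← ofReal_integral_eq_lintegral_ofReal hint
    ((ae_restrict_iff' measurableSet_Ioi).2 (Eventually.of_forall hnn)), hval, hG0]
  simp

namespace Params

variable {K : ℕ} (q : Params K)

/-- The exponent of the Laplace transform of the interference from the base stations. -/
def bsTail (s : ℝ≥0) (k : Fin K) (r : ℝ) : ℝ≥0∞ :=
  ∑ t, ENNReal.ofReal (q.dens t) * ∫⁻ x in (Metric.ball (0 : Plane) (q.Del k r t))ᶜ,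
    (1 - (1 + s * gain q.α (q.power t) x)⁻¹)

lemma Del_eq (k : Fin K) (r : ℝ) (t : Fin K) : q.Del k r t = r * q.amp t / q.amp k := by
  rw [Del, Real.div_rpow (q.power_pos t).le (q.power_pos k).le, amp, amp, mul_div_assoc]

/-- Taking `α`-th roots turns maximal mean received power into minimal rescaled distance. Both
distances must be positive for the negative powers to be meaningful. -/
lemma div_amp_le_of_power_le {k t : Fin K} {r D : ℝ} (hD : 0 < D) (hr : 0 < r)
    (h : q.power t * D ^ (-q.α) ≤ q.power k * r ^ (-q.α)) : r / q.amp k ≤ D / q.amp t := by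
  have hα := q.α_pos
  have := q.power_pos t
  rw [Real.rpow_neg hD.le, Real.rpow_neg hr.le, ← div_eq_mul_inv, ← div_eq_mul_inv,
    div_le_div_iff₀ (by positivity) (by positivity)] at h
  rw [div_le_div_iff₀ (q.amp_pos _) (q.amp_pos _)]
  have h2 := Real.rpow_le_rpow (by positivity) h (z := 1 / q.α) (by positivity)
  rw [Real.mul_rpow (q.power_pos _).le (by positivity),
    Real.mul_rpow (q.power_pos _).le (by positivity), ← Real.rpow_mul hr.le,
    ← Real.rpow_mul hD.le, mul_one_div_cancel hα.ne', Real.rpow_one, Real.rpow_one] at h2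
  unfold amp
  linarith

lemma Xi_pos [Nonempty (Fin K)] : 0 < q.Xi :=
  Finset.sum_pos (fun t _ => mul_pos (q.dens_pos t) (Real.rpow_pos_of_pos (q.power_pos t) _))
    Finset.univ_nonempty

lemma Xi_eq : q.Xi = ∑ t, q.dens t * q.amp t ^ 2 := by simp_rw [amp_sq]; rfl

lemma assocProb_pos [Nonempty (Fin K)] (k : Fin K) : 0 < q.assocProb k :=
  div_pos (mul_pos (q.dens_pos k) (Real.rpow_pos_of_pos (q.power_pos k) _)) q.Xi_pos

lemma sum_assocProb [Nonempty (Fin K)] : ∑ k, q.assocProb k = 1 := by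
  simp_rw [assocProb]
  rw [← Finset.sum_div]
  exact div_self q.Xi_pos.ne'

/-- A station of tier `t` is stronger exactly inside the disc of radius `Δ_{k,t}`, where the
integrand is `1` and contributes the area `π Δ²`. Weighted by the densities, these areas add up to
the exponent of the serving distance density; the exterior is the exponent of the interference. -/
lemma bsExponent_eq (s : ℝ≥0) (k : Fin K) {r : ℝ} (hr : 0 ≤ r) :
    q.bsExponent s k r =
      ENNReal.ofReal (Real.pi * r ^ 2 / q.power k ^ (2 / q.α) * q.Xi) + q.bsTail s k r := by
  have hset : ∀ t, {x : Plane | ‖x‖ / q.amp t < r / q.amp k} =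
      Metric.ball (0 : Plane) (q.Del k r t) := by
    intro t
    ext x
    rw [mem_ofPred_eq, mem_ball_zero_iff, Del_eq, div_lt_div_iff₀ (q.amp_pos t) (q.amp_pos k),
      lt_div_iff₀ (q.amp_pos k)]
  have hsplit : ∀ t, (∫⁻ x : Plane,
      if ‖x‖ / q.amp t < r / q.amp k then 1 else 1 - (1 + s * gain q.α (q.power t) x)⁻¹) =
      ENNReal.ofReal (Real.pi * q.Del k r t ^ 2) +
        ∫⁻ x in (Metric.ball (0 : Plane) (q.Del k r t))ᶜ,
          (1 - (1 + s * gain q.α (q.power t) x)⁻¹) := by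
    intro t
    have hD : 0 ≤ q.Del k r t := by
      rw [Del_eq]
      have := q.amp_pos t
      have := q.amp_pos k
      positivity
    have hmB : MeasurableSet (Metric.ball (0 : Plane) (q.Del k r t)) :=
      Metric.isOpen_ball.measurableSet
    have hmem : ∀ x : Plane, x ∈ Metric.ball (0 : Plane) (q.Del k r t) ↔
        ‖x‖ / q.amp t < r / q.amp k := fun x => by rw [← hset]; rfl
    rw [← lintegral_add_compl _ hmB]
    congr 1
    · rw [setLIntegral_congr_fun (g := fun _ => 1) hmB fun x hx => if_pos ((hmem x).1 hx),
        setLIntegral_const, one_mul, EuclideanSpace.volume_ball_fin_two,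
        ← ENNReal.ofReal_pow hD, ← ENNReal.ofReal_mul (by positivity), mul_comm]
    · exact setLIntegral_congr_fun hmB.compl fun x hx => if_neg fun h => hx ((hmem x).2 h)
  simp_rw [bsExponent, hsplit, mul_add, Finset.sum_add_distrib]
  rw [bsTail]
  congr 1
  rw [Xi_eq, Finset.mul_sum, ENNReal.ofReal_sum_of_nonneg]
  · refine Finset.sum_congr rfl fun t _ => ?_
    rw [← ENNReal.ofReal_mul (q.dens_pos t).le, Del_eq, ← amp_sq]
    congr 1
    have := q.amp_pos k
    field_simp
  · intro t _
    have := q.dens_pos t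
    have := Real.rpow_pos_of_pos (q.power_pos k) (2 / q.α)
    have := Real.pi_pos
    positivity

@[simp] lemma bsTail_zero (k : Fin K) (r : ℝ) : q.bsTail 0 k r = 0 := by simp [bsTail]

lemma measurable_bsTail (s : ℝ≥0) (k : Fin K) : Measurable (q.bsTail s k) := by
  refine Finset.measurable_sum _ fun t _ => Measurable.const_mul ?_ _
  have h : ∀ r, ∫⁻ x in (Metric.ball (0 : Plane) (q.Del k r t))ᶜ,
      (1 - (1 + s * gain q.α (q.power t) x)⁻¹) = ∫⁻ x : Plane, if q.Del k r t ≤ ‖x‖ then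
        (1 - (1 + s * gain q.α (q.power t) x)⁻¹) else 0 := by
    intro r
    rw [← lintegral_indicator Metric.isOpen_ball.measurableSet.compl]
    refine lintegral_congr fun x => ?_
    simp [indicator]
  simp_rw [h]
  refine Measurable.lintegral_prod_right' (f := fun p : ℝ × Plane =>
    if q.Del k p.1 t ≤ ‖p.2‖ then (1 - (1 + s * gain q.α (q.power t) p.2)⁻¹) else 0) ?_
  refine Measurable.ite (measurableSet_le ?_ ?_) ?_ measurable_const
  · exact measurable_fst.mul_const _
  · exact measurable_norm.comp measurable_snd
  · exact measurable_const.sub ((measurable_const.add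
      ((measurable_gain _ _).comp measurable_snd |>.const_mul _)).inv)

lemma distDensity_nonneg [Nonempty (Fin K)] (k : Fin K) {r : ℝ} (hr : 0 ≤ r) :
    0 ≤ q.distDensity k r := by
  have := q.dens_pos k
  have := q.assocProb_pos k
  have := Real.pi_pos
  unfold distDensity
  positivity

lemma measurable_distDensity (k : Fin K) : Measurable (q.distDensity k) := by
  unfold distDensity
  fun_prop

lemma lintegral_distDensity [Nonempty (Fin K)] (k : Fin K) :
    ∫⁻ r in Ioi (0 : ℝ), ENNReal.ofReal (q.distDensity k r) = 1 := by
  set c : ℝ := Real.pi / q.power k ^ (2 / q.α) * q.Xi with hc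
  have hpk := Real.rpow_pos_of_pos (q.power_pos k) (2 / q.α)
  have hcpos : 0 < c := mul_pos (div_pos Real.pi_pos hpk) q.Xi_pos
  have h := lintegral_hazard (G := fun r => c * r ^ 2) (g := fun r => c * (2 * r)) (by simp)
    (fun r _ => by simpa using (hasDerivAt_pow 2 r).const_mul c)
    (fun r hr => by positivity)
    ((tendsto_pow_atTop two_ne_zero).const_mul_atTop hcpos)
  rw [← h]
  refine lintegral_congr fun r => ?_
  congr 1
  unfold distDensity assocProb
  have := q.dens_pos k
  have := q.Xi_pos
  congr 1
  · rw [hc]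
    field_simp
  · congr 1
    rw [hc]
    ring

/-- In polar coordinates `λ_k 2πr` times the void probability equals `𝒜_k f_{D_k}(r)`; the remaining
factor is the transform of the interference. -/
lemma lintegral_plane_bsExponent [Nonempty (Fin K)] (s : ℝ≥0) (k : Fin K) {W : ℝ → ℝ≥0∞}
    (hW : Measurable W) :
    ENNReal.ofReal (q.dens k) * ∫⁻ x : Plane, W ‖x‖ * nexp (q.bsExponent s k ‖x‖) =
      ENNReal.ofReal (q.assocProb k) * ∫⁻ r in Ioi (0 : ℝ),
        W r * nexp (q.bsTail s k r) * ENNReal.ofReal (q.distDensity k r) := by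
  rw [lintegral_plane_norm (F := fun r => W r * nexp (q.bsExponent s k r))
    (hW.mul (measurable_nexp.comp (q.measurable_bsExponent s k))),
    ← lintegral_const_mul' _ _ ENNReal.ofReal_ne_top,
    ← lintegral_const_mul' _ _ ENNReal.ofReal_ne_top]
  refine setLIntegral_congr_fun measurableSet_Ioi fun r hr => ?_
  have hr : 0 < r := hr
  have hA := q.assocProb_pos k
  have := q.dens_pos k
  have hpk := Real.rpow_pos_of_pos (q.power_pos k) (2 / q.α)
  have := q.Xi_pos
  rw [bsExponent_eq _ _ _ hr.le, nexp_add, nexp_ofReal (by positivity)]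
  have h1 : ENNReal.ofReal (q.assocProb k) * ENNReal.ofReal (q.distDensity k r) =
      ENNReal.ofReal (q.dens k) * (ENNReal.ofReal (2 * Real.pi * r) *
        ENNReal.ofReal (Real.exp (-(Real.pi * r ^ 2 / q.power k ^ (2 / q.α) * q.Xi)))) := by
    rw [← ENNReal.ofReal_mul hA.le, ← ENNReal.ofReal_mul (by positivity),
      ← ENNReal.ofReal_mul (by positivity)]
    congr 1
    unfold distDensity
    field_simp
  calc _ = W r * nexp (q.bsTail s k r) * (ENNReal.ofReal (q.dens k) *
        (ENNReal.ofReal (2 * Real.pi * r) *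
        ENNReal.ofReal (Real.exp (-(Real.pi * r ^ 2 / q.power k ^ (2 / q.α) * q.Xi))))) := by ring
    _ = _ := by rw [← h1]; ring

end Params

namespace Model

variable {K : ℕ} {q : Params K} {Ω : Type*} [MeasurableSpace Ω] {P : Measure Ω}
  [IsProbabilityMeasure P] (M : Model q Ω P)

include M in
lemma nonempty_tier : Nonempty (Fin K) := by
  have : Nonempty Ω := nonempty_of_isProbabilityMeasure P
  exact this.map fun ω => (M.serving ω).1

lemma ae_finite_bs : ∀ᵐ ω ∂P, ∀ n : ℕ, {j : Fin K × ℕ | ‖M.bs j.1 j.2 ω‖ ≤ n}.Finite := by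
  refine ae_all_iff.2 fun n => ?_
  have := M.hasLaplace_bs.ae_finite M.measurable_bsPoint measurable_bsDens
    (fun _ z => dens_le_densBound q z.1) (B := univ ×ˢ Metric.closedBall 0 n)
    (MeasurableSet.univ.prod Metric.isClosed_closedBall.measurableSet) (by
      rw [Measure.prod_prod]
      exact ENNReal.mul_ne_top (by simp [Measure.count_apply]) (measure_closedBall_lt_top).ne)
  simpa [bsPoint] using this

lemma ae_bs_ne_zero : ∀ᵐ ω ∂P, ∀ j : Fin K × ℕ, M.bs j.1 j.2 ω ≠ 0 := by
  have := M.hasLaplace_bs.ae_notMem M.measurable_bsPoint measurable_bsDens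
    (fun _ z => dens_le_densBound q z.1) (B := univ ×ˢ {0})
    (MeasurableSet.univ.prod (measurableSet_singleton _)) (by simp [Measure.prod_prod])
  simpa [bsPoint] using this

lemma ae_strongest_serving : ∀ᵐ ω ∂P, q.Strongest (M.bsConf ω) (M.serving ω) := by
  filter_upwards [M.ae_finite_bs, M.ae_bs_ne_zero, M.serving_tier, M.serving_nearest]
    with ω hfin hne htier hnear
  rintro ⟨t, i⟩
  have hbdd : BddBelow (range fun i => ‖M.bs t i ω‖) := ⟨0, by rintro _ ⟨i, rfl⟩; exact norm_nonneg _⟩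
  have hD : nearestDist (M.bs t) ω ≤ ‖M.bs t i ω‖ := ciInf_le hbdd i
  obtain ⟨i₀, hi₀⟩ := exists_forall_le_of_finite (w := fun i => ‖M.bs t i ω‖) fun a => by
    obtain ⟨n, hn⟩ := exists_nat_ge a
    refine ((hfin n).preimage (f := fun i => (t, i)) (by intro; simp)).subset fun i hi => ?_
    exact le_trans hi hn
  -- Positivity is essential: in Lean `0 ^ (-α) = 0`, so a tier at distance zero would count as the
  -- weakest. Local finiteness makes the infimum a minimum, and no station is at the origin.
  have hDpos : 0 < nearestDist (M.bs t) ω :=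
    (norm_pos_iff.2 (hne (t, i₀))).trans_le (le_ciInf hi₀)
  have hr : 0 < ‖M.bs (M.serving ω).1 (M.serving ω).2 ω‖ := norm_pos_iff.2 (hne _)
  have h := htier t
  rw [← hnear] at h
  have key := q.div_amp_le_of_power_le hDpos hr h
  refine le_trans key ?_
  exact div_le_div_of_nonneg_right hD (q.amp_pos t).le

lemma measurableSet_strongest (l : Fin K × ℕ) :
    MeasurableSet {b : Fin K → ℕ → Plane | q.Strongest b l} := by
  have hm : ∀ l : Fin K × ℕ, Measurable fun b : Fin K → ℕ → Plane => q.weight (l.1, b l.1 l.2) :=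
    fun l => q.measurable_weight.comp (measurable_const.prodMk
      ((measurable_pi_apply l.2).comp (measurable_pi_apply l.1)))
  simp only [Params.Strongest, ofPred_forall]
  exact MeasurableSet.iInter fun l' => measurableSet_le (hm l) (hm l')

omit [IsProbabilityMeasure P] in
lemma measurable_bsConf : Measurable M.bsConf :=
  measurable_pi_lambda _ fun t => measurable_pi_lambda _ fun i => M.measurable_bs t i

/-- Almost surely the serving base station is the only strongest one. -/
lemma ae_strongest_iff : ∀ᵐ ω ∂P, ∀ l, q.Strongest (M.bsConf ω) l ↔ l = M.serving ω := by
  classical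
  have hK := M.nonempty_tier
  -- With parameter zero and weight one this computes the mean number of strongest stations, which
  -- is `∑ 𝒜_k = 1`. The serving station is one of them, so the number is almost surely exactly one.
  have e := M.lintegral_strongest 0 (W := fun _ _ => 1) fun _ => measurable_const
  simp_rw [q.lintegral_plane_bsExponent 0 _ measurable_const] at e
  simp only [Params.bsTail_zero, nexp_zero, mul_one, one_mul, q.lintegral_distDensity] at e
  rw [← ENNReal.ofReal_sum_of_nonneg fun k _ => (q.assocProb_pos k).le, q.sum_assocProb,
    ENNReal.ofReal_one] at e
  have h0 : ∀ z, q.bsLog 0 z = 0 := fun z => by simp [Params.bsLog]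
  simp only [h0, ite_self, tsum_zero, nexp_zero] at e
  set N : Ω → ℝ≥0∞ := fun ω => ∑' l, if q.Strongest (M.bsConf ω) l then 1 else 0 with hN
  have hNm : Measurable N := Measurable.tsum fun l =>
    Measurable.ite (M.measurable_bsConf (measurableSet_strongest l)) measurable_const
      measurable_const
  have h1 : (fun _ => 1) ≤ᵐ[P] N := by
    filter_upwards [M.ae_strongest_serving] with ω hω
    calc (1 : ℝ≥0∞) = if q.Strongest (M.bsConf ω) (M.serving ω) then 1 else 0 := by rw [if_pos hω]
      _ ≤ N ω := ENNReal.le_tsum (f := fun l => if q.Strongest (M.bsConf ω) l then (1 : ℝ≥0∞) else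
          0)
        (M.serving ω)
  have h2 := ae_eq_of_ae_le_of_lintegral_le h1 (by simp) hNm.aemeasurable
    (by rw [e]; simp)
  filter_upwards [h2, M.ae_strongest_serving] with ω hω hs l
  refine ⟨fun hl => ?_, fun h => h ▸ hs⟩
  by_contra hne
  have h3 : (2 : ℝ≥0∞) ≤ N ω := by
    rw [hN]
    dsimp only
    have := ENNReal.sum_le_tsum (f := fun l => if q.Strongest (M.bsConf ω) l then (1 : ℝ≥0∞) else 0)
      {l, M.serving ω}
    rw [Finset.sum_pair hne, if_pos hl, if_pos hs, one_add_one_eq_two] at this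
    exact this
  rw [← hω] at h3
  norm_num at h3

end Model
end HetNet

/-! ### Intensities and exponents of users, jammers and hole centres -/

namespace HetNet

section Proc

variable {K : ℕ}

instance : MeasurableSpace (Proc K) := ⊤

/-- The processes other than the base stations as a sum type. -/
def procEquiv (K : ℕ) : Proc K ≃ Unit ⊕ (Fin K ⊕ Fin K) where
  toFun
    | .jammer => .inl ()
    | .user t => .inr (.inl t)
    | .centre t => .inr (.inr t)
  invFun
    | .inl _ => .jammer
    | .inr (.inl t) => .user t
    | .inr (.inr t) => .centre t
  left_inv p := by cases p <;> rfl
  right_inv p := by rcases p with _ | _ | _ <;> rfl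

instance : Fintype (Proc K) := Fintype.ofEquiv _ (procEquiv K).symm

instance : DiscreteMeasurableSpace (Proc K) := ⟨fun _ => trivial⟩

lemma sum_proc {A : Type*} [AddCommMonoid A] (F : Proc K → A) :
    ∑ p, F p = F .jammer + (∑ t, F (.user t) + ∑ t, F (.centre t)) := by
  rw [← (procEquiv K).symm.sum_comp, Fintype.sum_sum_type, Fintype.sum_sum_type]
  simp [procEquiv]

lemma tsum_proc (F : Proc K × ℕ → ℝ≥0∞) :
    ∑' j, F j = ∑' i, F (.jammer, i) + (∑ t, ∑' i, F (.user t, i) + ∑ t, ∑' i, F (.centre t, i)) :=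
        by
  rw [ENNReal.tsum_prod', tsum_fintype, sum_proc]

end Proc

namespace Params

variable {K : ℕ} (q : Params K)

/-- The intensities of the processes other than the base stations. -/
def procDens (k : Fin K) (r : ℝ) : Proc K → ℝ → ℝ
  | .jammer, _ => q.densJ
  | .user t, y => q.userDensity k r t y
  | .centre t, y => q.userDensity k r t y

lemma userDensity_nonneg (k : Fin K) (r : ℝ) (t : Fin K) (y : ℝ) : 0 ≤ q.userDensity k r t y := by
  have h1 := q.dens_pos t
  have h2 := q.power_pos t
  have h3 := q.power_pos k
  refine mul_nonneg h1.le (sub_nonneg.2 (Real.exp_le_one_iff.2 (neg_nonpos.2 ?_)))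
  positivity

lemma userDensity_le (k : Fin K) (r : ℝ) (t : Fin K) (y : ℝ) : q.userDensity k r t y ≤ q.dens t :=
    by
  refine mul_le_of_le_one_right (q.dens_pos t).le ?_
  linarith [Real.exp_pos (-(Real.pi * (r + y) ^ 2 * q.dens t *
    (q.power t / q.power k) ^ (2 / q.α)))]

lemma measurable_userDensity (k t : Fin K) :
    Measurable fun p : ℝ × ℝ => q.userDensity k p.1 t p.2 := by
  unfold userDensity
  fun_prop

lemma measurable_procDens (k : Fin K) (p : Proc K) :
    Measurable fun a : ℝ × ℝ => q.procDens k a.1 p a.2 := by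
  cases p
  · exact measurable_const
  · exact q.measurable_userDensity k _
  · exact q.measurable_userDensity k _

lemma intensity_eq (k : Fin K) (r : ℝ) (p : Proc K) :
    q.intensity k r p = volume.withDensity fun x => ENNReal.ofReal (q.procDens k r p ‖x‖) := by
  cases p
  · simp only [intensity, procDens, withDensity_const]
  · rfl
  · rfl

lemma ofReal_procDens_le (k : Fin K) (r : ℝ) (p : Proc K) (y : ℝ) :
    ENNReal.ofReal (q.procDens k r p y) ≤ Model.densBound q := by
  cases p with
  | jammer =>
    refine ENNReal.ofReal_le_ofReal ?_
    have : 0 ≤ ∑ t, q.dens t := Finset.sum_nonneg fun t _ => (q.dens_pos t).le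
    simp only [procDens]
    linarith
  | user t =>
    exact (ENNReal.ofReal_le_ofReal (q.userDensity_le k r t y)).trans (Model.dens_le_densBound q t)
  | centre t =>
    exact (ENNReal.ofReal_le_ofReal (q.userDensity_le k r t y)).trans (Model.dens_le_densBound q t)

/-- The mean number of hole centres closer than `v`. -/
def holeVoid (k : Fin K) (r v : ℝ) : ℝ≥0∞ :=
  ∑ t, ∫⁻ x : Plane, if ‖x‖ < v then ENNReal.ofReal (q.userDensity k r t ‖x‖) else 0

/-- The exponent of the Laplace transform of the interference from the users. -/
def userExponent (s : ℝ≥0) (k : Fin K) (r : ℝ) : ℝ≥0∞ :=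
  ∑ t, ∫⁻ x : Plane, ENNReal.ofReal (q.userDensity k r t ‖x‖) *
    (1 - (1 + s * gain q.α q.powerU x)⁻¹)

/-- The exponent of the Laplace transform of the interference from the jammers outside the disc of
radius `R` around the origin and at distance more than `R'` from `c`. -/
def jamExponent (s : ℝ≥0) (R R' : ℝ) (c : Plane) : ℝ≥0∞ :=
  ∫⁻ x : Plane, ENNReal.ofReal q.densJ *
    if R ≤ ‖x‖ ∧ R' < dist x c then (1 - (1 + s * gain q.α q.powerJ x)⁻¹) else 0

/-- The Laplace transform of the interference from the jammers. -/
def jamLaplace (s : ℝ≥0) (R R' : ℝ) (k : Fin K) (r : ℝ) : ℝ≥0∞ :=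
  ∫⁻ c : Plane, ENNReal.ofReal (q.userDensityTotal k r ‖c‖) *
    nexp (q.holeVoid k r ‖c‖ + q.jamExponent s R R' c)

lemma ofReal_userDensityTotal (k : Fin K) (r y : ℝ) :
    ENNReal.ofReal (q.userDensityTotal k r y) = ∑ t, ENNReal.ofReal (q.userDensity k r t y) :=
  ENNReal.ofReal_sum_of_nonneg fun t _ => q.userDensity_nonneg k r t y

lemma measurable_userDensityTotal (k : Fin K) :
    Measurable fun p : ℝ × ℝ => q.userDensityTotal k p.1 p.2 :=
  Finset.measurable_sum _ fun t _ => q.measurable_userDensity k t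

lemma measurable_holeVoid (k : Fin K) : Measurable fun p : ℝ × ℝ => q.holeVoid k p.1 p.2 := by
  refine Finset.measurable_sum _ fun t _ => ?_
  refine Measurable.lintegral_prod_right' (f := fun p : (ℝ × ℝ) × Plane =>
    if ‖p.2‖ < p.1.2 then ENNReal.ofReal (q.userDensity k p.1.1 t ‖p.2‖) else 0) ?_
  refine Measurable.ite (measurableSet_lt (by fun_prop) (by fun_prop)) ?_ measurable_const
  exact ((q.measurable_userDensity k t).comp (f := fun p : (ℝ × ℝ) × Plane => (p.1.1, ‖p.2‖))
    (by fun_prop)).ennreal_ofReal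

lemma measurable_userExponent (s : ℝ≥0) (k : Fin K) : Measurable (q.userExponent s k) := by
  refine Finset.measurable_sum _ fun t _ => ?_
  refine Measurable.lintegral_prod_right' (f := fun p : ℝ × Plane =>
    ENNReal.ofReal (q.userDensity k p.1 t ‖p.2‖) * (1 - (1 + s * gain q.α q.powerU p.2)⁻¹)) ?_
  refine Measurable.mul ?_ ?_
  · exact ((q.measurable_userDensity k t).comp (f := fun p : ℝ × Plane => (p.1, ‖p.2‖))
      (by fun_prop)).ennreal_ofReal
  · exact measurable_const.sub ((measurable_const.add
      ((measurable_gain _ _).comp measurable_snd |>.const_mul _)).inv)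

lemma measurable_jamExponent (s : ℝ≥0) (R R' : ℝ) : Measurable (q.jamExponent s R R') := by
  refine Measurable.lintegral_prod_right' (f := fun p : Plane × Plane => ENNReal.ofReal q.densJ *
    if R ≤ ‖p.2‖ ∧ R' < dist p.2 p.1 then (1 - (1 + s * gain q.α q.powerJ p.2)⁻¹) else 0) ?_
  refine Measurable.const_mul (Measurable.ite ?_ ?_ measurable_const) _
  · have h1 : MeasurableSet {p : Plane × Plane | R ≤ ‖p.2‖} :=
      measurableSet_le (by fun_prop) (by fun_prop)
    have h2 : MeasurableSet {p : Plane × Plane | R' < dist p.2 p.1} :=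
      measurableSet_lt (by fun_prop) (by fun_prop)
    exact h1.inter h2
  · exact measurable_const.sub ((measurable_const.add
      ((measurable_gain _ _).comp measurable_snd |>.const_mul _)).inv)

lemma measurable_jamLaplace (s : ℝ≥0) (R R' : ℝ) (k : Fin K) :
    Measurable (q.jamLaplace s R R' k) := by
  refine Measurable.lintegral_prod_right' (f := fun p : ℝ × Plane =>
    ENNReal.ofReal (q.userDensityTotal k p.1 ‖p.2‖) *
    nexp (q.holeVoid k p.1 ‖p.2‖ + q.jamExponent s R R' p.2)) ?_
  have hm : Measurable fun p : ℝ × Plane => (p.1, ‖p.2‖) := by fun_prop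
  exact ((q.measurable_userDensityTotal k).comp hm).ennreal_ofReal.mul (measurable_nexp.comp
    (((q.measurable_holeVoid k).comp hm).add ((q.measurable_jamExponent s R R').comp
      measurable_snd)))

end Params

/-- The pairs of marked points `(z, w)` with `w` a hole centre closer to the origin than `z`, or
`w` a jammer at distance more than `R` from `z`, as a countable union of rectangles. -/
lemma exists_rectangle_iff {K : ℕ} (R : ℝ) (z w : Proc K × Plane) :
    (∃ i : ℚ ⊕ (ℕ × ℚ), z ∈ (Sum.elim (fun a : ℚ => {z : Proc K × Plane | (a : ℝ) < ‖z.2‖})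
        (fun b : ℕ × ℚ => {z : Proc K × Plane | dist z.2 (TopologicalSpace.denseSeq Plane b.1) <
            b.2}) i) ∧
      w ∈ (Sum.elim (fun a : ℚ => {w : Proc K × Plane | (∃ t, w.1 = .centre t) ∧ ‖w.2‖ < a})
        (fun b : ℕ × ℚ => {w : Proc K × Plane | w.1 = .jammer ∧
          R + b.2 < dist w.2 (TopologicalSpace.denseSeq Plane b.1)}) i)) ↔
    ((∃ t, w.1 = .centre t) ∧ ‖w.2‖ < ‖z.2‖) ∨ (w.1 = .jammer ∧ R < dist w.2 z.2) := by
  constructor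
  · rintro ⟨a | ⟨n, ε⟩, h1, h2⟩
    · exact Or.inl ⟨h2.1, h2.2.trans h1⟩
    · refine Or.inr ⟨h2.1, ?_⟩
      have h3 : dist z.2 (TopologicalSpace.denseSeq Plane n) < ε := h1
      have h4 : R + ε < dist w.2 (TopologicalSpace.denseSeq Plane n) := h2.2
      linarith [dist_triangle w.2 z.2 (TopologicalSpace.denseSeq Plane n)]
  · rintro (⟨h1, h2⟩ | ⟨h1, h2⟩)
    · obtain ⟨a, ha, hb⟩ := exists_rat_btwn h2
      exact ⟨Sum.inl a, hb, h1, ha⟩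
    · set δ := dist w.2 z.2 - R with hδ
      have hδ0 : 0 < δ := by linarith
      -- The dense point `d` is within `δ / 3 < ε` of `z`, so its distance from `w` is at least `R +
      -- 2δ / 3`, which exceeds `R + ε` because `ε < δ / 2`.
      obtain ⟨ε, hε1, hε2⟩ := exists_rat_btwn (show δ / 3 < δ / 2 by linarith)
      obtain ⟨n, hn⟩ := (TopologicalSpace.denseRange_denseSeq Plane).exists_dist_lt z.2
        (show 0 < δ / 3 by linarith)
      refine ⟨Sum.inr (n, ε), hn.trans hε1, h1, ?_⟩
      change R + ε < dist w.2 (TopologicalSpace.denseSeq Plane n)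
      have := dist_triangle_right w.2 z.2 (TopologicalSpace.denseSeq Plane n)
      linarith

end HetNet

/-! ### The Mecke formula at the closest hole centre -/

namespace HetNet

namespace Params

variable {K : ℕ} (q : Params K)

/-- The contribution of the scheduled users to the exponent. -/
def userPart (s : ℝ≥0) : Proc K × Plane → ℝ≥0∞
  | (.user _, x) => logAdd (s * gain q.α q.powerU x)
  | _ => 0

open Classical in
/-- The contribution of the hole centres (which must be void) and of the jammers outside the disc
of radius `R` to the exponent. -/
def holePart (s : ℝ≥0) (R : ℝ) : Proc K × Plane → ℝ≥0∞
  | (.centre _, _) => ∞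
  | (.jammer, x) => if R ≤ ‖x‖ then logAdd (s * gain q.α q.powerJ x) else 0
  | _ => 0

lemma measurable_userPart (s : ℝ≥0) : Measurable (q.userPart s) := by
  refine measurable_from_prod_countable_right fun p => ?_
  cases p
  · exact measurable_const
  · exact measurable_logAdd.comp ((measurable_gain _ _).const_mul _)
  · exact measurable_const

lemma measurable_holePart (s : ℝ≥0) (R : ℝ) : Measurable (q.holePart s R) := by
  refine measurable_from_prod_countable_right fun p => ?_
  cases p
  · exact Measurable.ite (measurableSet_le measurable_const measurable_norm)
      (measurable_logAdd.comp ((measurable_gain _ _).const_mul _)) measurable_const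
  · exact measurable_const
  · exact measurable_const

/-- The set where `holePart` contributes. -/
def holeSet (R' : ℝ) (z : Proc K × Plane) : Set (Proc K × Plane) :=
  {w | ((∃ t, w.1 = .centre t) ∧ ‖w.2‖ < ‖z.2‖) ∨ (w.1 = .jammer ∧ R' < dist w.2 z.2)}

end Params

namespace Model

variable {K : ℕ} {q : Params K} {Ω : Type*} [MeasurableSpace Ω] {P : Measure Ω}
  (M : Model q Ω P)

lemma measurable_tier : Measurable M.tier := measurable_fst.comp M.measurable_serving

lemma measurable_dist : Measurable M.dist := by
  have h : Measurable fun p : (Fin K × ℕ) × Ω => ‖M.bs p.1.1 p.1.2 p.2‖ :=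
    measurable_from_prod_countable_right fun l =>
      measurable_norm.comp (M.measurable_bs l.1 l.2)
  have e : M.dist = (fun p : (Fin K × ℕ) × Ω => ‖M.bs p.1.1 p.1.2 p.2‖) ∘
      fun ω => (M.serving ω, ω) := rfl
  rw [e]
  exact h.comp (M.measurable_serving.prodMk measurable_id)

lemma sigmaBS_le : sigmaBS M.bs ≤ ‹MeasurableSpace Ω› := M.measurable_bsConf.comap_le

lemma measurable_proc (p : Proc K) (i : ℕ) : Measurable (M.proc p i) := M.proc_poisson.1 p i

/-- The points of all processes other than the base stations, marked by their process. -/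
def procPoint (j : Proc K × ℕ) (ω : Ω) : Proc K × Plane := (j.1, M.proc j.1 j.2 ω)

lemma measurable_procPoint (j : Proc K × ℕ) : Measurable (M.procPoint j) :=
  measurable_const.prodMk (M.measurable_proc _ _)

/-- The conditional intensities of the processes other than the base stations. -/
def condDens (ω : Ω) (z : Proc K × Plane) : ℝ≥0∞ :=
  ENNReal.ofReal (q.procDens (M.tier ω) (M.dist ω) z.1 ‖z.2‖)

lemma measurable_condDens : Measurable (Function.uncurry M.condDens) := by
  have h : Measurable fun a : (Fin K × Proc K) × (ℝ × ℝ) =>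
      ENNReal.ofReal (q.procDens a.1.1 a.2.1 a.1.2 a.2.2) :=
    measurable_from_prod_countable_right fun kp => (q.measurable_procDens kp.1 kp.2).ennreal_ofReal
  exact h.comp (((M.measurable_tier.comp measurable_fst).prodMk
    (measurable_fst.comp measurable_snd)).prodMk ((M.measurable_dist.comp measurable_fst).prodMk
      (measurable_norm.comp (measurable_snd.comp measurable_snd))))

lemma condDens_le (ω : Ω) (z : Proc K × Plane) : M.condDens ω z ≤ densBound q :=
  q.ofReal_procDens_le _ _ _ _

variable [IsProbabilityMeasure P]

lemma hasLaplace_proc {S : Set Ω} (hS : MeasurableSet[sigmaBS M.bs] S) :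
    HasLaplace (P.restrict S) M.procPoint (Measure.count.prod volume) M.condDens := by
  have h := M.proc_poisson.hasPoissonCounts M.sigmaBS_le hS
  refine HasPoissonCounts.hasLaplace (C := densBound q) M.measurable_condDens M.condDens_le ?_
    M.measurable_proc
  have e : (fun p ω => q.intensity (M.serving ω).1 ‖M.bs (M.serving ω).1 (M.serving ω).2 ω‖ p) =
      fun (p : Proc K) ω => volume.withDensity fun x => M.condDens ω (p, x) := by
    funext p ω
    rw [Params.intensity_eq]
    rfl
  rwa [e] at h

/-- Both relations in `holeSet` are strict, hence countable unions of rectangles by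
`exists_rectangle_iff`. The activity condition for jammers is the closed one, `R ≤ dist`; it is
recovered later by letting `R'` increase to `R`. -/
lemma meckeHolds_proc {S : Set Ω} (hS : MeasurableSet[sigmaBS M.bs] S) (sU sJ : ℝ≥0) (R R' : ℝ) :
    MeckeHolds (P.restrict S) M.procPoint (Measure.count.prod volume) M.condDens
      fun z w => q.userPart sU w + (Params.holeSet R' z).indicator (q.holePart sJ R) w := by
  have h := (M.hasLaplace_proc hS).meckeHolds_countable_rectangles (I := ℚ ⊕ (ℕ × ℚ))
    M.measurable_procPoint M.measurable_condDens M.condDens_le (q.measurable_userPart sU)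
    (q.measurable_holePart sJ R)
    (A := Sum.elim (fun a : ℚ => {z : Proc K × Plane | (a : ℝ) < ‖z.2‖})
        (fun b : ℕ × ℚ => {z : Proc K × Plane | Dist.dist z.2 (TopologicalSpace.denseSeq Plane b.1)
            < b.2}))
    (B := Sum.elim (fun a : ℚ => {w : Proc K × Plane | (∃ t, w.1 = .centre t) ∧ ‖w.2‖ < a})
        (fun b : ℕ × ℚ => {w : Proc K × Plane | w.1 = .jammer ∧
          R' + b.2 < Dist.dist w.2 (TopologicalSpace.denseSeq Plane b.1)}))
    ?_ ?_
  · simp only [exists_rectangle_iff] at h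
    exact h
  · rintro (a | ⟨n, ε⟩)
    · exact measurableSet_lt measurable_const (measurable_norm.comp measurable_snd)
    · exact measurableSet_lt (measurable_snd.dist measurable_const) measurable_const
  · have hfst : ∀ s : Set (Proc K), MeasurableSet {w : Proc K × Plane | w.1 ∈ s} := fun s =>
      measurable_fst (MeasurableSet.of_discrete (s := s))
    rintro (a | ⟨n, ε⟩)
    · exact (hfst {p | ∃ t, p = .centre t}).inter
        (measurableSet_lt (measurable_norm.comp measurable_snd) measurable_const)
    · exact (hfst {.jammer}).inter
        (measurableSet_lt measurable_const (measurable_snd.dist measurable_const))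

/-- The part of the exponent that comes from the users. -/
def userSum (s : ℝ≥0) (ω : Ω) : ℝ≥0∞ :=
  ∑ t, ∑' i, logAdd (s * gain q.α q.powerU (M.proc (.user t) i ω))

open Classical in
/-- The part of the exponent that comes from the jammers outside the disc of radius `R` around the
origin and at distance more than `R'` from `c`. -/
def jamSum (s : ℝ≥0) (R R' : ℝ) (c : Plane) (ω : Ω) : ℝ≥0∞ :=
  ∑' j, if R ≤ ‖M.proc .jammer j ω‖ ∧ R' < Dist.dist (M.proc .jammer j ω) c then
    logAdd (s * gain q.α q.powerJ (M.proc .jammer j ω)) else 0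

omit [IsProbabilityMeasure P] in
open Classical in
-- The exponent separates by type of process: a hole centre closer than the selected one makes it
-- infinite, the jammers enter only outside the two discs, and the users do not depend on the
-- selection.
lemma mecke_term (sU sJ : ℝ≥0) (R R' : ℝ) (t : Fin K) (i : ℕ) (ω : Ω) :
    nexp (∑' j, (q.userPart sU (M.procPoint j ω) +
      (Params.holeSet R' (M.procPoint (.centre t, i) ω)).indicator (q.holePart sJ R)
        (M.procPoint j ω))) =
      if M.Closest t i ω then
        nexp (M.userSum sU ω + M.jamSum sJ R R' (M.proc (.centre t) i ω) ω) else 0 := by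
  set z := M.procPoint (.centre t, i) ω with hz
  have hjam : ∀ x : Plane, ((.jammer, x) : Proc K × Plane) ∈ Params.holeSet R' z ↔
      R' < Dist.dist x (M.proc (.centre t) i ω) := by
    intro x
    simp [Params.holeSet, hz, procPoint]
  have huser : ∀ t' (x : Plane), ((.user t', x) : Proc K × Plane) ∉ Params.holeSet R' z := by
    intro t' x
    simp [Params.holeSet]
  have hcen : ∀ t' (x : Plane), ((.centre t', x) : Proc K × Plane) ∈ Params.holeSet R' z ↔
      ‖x‖ < ‖M.proc (.centre t) i ω‖ := by
    intro t' x
    simp [Params.holeSet, hz, procPoint]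
  rw [tsum_proc]
  have e1 : ∑' j, (q.userPart sU (M.procPoint (.jammer, j) ω) +
      (Params.holeSet R' z).indicator (q.holePart sJ R) (M.procPoint (.jammer, j) ω)) =
      M.jamSum sJ R R' (M.proc (.centre t) i ω) ω := by
    refine tsum_congr fun j => ?_
    rw [procPoint, indicator_apply, hjam, Params.userPart, zero_add, Params.holePart]
    by_cases h1 : R' < Dist.dist (M.proc .jammer j ω) (M.proc (.centre t) i ω) <;>
      by_cases h2 : R ≤ ‖M.proc .jammer j ω‖ <;> simp [h1, h2]
    simp
  have e2 : ∑ t', ∑' j, (q.userPart sU (M.procPoint (.user t', j) ω) +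
      (Params.holeSet R' z).indicator (q.holePart sJ R) (M.procPoint (.user t', j) ω)) =
      M.userSum sU ω := by
    refine Finset.sum_congr rfl fun t' _ => tsum_congr fun j => ?_
    rw [procPoint, indicator_of_notMem (huser _ _), add_zero, Params.userPart]
  have e3 : ∑ t', ∑' j, (q.userPart sU (M.procPoint (.centre t', j) ω) +
      (Params.holeSet R' z).indicator (q.holePart sJ R) (M.procPoint (.centre t', j) ω)) =
      if M.Closest t i ω then 0 else ∞ := by
    have h0 : ∀ t' j, q.userPart sU (M.procPoint (.centre t', j) ω) +
        (Params.holeSet R' z).indicator (q.holePart sJ R) (M.procPoint (.centre t', j) ω) =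
        if ‖M.proc (.centre t') j ω‖ < ‖M.proc (.centre t) i ω‖ then ∞ else 0 := by
      intro t' j
      rw [procPoint, indicator_apply, hcen, Params.userPart, zero_add, Params.holePart]
      simp
    simp_rw [h0]
    split_ifs with h
    · refine Finset.sum_eq_zero fun t' _ => ENNReal.tsum_eq_zero.2 fun j => ?_
      rw [if_neg (not_lt.2 (h t' j))]
    · simp only [Closest, not_forall, not_le] at h
      obtain ⟨t', j, hj⟩ := h
      refine ENNReal.sum_eq_top.2 ⟨t', Finset.mem_univ _, ?_⟩
      exact ENNReal.tsum_eq_top_of_eq_top ⟨j, if_pos hj⟩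
  rw [e1, e2, e3]
  split_ifs
  · rw [add_zero, add_comm]
  · simp

omit [IsProbabilityMeasure P] in
open Classical in
-- The intensity integral splits in the same way: the users give their Laplace exponent, the centres
-- the mean number of points closer than `c`, the jammers the exponent of those outside the two
-- discs.
lemma lintegral_mecke_exponent (sU sJ : ℝ≥0) (R R' : ℝ) (t : Fin K) (c : Plane) (ω : Ω) :
    ∫⁻ w, M.condDens ω w * (1 - nexp (q.userPart sU w +
        (Params.holeSet R' (.centre t, c)).indicator (q.holePart sJ R) w))
        ∂(Measure.count.prod volume) =
      q.userExponent sU (M.tier ω) (M.dist ω) + (q.holeVoid (M.tier ω) (M.dist ω) ‖c‖ +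
        q.jamExponent sJ R R' c) := by
  have hjam : ∀ x : Plane, ((.jammer, x) : Proc K × Plane) ∈ Params.holeSet R' (.centre t, c) ↔
      R' < Dist.dist x c := by
    intro x
    simp [Params.holeSet]
  have huser : ∀ t' (x : Plane), ((.user t', x) : Proc K × Plane) ∉
      Params.holeSet R' (.centre t, c) := by
    intro t' x
    simp [Params.holeSet]
  have hcen : ∀ t' (x : Plane), ((.centre t', x) : Proc K × Plane) ∈
      Params.holeSet R' (.centre t, c) ↔ ‖x‖ < ‖c‖ := by
    intro t' x
    simp [Params.holeSet]
  have hset : MeasurableSet (Params.holeSet (K := K) R' (.centre t, c)) := by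
    have hfst : ∀ s : Set (Proc K), MeasurableSet {w : Proc K × Plane | w.1 ∈ s} := fun s =>
      measurable_fst (MeasurableSet.of_discrete (s := s))
    refine ((hfst {p | ∃ t, p = .centre t}).inter ?_).union ((hfst {.jammer}).inter ?_)
    · exact measurableSet_lt (measurable_norm.comp measurable_snd) measurable_const
    · exact measurableSet_lt measurable_const (measurable_snd.dist measurable_const)
  have hm : Measurable fun w => M.condDens ω w * (1 - nexp (q.userPart sU w +
        (Params.holeSet R' (.centre t, c)).indicator (q.holePart sJ R) w)) :=
    M.measurable_condDens.of_uncurry_left.mul (measurable_const.sub (measurable_nexp.comp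
      ((q.measurable_userPart sU).add ((q.measurable_holePart sJ R).indicator hset))))
  rw [lintegral_count_prod hm, sum_proc, add_comm, add_assoc]
  congr 1
  · refine Finset.sum_congr rfl fun t' _ => lintegral_congr fun x => ?_
    rw [indicator_of_notMem (huser _ _), add_zero, Params.userPart, nexp_logAdd]
    rfl
  congr 1
  · refine Finset.sum_congr rfl fun t' _ => lintegral_congr fun x => ?_
    rw [indicator_apply, hcen, (show q.userPart sU (.centre t', x) = 0 from rfl), zero_add,
      Params.holePart]
    split_ifs <;> simp [condDens, Params.procDens]
  · refine lintegral_congr fun x => ?_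
    rw [indicator_apply, hjam, (show q.userPart sU (.jammer, x) = 0 from rfl), zero_add,
      Params.holePart]
    by_cases h1 : R' < Dist.dist x c <;> by_cases h2 : R ≤ ‖x‖ <;>
      simp [h1, h2, condDens, Params.procDens, nexp_logAdd]

open Classical in
-- The Mecke formula with `f` selecting the hole centres. Integrating over the position of the
-- selected centre produces `jamLaplace`; the factor of the users does not depend on it and comes
-- out.
lemma lintegral_closest {S : Set Ω} (hS : MeasurableSet[sigmaBS M.bs] S) (sU sJ : ℝ≥0)
    (R R' : ℝ) :
    ∫⁻ ω in S, ∑ t, ∑' i, (if M.Closest t i ω then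
        nexp (M.userSum sU ω + M.jamSum sJ R R' (M.proc (.centre t) i ω) ω) else 0) ∂P =
      ∫⁻ ω in S, nexp (q.userExponent sU (M.tier ω) (M.dist ω)) *
        q.jamLaplace sJ R R' (M.tier ω) (M.dist ω) ∂P := by
  set f : Proc K × Plane → ℝ≥0∞ := fun z => {p : Proc K | ∃ t, p = .centre t}.indicator 1 z.1
    with hf
  have hfm : Measurable f := (measurable_from_top (f :=
    {p : Proc K | ∃ t, p = .centre t}.indicator (1 : Proc K → ℝ≥0∞))).comp measurable_fst
  have hfj : ∀ x, f (.jammer, x) = 0 := fun x => by simp [hf]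
  have hfu : ∀ t x, f (.user t, x) = 0 := fun t x => by simp [hf]
  have hfc : ∀ t x, f (.centre t, x) = 1 := fun t x => by simp [hf]
  have hM := M.meckeHolds_proc hS sU sJ R R'
  have e := hM.eq f hfm
  refine Eq.trans (lintegral_congr fun ω => ?_) (e.trans (lintegral_congr fun ω => ?_))
  · rw [tsum_proc]
    simp only [procPoint, hfj, hfu, hfc, zero_mul, tsum_zero, Finset.sum_const_zero, zero_add,
      one_mul]
    refine Finset.sum_congr rfl fun t _ => tsum_congr fun i => ?_
    exact (M.mecke_term sU sJ R R' t i ω).symm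
  · have hm := M.measurable_condDens.of_uncurry_left (x := ω)
    have hright := (measurable_mecke_right (κ := Measure.count.prod (volume : Measure Plane))
      M.measurable_condDens hM.measurable).of_uncurry_left (x := ω)
    refine (lintegral_count_prod (hm.mul (hfm.mul hright))).trans ?_
    rw [sum_proc]
    simp only [Pi.mul_apply, hfj, hfu, hfc, zero_mul, mul_zero, lintegral_zero,
      Finset.sum_const_zero, zero_add, one_mul]
    have hself : ∀ t (x : Plane), (Params.holeSet R' (.centre t, x)).indicator (q.holePart sJ R)
        ((.centre t, x) : Proc K × Plane) = 0 := fun t x =>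
      indicator_of_notMem (by simp [Params.holeSet]) _
    simp_rw [M.lintegral_mecke_exponent, hself, Params.userPart, add_zero, nexp_zero, one_mul]
    rw [Params.jamLaplace, ← lintegral_const_mul' _ _ (nexp_ne_top _), ← lintegral_finsetSum]
    · refine lintegral_congr fun x => ?_
      rw [← Finset.sum_mul, Params.ofReal_userDensityTotal, nexp_add (q.userExponent _ _ _)]
      simp only [condDens, Params.procDens]
      ring
    · intro t _
      have h1 : Measurable fun x : Plane => M.condDens ω (.centre t, x) :=
        hm.comp measurable_prodMk_left
      have h2 : Measurable fun x : Plane => q.holeVoid (M.tier ω) (M.dist ω) ‖x‖ :=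
        (q.measurable_holeVoid (M.tier ω)).comp (measurable_const.prodMk measurable_norm)
      exact h1.mul (measurable_nexp.comp (measurable_const.add
        (h2.add (q.measurable_jamExponent sJ R R'))))

end Model
end HetNet

/-! ### The closest hole centre exists; finiteness of the mean interference -/

namespace HetNet

namespace Params

variable {K : ℕ} (q : Params K)

lemma continuous_userDensityTotal (k : Fin K) (r : ℝ) : Continuous (q.userDensityTotal k r) := by
  unfold userDensityTotal userDensity
  fun_prop

lemma userDensityTotal_nonneg (k : Fin K) (r y : ℝ) : 0 ≤ q.userDensityTotal k r y :=
  Finset.sum_nonneg fun t _ => q.userDensity_nonneg k r t y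

lemma holeVoid_eq (k : Fin K) (r : ℝ) {v : ℝ} (hv : 0 ≤ v) :
    q.holeVoid k r v =
      ENNReal.ofReal (2 * Real.pi * ∫ y in (0 : ℝ)..v, q.userDensityTotal k r y * y) := by
  have hm : Measurable fun y => if y < v then ENNReal.ofReal (q.userDensityTotal k r y) else 0 :=
    Measurable.ite measurableSet_Iio
      (q.continuous_userDensityTotal k r).measurable.ennreal_ofReal measurable_const
  have e1 : q.holeVoid k r v =
      ∫⁻ x : Plane, if ‖x‖ < v then ENNReal.ofReal (q.userDensityTotal k r ‖x‖) else 0 := by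
    rw [holeVoid, ← lintegral_finsetSum]
    · refine lintegral_congr fun x => ?_
      split_ifs
      · rw [q.ofReal_userDensityTotal]
      · simp
    · intro t _
      exact Measurable.ite (measurableSet_lt measurable_norm measurable_const)
        ((q.measurable_userDensity k t).comp (f := fun x : Plane => (r, ‖x‖))
          (by fun_prop)).ennreal_ofReal measurable_const
  rw [e1, lintegral_plane_norm hm, intervalIntegral.integral_of_le hv,
    ← integral_const_mul, ofReal_integral_eq_lintegral_ofReal]
  · rw [← setLIntegral_congr Ioo_ae_eq_Ioc, ← lintegral_indicator measurableSet_Ioi,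
      ← lintegral_indicator measurableSet_Ioo]
    refine lintegral_congr fun y => ?_
    by_cases hy : 0 < y
    · rw [indicator_of_mem (by exact hy)]
      by_cases hyv : y < v
      · rw [indicator_of_mem (by exact ⟨hy, hyv⟩), if_pos hyv, ← ENNReal.ofReal_mul (by positivity)]
        congr 1
        ring
      · rw [indicator_of_notMem (by exact fun h => hyv h.2), if_neg hyv, mul_zero]
    · rw [indicator_of_notMem (by exact hy), indicator_of_notMem (by exact fun h => hy h.1)]
  · exact (((q.continuous_userDensityTotal k r).mul continuous_id).integrableOn_Ioc).const_mul _
  · refine (ae_restrict_mem measurableSet_Ioc).mono fun y hy => ?_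
    have := q.userDensityTotal_nonneg k r y
    have := hy.1
    positivity

/-- The distance to the closest hole centre is almost surely finite. -/
lemma lintegral_userDensityTotal_holeVoid (k : Fin K) {r : ℝ} (hr : 0 < r) :
    ∫⁻ c : Plane, ENNReal.ofReal (q.userDensityTotal k r ‖c‖) * nexp (q.holeVoid k r ‖c‖) = 1 := by
  have hcont : Continuous fun y => q.userDensityTotal k r y * y :=
    (q.continuous_userDensityTotal k r).mul continuous_id
  have hm : Measurable fun v => ENNReal.ofReal (q.userDensityTotal k r v) *
      nexp (q.holeVoid k r v) :=
    (q.continuous_userDensityTotal k r).measurable.ennreal_ofReal.mul (measurable_nexp.comp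
      ((q.measurable_holeVoid k).comp (measurable_const.prodMk measurable_id)))
  rw [lintegral_plane_norm hm]
  have h := lintegral_hazard (G := fun v => 2 * Real.pi * ∫ y in (0 : ℝ)..v,
      q.userDensityTotal k r y * y) (g := fun v => 2 * Real.pi * (q.userDensityTotal k r v * v))
    (by simp) (fun v _ => (intervalIntegral.integral_hasDerivAt_right
      (hcont.intervalIntegrable _ _) (hcont.stronglyMeasurableAtFilter _ _)
      hcont.continuousAt).const_mul _)
    (fun v hv => by have := q.userDensityTotal_nonneg k r v; positivity) ?_
  · rw [← h]
    refine setLIntegral_congr_fun measurableSet_Ioi fun v hv => ?_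
    have hv : 0 < v := hv
    have := q.userDensityTotal_nonneg k r v
    have hI : 0 ≤ ∫ y in (0 : ℝ)..v, q.userDensityTotal k r y * y :=
      intervalIntegral.integral_nonneg hv.le fun y hy =>
        mul_nonneg (q.userDensityTotal_nonneg k r y) hy.1
    rw [q.holeVoid_eq k r hv.le, nexp_ofReal (by positivity), ← ENNReal.ofReal_mul (by positivity),
      ← ENNReal.ofReal_mul (by positivity)]
    congr 1
    ring
  -- The hazard must have infinite total mass. For `r > 0` the density of tier `k` is positive at
  -- distance zero and increases with the distance, so the cumulative hazard is at least `π d v²`.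
  · set d := q.userDensity k r k 0 with hd
    have hdpos : 0 < d := by
      have h1 := q.dens_pos k
      have h2 := q.power_pos k
      have : 0 < Real.pi * (r + 0) ^ 2 * q.dens k * (q.power k / q.power k) ^ (2 / q.α) := by
        rw [add_zero]; positivity
      exact mul_pos h1 (sub_pos.2 (Real.exp_lt_one_iff.2 (neg_neg_of_pos this)))
    have hle : ∀ y, 0 ≤ y → d ≤ q.userDensityTotal k r y := by
      intro y hy
      refine le_trans ?_ (Finset.single_le_sum (f := fun t => q.userDensity k r t y)
        (fun t _ => q.userDensity_nonneg k r t y) (Finset.mem_univ k))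
      have h1 := q.dens_pos k
      have h2 := q.power_pos k
      simp only [hd, userDensity]
      gcongr
    refine tendsto_atTop_mono' atTop (f₁ := fun v => Real.pi * d * v ^ 2) ?_
      ((tendsto_pow_atTop two_ne_zero).const_mul_atTop (by positivity))
    filter_upwards [eventually_ge_atTop 0] with v hv
    have h1 : ∫ y in (0 : ℝ)..v, d * y ≤ ∫ y in (0 : ℝ)..v, q.userDensityTotal k r y * y :=
      intervalIntegral.integral_mono_on hv ((by fun_prop : Continuous fun y => d * y).intervalIntegrable _ _)
        (hcont.intervalIntegrable _ _) fun y hy => mul_le_mul_of_nonneg_right (hle y hy.1) hy.1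
    rw [intervalIntegral.integral_const_mul, integral_id] at h1
    have := Real.pi_pos
    nlinarith

lemma jamExponent_zero (R R' : ℝ) (c : Plane) : q.jamExponent 0 R R' c = 0 := by
  simp [jamExponent]

lemma userExponent_zero (k : Fin K) (r : ℝ) : q.userExponent 0 k r = 0 := by
  simp [userExponent]

lemma jamLaplace_zero (R R' : ℝ) (k : Fin K) {r : ℝ} (hr : 0 < r) :
    q.jamLaplace 0 R R' k r = 1 := by
  simp_rw [jamLaplace, jamExponent_zero, add_zero]
  exact q.lintegral_userDensityTotal_holeVoid k hr

lemma one_sub_inv_one_add_le (a : ℝ≥0∞) : 1 - (1 + a)⁻¹ ≤ a := by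
  rcases eq_or_ne a ∞ with rfl | ha
  · exact le_top
  rw [tsub_le_iff_right]
  calc (1 : ℝ≥0∞) = (1 + a) * (1 + a)⁻¹ :=
        (ENNReal.mul_inv_cancel (by simp) (ENNReal.add_ne_top.2 ⟨ENNReal.one_ne_top, ha⟩)).symm
    _ = a * (1 + a)⁻¹ + (1 + a)⁻¹ := by ring
    _ ≤ a * 1 + (1 + a)⁻¹ := by
        gcongr
        exact ENNReal.inv_le_one.2 le_self_add
    _ = _ := by rw [mul_one]

/-- The mean interference from outside a disc is finite. -/
lemma lintegral_gain_lt_top (p : ℝ) {R : ℝ} (hR : 0 < R) :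
    ∫⁻ x : Plane, (if R ≤ ‖x‖ then gain q.α p x else 0) < ∞ := by
  have hm : Measurable fun y : ℝ => if R ≤ y then ENNReal.ofReal (p * y ^ (-q.α)) else 0 :=
    Measurable.ite measurableSet_Ici (by fun_prop) measurable_const
  have e := lintegral_plane_norm hm
  unfold gain
  rw [e]
  -- The radius `R / 2` keeps the boundary points `y = R` inside an open half-line; integrability at
  -- infinity is the condition `α > 2`.
  have hint : IntegrableOn (fun y : ℝ => 2 * Real.pi * |p| * y ^ (1 - q.α)) (Ioi (R / 2)) :=
    (integrableOn_Ioi_rpow_of_lt (by linarith [q.two_lt_α]) (by positivity)).const_mul _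
  refine lt_of_le_of_lt ?_ hint.lintegral_lt_top
  rw [← lintegral_indicator measurableSet_Ioi, ← lintegral_indicator measurableSet_Ioi]
  refine lintegral_mono fun y => ?_
  by_cases hy : R ≤ y
  · have hy0 : 0 < y := by linarith
    have hy1 : R / 2 < y := by linarith
    rw [indicator_of_mem (by exact hy0), indicator_of_mem (by exact hy1), if_pos hy,
      ← ENNReal.ofReal_mul (by positivity)]
    refine ENNReal.ofReal_le_ofReal ?_
    rw [sub_eq_add_neg, Real.rpow_add hy0, Real.rpow_one]
    have : 0 ≤ y ^ (-q.α) := by positivity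
    calc 2 * Real.pi * y * (p * y ^ (-q.α)) ≤ 2 * Real.pi * y * (|p| * y ^ (-q.α)) := by
          gcongr; exact le_abs_self p
      _ = _ := by ring
  · rw [indicator_apply, if_neg hy]
    simp

end Params
end HetNet

/-! ### Active jammers and the boundary of the guard zone -/

namespace HetNet

namespace Params

variable {K : ℕ} (q : Params K)

lemma jamExponent_antitone (s : ℝ≥0) (R : ℝ) (c : Plane) :
    Antitone fun R' => q.jamExponent s R R' c := by
  intro R₁ R₂ h
  refine lintegral_mono fun x => mul_le_mul_right ?_ _
  by_cases h2 : R ≤ ‖x‖ ∧ R₂ < dist x c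
  · rw [if_pos h2, if_pos ⟨h2.1, h.trans_lt h2.2⟩]
  · rw [if_neg h2]
    exact zero_le

lemma measurable_jamExponent_integrand (s : ℝ≥0) (R R' : ℝ) (c : Plane) :
    Measurable fun x : Plane => ENNReal.ofReal q.densJ *
      if R ≤ ‖x‖ ∧ R' < dist x c then (1 - (1 + s * gain q.α q.powerJ x)⁻¹) else 0 := by
  refine Measurable.const_mul (Measurable.ite ?_ ?_ measurable_const) _
  · have h1 : MeasurableSet {x : Plane | R ≤ ‖x‖} := measurableSet_le (by fun_prop) (by fun_prop)
    have h2 : MeasurableSet {x : Plane | R' < dist x c} :=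
      measurableSet_lt (by fun_prop) (by fun_prop)
    exact h1.inter h2
  · exact measurable_const.sub ((measurable_const.add ((measurable_gain _ _).const_mul _)).inv)

lemma jamExponent_ne_top (s : ℝ≥0) {R : ℝ} (hR : 0 < R) (R' : ℝ) (c : Plane) :
    q.jamExponent s R R' c ≠ ∞ := by
  have hm : Measurable fun x : Plane => if R ≤ ‖x‖ then gain q.α q.powerJ x else 0 :=
    Measurable.ite (measurableSet_le measurable_const measurable_norm) (measurable_gain _ _)
      measurable_const
  refine ne_top_of_le_ne_top (b := ENNReal.ofReal q.densJ * s *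
    ∫⁻ x : Plane, (if R ≤ ‖x‖ then gain q.α q.powerJ x else 0)) (ENNReal.mul_ne_top
      (ENNReal.mul_ne_top ENNReal.ofReal_ne_top ENNReal.coe_ne_top)
      (q.lintegral_gain_lt_top _ hR).ne) ?_
  rw [← lintegral_const_mul _ hm]
  refine lintegral_mono fun x => ?_
  rw [mul_assoc]
  refine mul_le_mul_right ?_ _
  by_cases h : R ≤ ‖x‖ ∧ R' < dist x c
  · rw [if_pos h, if_pos h.1]
    exact one_sub_inv_one_add_le _
  · rw [if_neg h]
    exact zero_le

/-- The regions at distance more than `R' - 1 / (m + 1)` from `c` decrease to the closed region at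
distance at least `R'`, which differs from the open one by a circle of measure zero. Finiteness of
the exponents permits decreasing limits. -/
lemma tendsto_jamExponent (s : ℝ≥0) {R : ℝ} (hR : 0 < R) (R' : ℝ) (c : Plane) :
    Tendsto (fun m : ℕ => q.jamExponent s R (R' - 1 / (m + 1)) c) atTop
      (𝓝 (q.jamExponent s R R' c)) := by
  refine lintegral_tendsto_of_tendsto_of_antitone
    (fun m => (q.measurable_jamExponent_integrand s R _ c).aemeasurable) ?_
    (q.jamExponent_ne_top s hR _ c) ?_
  · refine .of_forall fun x m n hmn => mul_le_mul_right ?_ _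
    have hle : R' - 1 / ((m : ℝ) + 1) ≤ R' - 1 / (n + 1) := by
      have : (m : ℝ) ≤ n := by exact_mod_cast hmn
      gcongr
    by_cases h2 : R ≤ ‖x‖ ∧ R' - 1 / ((n : ℝ) + 1) < dist x c
    · rw [if_pos h2, if_pos ⟨h2.1, hle.trans_lt h2.2⟩]
    · rw [if_neg h2]
      exact zero_le
  · have hnull : ∀ᵐ x : Plane, x ∉ Metric.sphere c R' := by
      exact measure_eq_zero_iff_ae_notMem.1 (Measure.addHaar_sphere volume c R')
    filter_upwards [hnull] with x hx
    have hx : dist x c ≠ R' := hx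
    refine ENNReal.Tendsto.const_mul ?_ (Or.inr ENNReal.ofReal_ne_top)
    refine tendsto_const_nhds.congr' ?_
    rcases lt_or_gt_of_ne hx with h | h
    · have ht : Tendsto (fun m : ℕ => R' - 1 / ((m : ℝ) + 1)) atTop (𝓝 (R' - 0)) :=
        tendsto_const_nhds.sub tendsto_one_div_add_atTop_nhds_zero_nat
      rw [sub_zero] at ht
      filter_upwards [ht.eventually (lt_mem_nhds h)] with m hm
      rw [if_neg fun h' => h'.2.not_gt h, if_neg fun h' => h'.2.not_gt hm]
    · refine .of_forall fun m => ?_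
      have : R' - 1 / ((m : ℝ) + 1) < dist x c := by
        have : 0 < 1 / ((m : ℝ) + 1) := by positivity
        linarith
      simp only [h, this]

lemma tendsto_jamLaplace (s : ℝ≥0) {R : ℝ} (hR : 0 < R) (R' : ℝ) (k : Fin K) (r : ℝ) :
    Tendsto (fun m : ℕ => q.jamLaplace s R (R' - 1 / (m + 1)) k r) atTop
      (𝓝 (q.jamLaplace s R R' k r)) := by
  refine lintegral_tendsto_of_tendsto_of_monotone (fun m => ?_) ?_ ?_
  · have hm : Measurable fun c : Plane => (r, ‖c‖) := by fun_prop
    exact (((q.measurable_userDensityTotal k).comp hm).ennreal_ofReal.mul (measurable_nexp.comp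
      (((q.measurable_holeVoid k).comp hm).add (q.measurable_jamExponent s R _)))).aemeasurable
  · refine .of_forall fun x m n hmn => mul_le_mul_right (nexp_antitone ?_) _
    refine add_le_add le_rfl (q.jamExponent_antitone s R x ?_)
    have : (m : ℝ) ≤ n := by exact_mod_cast hmn
    gcongr
  · refine .of_forall fun c => ENNReal.Tendsto.const_mul ?_ (Or.inr ENNReal.ofReal_ne_top)
    exact (continuous_nexp.tendsto _).comp (tendsto_const_nhds.add
      (q.tendsto_jamExponent s hR R' c))

lemma jamLaplace_mono (s : ℝ≥0) (R : ℝ) (k : Fin K) (r : ℝ) :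
    Monotone fun R' => q.jamLaplace s R R' k r := fun _ _ h =>
  lintegral_mono fun x => mul_le_mul_right (nexp_antitone (add_le_add le_rfl
    (q.jamExponent_antitone s R x h))) _

lemma guardRadius_pos {τ : ℝ} (hτ : 0 < τ) : 0 < q.guardRadius τ :=
  Real.rpow_pos_of_pos (div_pos q.powerJ_pos hτ) _

end Params

/-- In the configuration `x`, the `i`-th hole centre of tier `t` is a closest one. -/
def IsClosest {K : ℕ} (x : Proc K → ℕ → Plane) (l : Fin K × ℕ) : Prop :=
  ∀ (t' : Fin K) (i' : ℕ), ‖x (.centre l.1) l.2‖ ≤ ‖x (.centre t') i'‖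

/-- In the configuration `x`, the `j`-th jammer is outside the guard zones of radius `R`. -/
def IsActive {K : ℕ} (R : ℝ) (x : Proc K → ℕ → Plane) (j : ℕ) : Prop :=
  x .jammer j ∉ Metric.ball (0 : Plane) R ∧
    ∀ (t : Fin K) (i : ℕ), IsClosest x (t, i) → x .jammer j ∉ Metric.ball (x (.centre t) i) R

lemma measurableSet_isClosest {K : ℕ} (l : Fin K × ℕ) :
    MeasurableSet {x : Proc K → ℕ → Plane | IsClosest x l} := by
  have hm : ∀ p i, Measurable fun x : Proc K → ℕ → Plane => ‖x p i‖ := fun p i => by fun_prop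
  simp only [IsClosest, ofPred_forall]
  exact MeasurableSet.iInter fun t => MeasurableSet.iInter fun i =>
    measurableSet_le (hm _ _) (hm _ _)

lemma measurableSet_isActive {K : ℕ} (R : ℝ) (j : ℕ) :
    MeasurableSet {x : Proc K → ℕ → Plane | IsActive R x j} := by
  have e : {x : Proc K → ℕ → Plane | IsActive R x j} = {x | R ≤ ‖x .jammer j‖} ∩
      ⋂ t, ⋂ i, ({x | IsClosest x (t, i)}ᶜ ∪ {x | R ≤ dist (x .jammer j) (x (.centre t) i)}) := by
    ext x
    simp [IsActive, imp_iff_not_or]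
  rw [e]
  refine (measurableSet_le (by fun_prop) (by fun_prop)).inter (MeasurableSet.iInter fun t =>
    MeasurableSet.iInter fun i => (measurableSet_isClosest _).compl.union
      (measurableSet_le (by fun_prop) (by fun_prop)))

namespace Model

variable {K : ℕ} {q : Params K} {Ω : Type*} [MeasurableSpace Ω] {P : Measure Ω}
  (M : Model q Ω P)

/-- The configuration of the processes other than the base stations. -/
def procConf (ω : Ω) : Proc K → ℕ → Plane := fun p i => M.proc p i ω

lemma measurable_procConf : Measurable M.procConf :=
  measurable_pi_lambda _ fun p => measurable_pi_lambda _ fun i => M.measurable_proc p i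

open Classical in
/-- The part of the exponent that comes from the active jammers. -/
def activeSum (s : ℝ≥0) (R : ℝ) (ω : Ω) : ℝ≥0∞ :=
  ∑' j, if IsActive R (M.procConf ω) j then
    logAdd (s * gain q.α q.powerJ (M.proc .jammer j ω)) else 0

lemma measurable_comp_serving {A : Type*} [MeasurableSpace A] {F : Fin K → ℝ → A}
    (hF : ∀ k, Measurable (F k)) : Measurable fun ω => F (M.tier ω) (M.dist ω) :=
  (measurable_from_prod_countable_right (f := fun p : Fin K × ℝ => F p.1 p.2) hF).comp
    (M.measurable_tier.prodMk M.measurable_dist)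

lemma measurable_userSum (s : ℝ≥0) : Measurable (M.userSum s) :=
  Finset.measurable_sum _ fun _ _ => Measurable.tsum fun i => measurable_logAdd.comp
    (((measurable_gain _ _).comp (M.measurable_proc _ i)).const_mul _)

lemma measurable_activeSum (s : ℝ≥0) (R : ℝ) : Measurable (M.activeSum s R) :=
  Measurable.tsum fun i => Measurable.ite (M.measurable_procConf (measurableSet_isActive R i))
    (measurable_logAdd.comp (((measurable_gain _ _).comp (M.measurable_proc _ i)).const_mul _))
    measurable_const

variable [IsProbabilityMeasure P]

lemma ae_dist_pos : ∀ᵐ ω ∂P, 0 < M.dist ω := by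
  filter_upwards [M.ae_bs_ne_zero] with ω h
  exact norm_pos_iff.2 (h (M.serving ω))

lemma ae_finite_centre :
    ∀ᵐ ω ∂P, ∀ n : ℕ, {l : Fin K × ℕ | ‖M.proc (.centre l.1) l.2 ω‖ ≤ n}.Finite := by
  refine ae_all_iff.2 fun n => ?_
  have h := (M.hasLaplace_proc MeasurableSet.univ)
  rw [Measure.restrict_univ] at h
  have := h.ae_finite M.measurable_procPoint M.measurable_condDens M.condDens_le
    (B := univ ×ˢ Metric.closedBall 0 n)
    (MeasurableSet.univ.prod Metric.isClosed_closedBall.measurableSet) (by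
      rw [Measure.prod_prod]
      exact ENNReal.mul_ne_top (by simp [Measure.count_apply]) (measure_closedBall_lt_top).ne)
  filter_upwards [this] with ω hω
  refine (hω.preimage (f := fun l : Fin K × ℕ => ((.centre l.1 : Proc K), l.2)) ?_).subset ?_
  · rintro ⟨a, b⟩ _ ⟨c, d⟩ _ h
    simpa using h
  · intro l hl
    simpa [procPoint] using hl

/-- The counting argument again: with all Laplace parameters zero, `lintegral_closest` gives the
mean number of closest centres as the total mass of the closest-centre law, which is one. Local
finiteness provides at least one. -/
lemma ae_existsUnique_isClosest : ∀ᵐ ω ∂P, ∃ l₀, ∀ l, IsClosest (M.procConf ω) l ↔ l = l₀ := by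
  classical
  have hK := M.nonempty_tier
  have hex : ∀ᵐ ω ∂P, ∃ l, IsClosest (M.procConf ω) l := by
    filter_upwards [M.ae_finite_centre] with ω hω
    obtain ⟨l, hl⟩ := exists_forall_le_of_finite
      (w := fun l : Fin K × ℕ => ‖M.proc (.centre l.1) l.2 ω‖) fun a => by
        obtain ⟨n, hn⟩ := exists_nat_ge a
        exact (hω n).subset fun l hl => le_trans hl hn
    exact ⟨l, fun t i => hl (t, i)⟩
  set N : Ω → ℝ≥0∞ := fun ω => ∑' l, if IsClosest (M.procConf ω) l then 1 else 0 with hN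
  have hNm : Measurable N := Measurable.tsum fun l =>
    Measurable.ite (M.measurable_procConf (measurableSet_isClosest l)) measurable_const
      measurable_const
  have e : ∫⁻ ω, N ω ∂P = 1 := by
    have h := M.lintegral_closest MeasurableSet.univ 0 0 0 0
    rw [Measure.restrict_univ] at h
    have h1 : ∫⁻ ω, nexp (q.userExponent 0 (M.tier ω) (M.dist ω)) *
        q.jamLaplace 0 0 0 (M.tier ω) (M.dist ω) ∂P = 1 := by
      have h2 : ∀ᵐ ω ∂P, nexp (q.userExponent 0 (M.tier ω) (M.dist ω)) *
          q.jamLaplace 0 0 0 (M.tier ω) (M.dist ω) = 1 := by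
        filter_upwards [M.ae_dist_pos] with ω hω
        rw [q.userExponent_zero, nexp_zero, one_mul, q.jamLaplace_zero _ _ _ hω]
      rw [lintegral_congr_ae h2]
      simp
    rw [h1] at h
    rw [← h]
    refine lintegral_congr fun ω => ?_
    have h0 : ∀ c, M.jamSum 0 0 0 c ω = 0 := fun c => by simp [jamSum, logAdd_zero]
    simp only [hN, userSum, h0, logAdd_zero, ENNReal.coe_zero, zero_mul, tsum_zero,
      Finset.sum_const_zero, add_zero, nexp_zero]
    rw [ENNReal.tsum_prod', tsum_fintype]
    rfl
  have h1 : (fun _ => 1) ≤ᵐ[P] N := by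
    filter_upwards [hex] with ω ⟨l, hl⟩
    calc (1 : ℝ≥0∞) = if IsClosest (M.procConf ω) l then 1 else 0 := by rw [if_pos hl]
      _ ≤ N ω := ENNReal.le_tsum (f := fun l => if IsClosest (M.procConf ω) l then (1 : ℝ≥0∞) else
          0) l
  have h2 := ae_eq_of_ae_le_of_lintegral_le h1 (by simp) hNm.aemeasurable (by rw [e]; simp)
  filter_upwards [h2, hex] with ω hω ⟨l₀, hs⟩
  refine ⟨l₀, fun l => ⟨fun hl => ?_, fun h => h ▸ hs⟩⟩
  by_contra hne
  have h3 : (2 : ℝ≥0∞) ≤ N ω := by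
    rw [hN]
    dsimp only
    have := ENNReal.sum_le_tsum
      (f := fun l => if IsClosest (M.procConf ω) l then (1 : ℝ≥0∞) else 0) {l, l₀}
    rw [Finset.sum_pair hne, if_pos hl, if_pos hs, one_add_one_eq_two] at this
    exact this
  rw [← hω] at h3
  norm_num at h3

/-- The Laplace functional of the users and of the active jammers, on an event that depends on the
base stations. -/
lemma setLIntegral_nexp_userSum_activeSum {S : Set Ω} (hS : MeasurableSet[sigmaBS M.bs] S)
    (sU sJ : ℝ≥0) {R : ℝ} (hR : 0 < R) :
    ∫⁻ ω in S, nexp (M.userSum sU ω + M.activeSum sJ R ω) ∂P =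
      ∫⁻ ω in S, nexp (q.userExponent sU (M.tier ω) (M.dist ω)) *
        q.jamLaplace sJ R R (M.tier ω) (M.dist ω) ∂P := by
  classical
  have key : ∀ R', ∫⁻ ω in S, nexp (q.userExponent sU (M.tier ω) (M.dist ω)) *
        q.jamLaplace sJ R R' (M.tier ω) (M.dist ω) ∂P = ∫⁻ ω in S, ∑' l : Fin K × ℕ,
        if IsClosest (M.procConf ω) l then nexp (M.userSum sU ω +
          M.jamSum sJ R R' (M.proc (.centre l.1) l.2 ω) ω) else 0 ∂P := by
    intro R'
    rw [← M.lintegral_closest hS]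
    refine lintegral_congr fun ω => ?_
    rw [ENNReal.tsum_prod', tsum_fintype]
    rfl
  have huniq := ae_restrict_of_ae (s := S) M.ae_existsUnique_isClosest
  have hterm : ∀ ω l₀, (∀ l, IsClosest (M.procConf ω) l ↔ l = l₀) → ∀ F : Fin K × ℕ → ℝ≥0∞,
      (∑' l, if IsClosest (M.procConf ω) l then F l else 0) = F l₀ := by
    intro ω l₀ hl F
    simp_rw [hl]
    exact tsum_ite_eq l₀ _
  have hact : ∀ ω l₀, (∀ l, IsClosest (M.procConf ω) l ↔ l = l₀) → ∀ j,
      IsActive R (M.procConf ω) j ↔ R ≤ ‖M.proc .jammer j ω‖ ∧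
        R ≤ Dist.dist (M.proc .jammer j ω) (M.proc (.centre l₀.1) l₀.2 ω) := by
    intro ω l₀ hl j
    have h1 : ∀ t i, IsClosest (M.procConf ω) (t, i) ↔ (t, i) = l₀ := fun t i => hl (t, i)
    simp only [IsActive, h1]
    rw [Metric.mem_ball, not_lt, dist_zero_right]
    refine and_congr Iff.rfl ⟨fun h => ?_, fun h t i hti => ?_⟩
    · have := h l₀.1 l₀.2 rfl
      rwa [Metric.mem_ball, not_lt] at this
    · subst hti
      rwa [Metric.mem_ball, not_lt]
  -- Activity, `R ≤ dist`, lies between the strict conditions with radii `R` and `R - 1 / (m + 1)`.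
  -- The first gives the upper bound; the second gives a lower bound for each `m`, and `m` tends to
  -- infinity.
  refine le_antisymm ?_ ?_
  · rw [key R]
    refine lintegral_mono_ae ?_
    filter_upwards [huniq] with ω ⟨l₀, hl⟩
    rw [hterm ω l₀ hl]
    refine nexp_antitone (add_le_add le_rfl (ENNReal.tsum_le_tsum fun j => ?_))
    rw [hact ω l₀ hl]
    by_cases h : R ≤ ‖M.proc .jammer j ω‖ ∧
        R < Dist.dist (M.proc .jammer j ω) (M.proc (.centre l₀.1) l₀.2 ω)
    · rw [if_pos h, if_pos ⟨h.1, h.2.le⟩]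
    · rw [if_neg h]
      exact zero_le
  · have hlim : Tendsto (fun m : ℕ => ∫⁻ ω in S, nexp (q.userExponent sU (M.tier ω) (M.dist ω)) *
        q.jamLaplace sJ R (R - 1 / (m + 1)) (M.tier ω) (M.dist ω) ∂P) atTop
        (𝓝 (∫⁻ ω in S, nexp (q.userExponent sU (M.tier ω) (M.dist ω)) *
        q.jamLaplace sJ R R (M.tier ω) (M.dist ω) ∂P)) := by
      refine lintegral_tendsto_of_tendsto_of_monotone (fun m => ?_) ?_ ?_
      · exact (M.measurable_comp_serving (F := fun k r => nexp (q.userExponent sU k r) *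
          q.jamLaplace sJ R (R - 1 / (m + 1)) k r) fun k => (measurable_nexp.comp
            (q.measurable_userExponent sU k)).mul (q.measurable_jamLaplace _ _ _ k)).aemeasurable
      · refine .of_forall fun ω m n hmn => mul_le_mul_right (q.jamLaplace_mono _ _ _ _ ?_) _
        have : (m : ℝ) ≤ n := by exact_mod_cast hmn
        gcongr
      · exact .of_forall fun ω => ENNReal.Tendsto.const_mul (q.tendsto_jamLaplace _ hR _ _ _)
          (Or.inr (nexp_ne_top _))
    refine le_of_tendsto' hlim fun m => ?_
    rw [key]
    refine lintegral_mono_ae ?_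
    filter_upwards [huniq] with ω ⟨l₀, hl⟩
    rw [hterm ω l₀ hl]
    refine nexp_antitone (add_le_add le_rfl (ENNReal.tsum_le_tsum fun j => ?_))
    rw [hact ω l₀ hl]
    by_cases h : R ≤ ‖M.proc .jammer j ω‖ ∧
        R ≤ Dist.dist (M.proc .jammer j ω) (M.proc (.centre l₀.1) l₀.2 ω)
    · have : 0 < 1 / ((m : ℝ) + 1) := by positivity
      rw [if_pos h, if_pos ⟨h.1, by linarith [h.2]⟩]
    · rw [if_neg h]
      exact zero_le

/-- The Laplace functional of the users and of the active jammers, with a weight that depends on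
the base stations. -/
lemma lintegral_mul_nexp_userSum_activeSum {V : Ω → ℝ≥0∞} (hV : Measurable[sigmaBS M.bs] V)
    (sU sJ : ℝ≥0) {R : ℝ} (hR : 0 < R) :
    ∫⁻ ω, V ω * nexp (M.userSum sU ω + M.activeSum sJ R ω) ∂P =
      ∫⁻ ω, V ω * (nexp (q.userExponent sU (M.tier ω) (M.dist ω)) *
        q.jamLaplace sJ R R (M.tier ω) (M.dist ω)) ∂P :=
  lintegral_mul_eq_of_forall_setLIntegral_eq M.sigmaBS_le
    (measurable_nexp.comp ((M.measurable_userSum sU).add (M.measurable_activeSum sJ R)))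
    (M.measurable_comp_serving (F := fun k r => nexp (q.userExponent sU k r) *
      q.jamLaplace sJ R R k r) fun k => (measurable_nexp.comp
        (q.measurable_userExponent sU k)).mul (q.measurable_jamLaplace _ _ _ k))
    (fun _ hS => M.setLIntegral_nexp_userSum_activeSum hS sU sJ hR) hV

end Model
end HetNet

/-! ### The joint Laplace transform of the interferences -/

namespace HetNet

section Node

variable {K : ℕ}

/-- The transmitters as a sum type. -/
def nodeEquiv (K : ℕ) : Node K ≃ (Fin K × ℕ) ⊕ ((Fin K × ℕ) ⊕ ℕ) where
  toFun
    | .bs t i => .inl (t, i)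
    | .user t i => .inr (.inl (t, i))
    | .jammer i => .inr (.inr i)
  invFun
    | .inl l => .bs l.1 l.2
    | .inr (.inl l) => .user l.1 l.2
    | .inr (.inr i) => .jammer i
  left_inv p := by cases p <;> rfl
  right_inv p := by rcases p with _ | _ | _ <;> rfl

instance : Countable (Node K) := (nodeEquiv K).injective.countable

lemma tsum_node (F : Node K → ℝ≥0∞) :
    ∑' j, F j = ∑' l : Fin K × ℕ, F (.bs l.1 l.2) +
      (∑ t, ∑' i, F (.user t i) + ∑' i, F (.jammer i)) := by
  rw [← (nodeEquiv K).symm.tsum_eq, ENNReal.summable.tsum_sum ENNReal.summable,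
    ENNReal.summable.tsum_sum ENNReal.summable]
  congr 2
  rw [ENNReal.tsum_prod', tsum_fintype]
  rfl

end Node

/-- The configurations of the locations. -/
abbrev LocConf (K : ℕ) : Type := (Fin K → ℕ → Plane) × (Proc K → ℕ → Plane)

namespace Params

variable {K : ℕ} (q : Params K)

open Classical in
/-- The coefficients of the power gains in the interference, with weights `sB`, `sU`, `sJ` for the
base stations other than `l₀`, for the users and for the active jammers. -/
def nodeCoef (sB sU sJ : ℝ≥0∞) (R : ℝ) (l₀ : Fin K × ℕ) (x : LocConf K) : Node K → ℝ≥0∞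
  | .bs t i => if (t, i) = l₀ then 0 else sB * gain q.α (q.power t) (x.1 t i)
  | .user t i => sU * gain q.α q.powerU (x.2 (.user t) i)
  | .jammer i => if IsActive R x.2 i then sJ * gain q.α q.powerJ (x.2 .jammer i) else 0

lemma measurable_nodeCoef {sB sU sJ : LocConf K → ℝ≥0∞} (hB : Measurable sB) (hU : Measurable sU)
    (hJ : Measurable sJ) (R : ℝ) (l₀ : Fin K × ℕ) (j : Node K) :
    Measurable fun x => q.nodeCoef (sB x) (sU x) (sJ x) R l₀ x j := by
  cases j with
  | bs t i =>
    simp only [nodeCoef]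
    split_ifs
    · exact measurable_const
    · exact hB.mul ((measurable_gain _ _).comp (by fun_prop))
  | user t i => exact hU.mul ((measurable_gain _ _).comp (by fun_prop))
  | jammer i =>
    exact Measurable.ite (measurable_snd (measurableSet_isActive R i))
      (hJ.mul ((measurable_gain _ _).comp (by fun_prop))) measurable_const

lemma nodeCoef_ne_top {sB sU sJ : ℝ≥0∞} (hB : sB ≠ ∞) (hU : sU ≠ ∞) (hJ : sJ ≠ ∞) (R : ℝ)
    (l₀ : Fin K × ℕ) (x : LocConf K) (j : Node K) : q.nodeCoef sB sU sJ R l₀ x j ≠ ∞ := by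
  cases j <;> simp only [nodeCoef] <;> (try split_ifs) <;>
    first
    | exact ENNReal.zero_ne_top
    | exact ENNReal.mul_ne_top hB (gain_ne_top _ _ _)
    | exact ENNReal.mul_ne_top hU (gain_ne_top _ _ _)
    | exact ENNReal.mul_ne_top hJ (gain_ne_top _ _ _)

/-- The product of the conditional Laplace transforms of the interferences, given serving tier `k`
and serving distance `r`. -/
def condLaplace (sB sU sJ : ℝ≥0) (R : ℝ) (k : Fin K) (r : ℝ) : ℝ≥0∞ :=
  nexp (q.bsTail sB k r) * (nexp (q.userExponent sU k r) * q.jamLaplace sJ R R k r)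

lemma measurable_condLaplace (sB sU sJ : ℝ≥0) (R : ℝ) (k : Fin K) :
    Measurable (q.condLaplace sB sU sJ R k) :=
  (measurable_nexp.comp (q.measurable_bsTail sB k)).mul ((measurable_nexp.comp
    (q.measurable_userExponent sU k)).mul (q.measurable_jamLaplace sJ R R k))

open Classical in
/-- A weight times the conditional Laplace transform of the interference from the base stations in
the configuration `b`, as a function of the configuration. -/
def bsWeight (s : ℝ≥0) (W : Fin K → ℝ → ℝ≥0∞) (b : Fin K → ℕ → Plane) : ℝ≥0∞ :=
  ∑' l : Fin K × ℕ, if q.Strongest b l then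
    W l.1 ‖b l.1 l.2‖ * nexp (∑' l' : Fin K × ℕ, if l' = l then 0 else
      q.bsLog s (l'.1, b l'.1 l'.2)) else 0

lemma measurable_bsWeight (s : ℝ≥0) {W : Fin K → ℝ → ℝ≥0∞} (hW : ∀ k, Measurable (W k)) :
    Measurable (q.bsWeight s W) := by
  refine Measurable.tsum fun l => Measurable.ite (Model.measurableSet_strongest l) ?_
    measurable_const
  refine ((hW _).comp (by fun_prop)).mul (measurable_nexp.comp (Measurable.tsum fun l' => ?_))
  split_ifs
  · exact measurable_const
  · exact (q.measurable_bsLog s).comp (measurable_const.prodMk (by fun_prop))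

end Params

namespace Model

variable {K : ℕ} {q : Params K} {Ω : Type*} [MeasurableSpace Ω] {P : Measure Ω}
  (M : Model q Ω P)

/-- The locations as a configuration. -/
def locConf (ω : Ω) : LocConf K := (M.bsConf ω, M.procConf ω)

lemma measurable_locConf : Measurable M.locConf := M.measurable_bsConf.prodMk M.measurable_procConf

/-- All interference is one linear form in the gains, with coefficients depending only on locations,
so the fading is averaged in a single step. Its parameters `sB`, `sU`, `sJ` can be switched off
separately. -/
lemma tsum_nodeCoef_fading (sB sU sJ : ℝ≥0∞) (τ : ℝ) (ω : Ω) :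
    ∑' j, q.nodeCoef sB sU sJ (q.guardRadius τ) (M.serving ω) (M.locConf ω) j *
        ENNReal.ofReal (M.fading j ω) =
      sB * M.interferenceB ω + (sU * M.interferenceU ω + sJ * M.interferenceJ τ ω) := by
  rw [tsum_node]
  congr 1
  · have e : M.interferenceB ω = ∑' l : Fin K × ℕ, if l = M.serving ω then 0 else
        received q.α (q.power l.1) (M.fading (.bs l.1 l.2) ω) (M.bs l.1 l.2 ω) := by
      rw [ENNReal.tsum_prod', tsum_fintype]
      rfl
    rw [e, ← ENNReal.tsum_mul_left]
    refine tsum_congr fun l => ?_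
    rw [Params.nodeCoef, received_eq (q.power_pos _).le]
    split_ifs
    · simp
    · exact mul_assoc _ _ _
  congr 1
  · rw [interferenceU, Finset.mul_sum]
    refine Finset.sum_congr rfl fun t _ => ?_
    rw [← ENNReal.tsum_mul_left]
    refine tsum_congr fun i => ?_
    rw [Params.nodeCoef, received_eq q.powerU_nonneg]
    exact mul_assoc _ _ _
  · rw [interferenceJ, ← ENNReal.tsum_mul_left]
    refine tsum_congr fun i => ?_
    rw [Params.nodeCoef, received_eq q.powerJ_pos.le]
    by_cases h : M.Active τ i ω
    · rw [if_pos h, if_pos (show IsActive (q.guardRadius τ) (M.locConf ω).2 i from h)]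
      exact mul_assoc _ _ _
    · rw [if_neg h, if_neg (show ¬IsActive (q.guardRadius τ) (M.locConf ω).2 i from h), zero_mul,
        mul_zero]

open Classical in
lemma tsum_logAdd_nodeCoef (sB sU sJ : ℝ≥0) (R : ℝ) (l₀ : Fin K × ℕ) (ω : Ω) :
    ∑' j, logAdd (q.nodeCoef sB sU sJ R l₀ (M.locConf ω) j) =
      (∑' l', if l' = l₀ then 0 else q.bsLog sB (M.bsPoint l' ω)) +
        (M.userSum sU ω + M.activeSum sJ R ω) := by
  rw [tsum_node]
  congr 1
  · refine tsum_congr fun l => ?_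
    rw [Params.nodeCoef]
    split_ifs
    · exact logAdd_zero
    · rfl
  congr 1
  refine tsum_congr fun i => ?_
  rw [Params.nodeCoef]
  have : IsActive R (M.locConf ω).2 i ↔ IsActive R (M.procConf ω) i := Iff.rfl
  simp only [this]
  split_ifs
  · rfl
  · exact logAdd_zero

variable [IsProbabilityMeasure P]

open Classical in
-- The serving index is random and only almost surely determined by the locations. Splitting over
-- its values, with the indicator of being strongest in place of the event itself, leaves a fixed
-- index and weights that are functions of the locations.
lemma lintegral_eq_tsum_serving {F : Fin K × ℕ → Ω → ℝ≥0∞} (hF : ∀ l, Measurable (F l)) :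
    ∫⁻ ω, F (M.serving ω) ω ∂P =
      ∑' l, ∫⁻ ω, (if q.Strongest (M.locConf ω).1 l then 1 else 0) * F l ω ∂P := by
  rw [← lintegral_tsum]
  · refine lintegral_congr_ae ?_
    filter_upwards [M.ae_strongest_iff] with ω hω
    have : ∀ l, q.Strongest (M.locConf ω).1 l ↔ l = M.serving ω := hω
    simp only [this, ite_mul, one_mul, zero_mul]
    rw [tsum_ite_eq]
  · intro l
    exact ((Measurable.ite (M.measurable_bsConf (measurableSet_strongest l)) measurable_const
      measurable_const).mul (hF l)).aemeasurable

/-- The expression at the serving station is replaced by an honest function of the base station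
configuration, which is measurable for `sigmaBS` and may serve as a weight when conditioning on the
base stations. -/
lemma ae_bsWeight (s : ℝ≥0) (W : Fin K → ℝ → ℝ≥0∞) :
    ∀ᵐ ω ∂P, q.bsWeight s W (M.bsConf ω) = W (M.tier ω) (M.dist ω) *
      nexp (∑' l', if l' = M.serving ω then 0 else q.bsLog s (M.bsPoint l' ω)) := by
  filter_upwards [M.ae_strongest_iff] with ω hω
  simp only [Params.bsWeight, hω]
  rw [tsum_ite_eq]
  rfl

lemma lintegral_bsWeight (s : ℝ≥0) {W : Fin K → ℝ → ℝ≥0∞} (hW : ∀ k, Measurable (W k)) :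
    ∫⁻ ω, q.bsWeight s W (M.bsConf ω) ∂P = ∑ k, ENNReal.ofReal (q.assocProb k) *
      ∫⁻ r in Ioi (0 : ℝ), W k r * nexp (q.bsTail s k r) * ENNReal.ofReal (q.distDensity k r) := by
  have hK := M.nonempty_tier
  refine Eq.trans ?_ ((M.lintegral_strongest s hW).trans (Finset.sum_congr rfl fun k _ =>
    q.lintegral_plane_bsExponent s k (hW k)))
  refine lintegral_congr fun ω => tsum_congr fun l => ?_
  split_ifs <;> rfl

/-- The joint law of the serving tier and the serving distance. -/
lemma lintegral_comp_serving {W : Fin K → ℝ → ℝ≥0∞} (hW : ∀ k, Measurable (W k)) :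
    ∫⁻ ω, W (M.tier ω) (M.dist ω) ∂P = ∑ k, ENNReal.ofReal (q.assocProb k) *
      ∫⁻ r in Ioi (0 : ℝ), W k r * ENNReal.ofReal (q.distDensity k r) := by
  have h := M.lintegral_bsWeight 0 hW
  have h0 : ∀ z, q.bsLog 0 z = 0 := fun z => by simp [Params.bsLog, logAdd_zero]
  simp only [Params.bsTail_zero, nexp_zero, mul_one] at h
  rw [← h]
  refine lintegral_congr_ae ?_
  filter_upwards [M.ae_bsWeight 0 W] with ω hω
  rw [hω]
  simp [h0]

/-- Three successive averages: over the gains given all locations, over users, jammers and hole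
centres given the base stations, and over the base stations. -/
lemma lintegral_nexp_interference (sB sU sJ : ℝ≥0) {τ : ℝ} (hτ : 0 < τ)
    {W : Fin K → ℝ → ℝ≥0∞} (hW : ∀ k, Measurable (W k)) :
    ∫⁻ ω, W (M.tier ω) (M.dist ω) * nexp (sB * M.interferenceB ω +
        (sU * M.interferenceU ω + sJ * M.interferenceJ τ ω)) ∂P =
      ∫⁻ ω, W (M.tier ω) (M.dist ω) *
        q.condLaplace sB sU sJ (q.guardRadius τ) (M.tier ω) (M.dist ω) ∂P := by
  classical
  set R := q.guardRadius τ with hR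
  have hRpos : 0 < R := q.guardRadius_pos hτ
  have hcm : ∀ l₀ j, Measurable fun x => q.nodeCoef sB sU sJ R l₀ x j := fun l₀ j =>
    q.measurable_nodeCoef measurable_const measurable_const measurable_const R l₀ j
  have hWl : ∀ l : Fin K × ℕ, Measurable fun x : LocConf K => W l.1 ‖x.1 l.1 l.2‖ := fun l =>
    (hW _).comp (by fun_prop)
  have hSl : ∀ l : Fin K × ℕ, Measurable fun x : LocConf K =>
      if q.Strongest x.1 l then (1 : ℝ≥0∞) else 0 := fun l =>
    Measurable.ite (measurable_fst (measurableSet_strongest l)) measurable_const measurable_const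
  have step1 : ∫⁻ ω, W (M.tier ω) (M.dist ω) * nexp (sB * M.interferenceB ω +
        (sU * M.interferenceU ω + sJ * M.interferenceJ τ ω)) ∂P =
      ∫⁻ ω, q.bsWeight sB W (M.bsConf ω) * nexp (M.userSum sU ω + M.activeSum sJ R ω) ∂P := by
    have e1 := M.lintegral_eq_tsum_serving (F := fun l ω => W l.1 ‖(M.locConf ω).1 l.1 l.2‖ *
      nexp (∑' j, q.nodeCoef sB sU sJ R l (M.locConf ω) j * ENNReal.ofReal (M.fading j ω)))
      fun l => ((hWl l).comp M.measurable_locConf).mul (measurable_nexp.comp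
        (Measurable.tsum fun j => ((hcm l j).comp M.measurable_locConf).mul
          (M.measurable_fading j).ennreal_ofReal))
    have e2 := M.lintegral_eq_tsum_serving (F := fun l ω => W l.1 ‖(M.locConf ω).1 l.1 l.2‖ *
      nexp (∑' j, logAdd (q.nodeCoef sB sU sJ R l (M.locConf ω) j)))
      fun l => ((hWl l).comp M.measurable_locConf).mul (measurable_nexp.comp
        (Measurable.tsum fun j => measurable_logAdd.comp ((hcm l j).comp M.measurable_locConf)))
    have e3 : ∀ l, ∫⁻ ω, (if q.Strongest (M.locConf ω).1 l then 1 else 0) *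
        (W l.1 ‖(M.locConf ω).1 l.1 l.2‖ * nexp (∑' j, q.nodeCoef sB sU sJ R l (M.locConf ω) j *
          ENNReal.ofReal (M.fading j ω))) ∂P =
        ∫⁻ ω, (if q.Strongest (M.locConf ω).1 l then 1 else 0) *
        (W l.1 ‖(M.locConf ω).1 l.1 l.2‖ *
          nexp (∑' j, logAdd (q.nodeCoef sB sU sJ R l (M.locConf ω) j))) ∂P := by
      intro l
      have h := lintegral_nexp_fading_loc M.measurable_fading M.fading_law M.fading_indep
        M.measurable_locConf M.fading_indep_locations
        (W := fun x => (if q.Strongest x.1 l then 1 else 0) * W l.1 ‖x.1 l.1 l.2‖)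
        ((hSl l).mul (hWl l)) (hcm l) (fun j x => q.nodeCoef_ne_top ENNReal.coe_ne_top
          ENNReal.coe_ne_top ENNReal.coe_ne_top R l x j)
      simp only [mul_assoc] at h
      exact h
    simp only [e3] at e1
    rw [← e2] at e1
    calc _ = _ := by
          refine lintegral_congr fun ω => ?_
          rw [← M.tsum_nodeCoef_fading]
          rfl
      _ = _ := e1
      _ = _ := by
          refine lintegral_congr_ae ?_
          filter_upwards [M.ae_bsWeight sB W] with ω hω
          rw [M.tsum_logAdd_nodeCoef, nexp_add, hω, mul_assoc]
          congr 3
  have hV : Measurable[sigmaBS M.bs] fun ω => q.bsWeight sB W (M.bsConf ω) :=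
    (q.measurable_bsWeight sB hW).comp (comap_measurable M.bsConf)
  rw [step1, M.lintegral_mul_nexp_userSum_activeSum hV sU sJ hRpos]
  have hX : ∀ k, Measurable fun r => nexp (q.userExponent sU k r) * q.jamLaplace sJ R R k r :=
    fun k => (measurable_nexp.comp (q.measurable_userExponent sU k)).mul
      (q.measurable_jamLaplace sJ R R k)
  rw [M.lintegral_comp_serving (W := fun k r => W k r * q.condLaplace sB sU sJ R k r)
    fun k => (hW k).mul (q.measurable_condLaplace sB sU sJ R k)]
  -- The transforms of users and jammers depend only on the serving tier and distance, so they join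
  -- `W` and the base station formula applies to the product.
  calc _ = ∫⁻ ω, q.bsWeight sB (fun k r => W k r * (nexp (q.userExponent sU k r) *
          q.jamLaplace sJ R R k r)) (M.bsConf ω) ∂P := by
        refine lintegral_congr_ae ?_
        filter_upwards [M.ae_bsWeight sB W, M.ae_bsWeight sB (fun k r => W k r *
          (nexp (q.userExponent sU k r) * q.jamLaplace sJ R R k r))] with ω h1 h2
        rw [h1, h2]
        ring
    _ = _ := by
        rw [M.lintegral_bsWeight sB (W := fun k r => W k r * (nexp (q.userExponent sU k r) *
          q.jamLaplace sJ R R k r)) fun k => (hW k).mul (hX k)]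
        refine Finset.sum_congr rfl fun k _ => congrArg _ (lintegral_congr fun r => ?_)
        rw [Params.condLaplace]
        ring

end Model
end HetNet

/-! ### Laplace arguments depending on tier and distance -/

namespace HetNet

lemma monotone_one_sub_inv (g : ℝ≥0∞) : Monotone fun s : ℝ≥0 => 1 - (1 + s * g)⁻¹ := by
  intro a b h
  have : (a : ℝ≥0∞) ≤ b := by exact_mod_cast h
  dsimp only
  gcongr

lemma continuous_one_sub_inv {g : ℝ≥0∞} (hg : g ≠ ∞) :
    Continuous fun s : ℝ≥0 => 1 - (1 + s * g)⁻¹ := by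
  have h1 : Continuous fun s : ℝ≥0 => (s : ℝ≥0∞) * g :=
    (ENNReal.continuous_mul_const hg).comp ENNReal.continuous_coe
  have h2 : Continuous fun s : ℝ≥0 => 1 + (s : ℝ≥0∞) * g := continuous_const.add h1
  exact (ENNReal.continuous_sub_left ENNReal.one_ne_top).comp (continuous_inv.comp h2)

section Limits

variable {X : Type*} [MeasurableSpace X] {μ : Measure X}

/-- Continuity of the exponents along increasing sequences. -/
lemma tendsto_lintegral_mul_one_sub_inv {w g : X → ℝ≥0∞} (hw : Measurable w) (hg : Measurable g)
    (hwt : ∀ x, w x ≠ ∞) (hgt : ∀ x, g x ≠ ∞) {s : ℕ → ℝ≥0} {s₀ : ℝ≥0} (hs : Monotone s)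
    (hlim : Tendsto s atTop (𝓝 s₀)) :
    Tendsto (fun n => ∫⁻ x, w x * (1 - (1 + s n * g x)⁻¹) ∂μ) atTop
      (𝓝 (∫⁻ x, w x * (1 - (1 + s₀ * g x)⁻¹) ∂μ)) := by
  refine lintegral_tendsto_of_tendsto_of_monotone (fun n => ?_) ?_ ?_
  · exact (hw.mul (measurable_const.sub (measurable_const.add
      (hg.const_mul _)).inv)).aemeasurable
  · exact .of_forall fun x m n hmn => mul_le_mul_right (monotone_one_sub_inv _ (hs hmn)) _
  · exact .of_forall fun x => ENNReal.Tendsto.const_mul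
      (((continuous_one_sub_inv (hgt x)).tendsto _).comp hlim) (Or.inr (hwt x))

end Limits

/-- For a countably valued parameter, measurability in `r` at each fixed parameter is enough; joint
measurability in the parameter and `r` is never required. -/
lemma measurable_of_countable_range {A : Type*} [MeasurableSpace A] {f : ℝ → ℕ}
    (hf : Measurable f) {G : ℕ → ℝ → A} (hG : ∀ m, Measurable (G m)) :
    Measurable fun r => G (f r) r :=
  (measurable_from_prod_countable_right (f := fun p : ℕ × ℝ => G p.1 p.2) hG).comp
    (hf.prodMk measurable_id)

/-- Dyadic approximation from below. -/
def dyadicFloor (n : ℕ) (z : ℝ≥0) : ℝ≥0 := (⌊(z : ℝ) * 2 ^ n⌋₊ : ℝ≥0) / 2 ^ n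

lemma dyadicFloor_le (n : ℕ) (z : ℝ≥0) : dyadicFloor n z ≤ z := by
  rw [dyadicFloor, div_le_iff₀ (by positivity), ← NNReal.coe_le_coe]
  push_cast
  exact Nat.floor_le (by positivity)

lemma monotone_dyadicFloor (z : ℝ≥0) : Monotone fun n => dyadicFloor n z := by
  refine monotone_nat_of_le_succ fun n => ?_
  rw [dyadicFloor, dyadicFloor, div_le_div_iff₀ (by positivity) (by positivity), pow_succ,
    mul_comm _ (2 : ℝ≥0), ← mul_assoc]
  refine mul_le_mul_left ?_ _
  have : ⌊(z : ℝ) * 2 ^ n⌋₊ * 2 ≤ ⌊(z : ℝ) * 2 ^ (n + 1)⌋₊ := by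
    refine Nat.le_floor ?_
    push_cast
    rw [pow_succ, ← mul_assoc]
    exact mul_le_mul_of_nonneg_right (Nat.floor_le (by positivity)) (by norm_num)
  rw [pow_succ] at this
  exact_mod_cast this

lemma tendsto_dyadicFloor (z : ℝ≥0) : Tendsto (fun n => dyadicFloor n z) atTop (𝓝 z) := by
  rw [← NNReal.tendsto_coe]
  have h := (tendsto_nat_floor_mul_div_atTop z.2).comp
    (tendsto_pow_atTop_atTop_of_one_lt (one_lt_two (α := ℝ)))
  refine h.congr fun n => ?_
  simp [dyadicFloor]

namespace Params

variable {K : ℕ} (q : Params K)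

lemma jamExponent_eq_mul (s : ℝ≥0) (R R' : ℝ) (c : Plane) : q.jamExponent s R R' c =
    ∫⁻ x : Plane, {x : Plane | R ≤ ‖x‖ ∧ R' < dist x c}.indicator
      (fun _ => ENNReal.ofReal q.densJ) x * (1 - (1 + s * gain q.α q.powerJ x)⁻¹) := by
  refine lintegral_congr fun x => ?_
  by_cases h : R ≤ ‖x‖ ∧ R' < dist x c
  · rw [if_pos h, indicator_of_mem (by exact h)]
  · rw [if_neg h, indicator_of_notMem (by exact h), mul_zero, zero_mul]

section Continuity

variable {s : ℕ → ℝ≥0} {s₀ : ℝ≥0} (hs : Monotone s) (hlim : Tendsto s atTop (𝓝 s₀))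
include hs hlim

lemma tendsto_bsTail (k : Fin K) (r : ℝ) :
    Tendsto (fun n => q.bsTail (s n) k r) atTop (𝓝 (q.bsTail s₀ k r)) := by
  refine tendsto_finsetSum _ fun t _ => ENNReal.Tendsto.const_mul ?_ (Or.inr ENNReal.ofReal_ne_top)
  have h := tendsto_lintegral_mul_one_sub_inv (μ := volume.restrict (Metric.ball 0 (q.Del k r t))ᶜ)
    (measurable_const (a := (1 : ℝ≥0∞))) (measurable_gain q.α (q.power t))
    (fun _ => ENNReal.one_ne_top) (gain_ne_top _ _) hs hlim
  simpa only [one_mul] using h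

lemma tendsto_userExponent (k : Fin K) (r : ℝ) :
    Tendsto (fun n => q.userExponent (s n) k r) atTop (𝓝 (q.userExponent s₀ k r)) := by
  refine tendsto_finsetSum _ fun t _ => tendsto_lintegral_mul_one_sub_inv ?_ (measurable_gain _ _)
    (fun _ => ENNReal.ofReal_ne_top) (gain_ne_top _ _) hs hlim
  exact ((q.measurable_userDensity k t).comp (f := fun x : Plane => (r, ‖x‖))
    (by fun_prop)).ennreal_ofReal

lemma tendsto_jamExponent_weight (R R' : ℝ) (c : Plane) :
    Tendsto (fun n => q.jamExponent (s n) R R' c) atTop (𝓝 (q.jamExponent s₀ R R' c)) := by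
  simp only [q.jamExponent_eq_mul]
  refine tendsto_lintegral_mul_one_sub_inv (measurable_const.indicator ?_) (measurable_gain _ _)
    (fun x => ?_) (gain_ne_top _ _) hs hlim
  · have h1 : MeasurableSet {x : Plane | R ≤ ‖x‖} := measurableSet_le (by fun_prop) (by fun_prop)
    have h2 : MeasurableSet {x : Plane | R' < dist x c} :=
      measurableSet_lt (by fun_prop) (by fun_prop)
    exact h1.inter h2
  · rw [indicator_apply]
    split_ifs
    · exact ENNReal.ofReal_ne_top
    · exact ENNReal.zero_ne_top

/-- The law of the closest centre dominates and has mass one; this is where `r > 0` is needed. -/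
lemma tendsto_jamLaplace_weight (R R' : ℝ) (k : Fin K) {r : ℝ} (hr : 0 < r) :
    Tendsto (fun n => q.jamLaplace (s n) R R' k r) atTop (𝓝 (q.jamLaplace s₀ R R' k r)) := by
  have hm : Measurable fun c : Plane => (r, ‖c‖) := by fun_prop
  refine tendsto_lintegral_of_dominated_convergence
    (fun c => ENNReal.ofReal (q.userDensityTotal k r ‖c‖) * nexp (q.holeVoid k r ‖c‖))
    (fun n => ?_) (fun n => .of_forall fun c => mul_le_mul_right (nexp_antitone le_self_add) _) ?_
    (.of_forall fun c => ENNReal.Tendsto.const_mul ?_ (Or.inr ENNReal.ofReal_ne_top))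
  · exact ((q.measurable_userDensityTotal k).comp hm).ennreal_ofReal.mul (measurable_nexp.comp
      (((q.measurable_holeVoid k).comp hm).add (q.measurable_jamExponent _ R _)))
  · rw [q.lintegral_userDensityTotal_holeVoid k hr]
    exact ENNReal.one_ne_top
  · exact (continuous_nexp.tendsto _).comp (tendsto_const_nhds.add
      (q.tendsto_jamExponent_weight hs hlim R R' c))

end Continuity

lemma jamLaplace_le_one (s : ℝ≥0) (R R' : ℝ) (k : Fin K) {r : ℝ} (hr : 0 < r) :
    q.jamLaplace s R R' k r ≤ 1 := by
  rw [← q.lintegral_userDensityTotal_holeVoid k hr]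
  exact lintegral_mono fun c => mul_le_mul_right (nexp_antitone le_self_add) _

lemma condLaplace_le_one (sB sU sJ : ℝ≥0) (R : ℝ) (k : Fin K) {r : ℝ} (hr : 0 < r) :
    q.condLaplace sB sU sJ R k r ≤ 1 :=
  mul_le_one' (nexp_le_one _) (mul_le_one' (nexp_le_one _) (q.jamLaplace_le_one sJ R R k hr))

lemma measurable_condLaplace_dyadicFloor (n : ℕ) {z : ℝ → ℝ≥0} (hz : Measurable z) (R : ℝ)
    (k : Fin K) : Measurable fun r => q.condLaplace (dyadicFloor n (z r)) (dyadicFloor n (z r))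
      (dyadicFloor n (z r)) R k r := by
  have hf : Measurable fun r => ⌊(z r : ℝ) * 2 ^ n⌋₊ :=
    Nat.measurable_floor.comp (hz.coe_nnreal_real.mul_const (2 ^ n))
  exact measurable_of_countable_range hf
    (G := fun m r => q.condLaplace (m / 2 ^ n) (m / 2 ^ n) (m / 2 ^ n) R k r)
    fun m => q.measurable_condLaplace _ _ _ R k

lemma tendsto_condLaplace {s : ℕ → ℝ≥0} {s₀ : ℝ≥0} (hs : Monotone s)
    (hlim : Tendsto s atTop (𝓝 s₀)) (R : ℝ) (k : Fin K) {r : ℝ} (hr : 0 < r) :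
    Tendsto (fun n => q.condLaplace (s n) (s n) (s n) R k r) atTop
      (𝓝 (q.condLaplace s₀ s₀ s₀ R k r)) := by
  have hB := (continuous_nexp.tendsto _).comp (q.tendsto_bsTail hs hlim k r)
  have hU := (continuous_nexp.tendsto _).comp (q.tendsto_userExponent hs hlim k r)
  have hJ := q.tendsto_jamLaplace_weight hs hlim R R k hr
  have h1 : q.jamLaplace s₀ R R k r ≠ ∞ :=
    ne_top_of_le_ne_top ENNReal.one_ne_top (q.jamLaplace_le_one s₀ R R k hr)
  exact ENNReal.Tendsto.mul hB (Or.inr (ENNReal.mul_ne_top (nexp_ne_top _) h1))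
    (ENNReal.Tendsto.mul hU (Or.inr h1) hJ (Or.inr (nexp_ne_top _))) (Or.inr (nexp_ne_top _))

end Params

/-- Multiplication is discontinuous at `0 * ∞`. Approximation from below avoids this: if the limit
is zero, the sequence is identically zero. -/
lemma tendsto_coe_mul_of_le {s : ℕ → ℝ≥0} {s₀ : ℝ≥0} (hle : ∀ n, s n ≤ s₀)
    (hlim : Tendsto s atTop (𝓝 s₀)) (a : ℝ≥0∞) :
    Tendsto (fun n => (s n : ℝ≥0∞) * a) atTop (𝓝 (s₀ * a)) := by
  rcases eq_or_ne s₀ 0 with rfl | h0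
  · have : ∀ n, s n = 0 := fun n => le_antisymm (hle n) zero_le
    simp [this]
  · exact ENNReal.Tendsto.mul_const (ENNReal.tendsto_coe.2 hlim)
      (Or.inl (by exact_mod_cast h0))

namespace Model

variable {K : ℕ} {q : Params K} {Ω : Type*} [MeasurableSpace Ω] {P : Measure Ω}
  (M : Model q Ω P)

lemma measurable_gain_fading (p : ℝ) {Y : Ω → Plane} (hY : Measurable Y) (j : Node K) :
    Measurable fun ω => received q.α p (M.fading j ω) (Y ω) := by
  have := M.measurable_fading j
  unfold received
  fun_prop

lemma measurable_interferenceB : Measurable M.interferenceB :=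
  Finset.measurable_sum _ fun t _ => Measurable.tsum fun i => Measurable.ite
    (measurableSet_eq_fun measurable_const M.measurable_serving) measurable_const
    (M.measurable_gain_fading _ (M.measurable_bs t i) _)

lemma measurable_interferenceU : Measurable M.interferenceU :=
  Finset.measurable_sum _ fun _ _ => Measurable.tsum fun i =>
    M.measurable_gain_fading _ (M.measurable_proc _ i) _

lemma measurable_interferenceJ (τ : ℝ) : Measurable (M.interferenceJ τ) :=
  Measurable.tsum fun i => Measurable.ite
    (M.measurable_procConf (measurableSet_isActive (q.guardRadius τ) i))
    (M.measurable_gain_fading _ (M.measurable_proc _ i) _) measurable_const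

variable [IsProbabilityMeasure P]

/-- The conditional Laplace transform of the interference, at an argument that depends on the
serving tier and distance. -/
lemma lintegral_nexp_mul_interference {τ : ℝ} (hτ : 0 < τ) {z : Fin K → ℝ → ℝ≥0}
    (hz : ∀ k, Measurable (z k)) {W : Fin K → ℝ → ℝ≥0∞} (hW : ∀ k, Measurable (W k))
    (hW1 : ∀ k r, W k r ≤ 1) :
    ∫⁻ ω, W (M.tier ω) (M.dist ω) * nexp (z (M.tier ω) (M.dist ω) *
        (M.interferenceB ω + (M.interferenceU ω + M.interferenceJ τ ω))) ∂P =
      ∫⁻ ω, W (M.tier ω) (M.dist ω) * q.condLaplace (z (M.tier ω) (M.dist ω))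
        (z (M.tier ω) (M.dist ω)) (z (M.tier ω) (M.dist ω)) (q.guardRadius τ)
        (M.tier ω) (M.dist ω) ∂P := by
  classical
  set R := q.guardRadius τ
  set I : Ω → ℝ≥0∞ := fun ω => M.interferenceB ω + (M.interferenceU ω + M.interferenceJ τ ω) with hI
  have hIm : Measurable I := M.measurable_interferenceB.add
    (M.measurable_interferenceU.add (M.measurable_interferenceJ τ))
  have hWm := M.measurable_comp_serving hW
  set fl : ℕ → Fin K → ℝ → ℕ := fun n k r => ⌊(z k r : ℝ) * 2 ^ n⌋₊ with hfl
  have hflm : ∀ n k, Measurable (fl n k) := fun n k =>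
    Nat.measurable_floor.comp ((hz k).coe_nnreal_real.mul_const _)
  have hWj : ∀ n j k, Measurable fun r => (if fl n k r = j then W k r else 0) := fun n j k =>
    Measurable.ite (hflm n k (measurableSet_singleton j)) (hW k) measurable_const
  -- The argument rounded down to a multiple of `2⁻ⁿ` is constant on each piece of a countable
  -- partition by tier and distance. There the formula for a fixed argument applies, with the
  -- indicator of the piece included in the weight.
  have hsplit : ∀ (n : ℕ) (F : ℝ≥0 → Ω → ℝ≥0∞), (∀ s, Measurable (F s)) →
      ∫⁻ ω, W (M.tier ω) (M.dist ω) * F (dyadicFloor n (z (M.tier ω) (M.dist ω))) ω ∂P =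
      ∑' j : ℕ, ∫⁻ ω, (if fl n (M.tier ω) (M.dist ω) = j then W (M.tier ω) (M.dist ω) else 0) *
        F (j / 2 ^ n) ω ∂P := by
    intro n F hF
    rw [← lintegral_tsum]
    · refine lintegral_congr fun ω => ?_
      simp only [ite_mul, zero_mul]
      rw [tsum_eq_single (fl n (M.tier ω) (M.dist ω)) fun j hj => if_neg hj.symm, if_pos rfl]
      rfl
    · exact fun j => ((M.measurable_comp_serving (hWj n j)).mul (hF _)).aemeasurable
  have hn : ∀ n, ∫⁻ ω, W (M.tier ω) (M.dist ω) *
        nexp (dyadicFloor n (z (M.tier ω) (M.dist ω)) * I ω) ∂P =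
      ∫⁻ ω, W (M.tier ω) (M.dist ω) * q.condLaplace (dyadicFloor n (z (M.tier ω) (M.dist ω)))
        (dyadicFloor n (z (M.tier ω) (M.dist ω))) (dyadicFloor n (z (M.tier ω) (M.dist ω))) R
        (M.tier ω) (M.dist ω) ∂P := by
    intro n
    rw [hsplit n (fun s ω => nexp (s * I ω)) fun s => measurable_nexp.comp (hIm.const_mul _),
      hsplit n (fun s ω => q.condLaplace s s s R (M.tier ω) (M.dist ω)) fun s =>
        M.measurable_comp_serving (q.measurable_condLaplace s s s R)]
    refine tsum_congr fun j => ?_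
    rw [← M.lintegral_nexp_interference (j / 2 ^ n) (j / 2 ^ n) (j / 2 ^ n) hτ
      (W := fun k r => if fl n k r = j then W k r else 0) (hWj n j)]
    simp only [hI, mul_add]
  have hzn : ∀ n k, Measurable fun r => dyadicFloor n (z k r) := fun n k =>
    (measurable_from_top (f := fun m : ℕ => (m : ℝ≥0) / 2 ^ n)).comp (hflm n k)
  have hzω := fun n => M.measurable_comp_serving (hzn n)
  have hL : Tendsto (fun n => ∫⁻ ω, W (M.tier ω) (M.dist ω) *
        nexp (dyadicFloor n (z (M.tier ω) (M.dist ω)) * I ω) ∂P) atTop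
      (𝓝 (∫⁻ ω, W (M.tier ω) (M.dist ω) * nexp (z (M.tier ω) (M.dist ω) * I ω) ∂P)) := by
    refine tendsto_lintegral_of_dominated_convergence 1 (fun n => ?_)
      (fun n => .of_forall fun ω => mul_le_one' (hW1 _ _) (nexp_le_one _)) (by simp)
      (.of_forall fun ω => ENNReal.Tendsto.const_mul ((continuous_nexp.tendsto _).comp
        (tendsto_coe_mul_of_le (fun n => dyadicFloor_le n _) (tendsto_dyadicFloor _) _))
        (Or.inr (ne_top_of_le_ne_top ENNReal.one_ne_top (hW1 _ _))))
    exact hWm.mul (measurable_nexp.comp ((hzω n).coe_nnreal_ennreal.mul hIm))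
  simp only [hn] at hL
  refine tendsto_nhds_unique hL ?_
  have hm : ∀ n, Measurable (fun ω => W (M.tier ω) (M.dist ω) *
      q.condLaplace (dyadicFloor n (z (M.tier ω) (M.dist ω)))
        (dyadicFloor n (z (M.tier ω) (M.dist ω))) (dyadicFloor n (z (M.tier ω) (M.dist ω))) R
        (M.tier ω) (M.dist ω)) := fun n =>
    hWm.mul (M.measurable_comp_serving fun k => q.measurable_condLaplace_dyadicFloor n (hz k) R k)
  refine tendsto_lintegral_filter_of_dominated_convergence 1 (.of_forall hm)
    (.of_forall fun n => ?_) (by simp) ?_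
  · filter_upwards [M.ae_dist_pos] with ω hω
    exact mul_le_one' (hW1 _ _) (q.condLaplace_le_one _ _ _ R _ hω)
  · filter_upwards [M.ae_dist_pos] with ω hω
    exact ENNReal.Tendsto.const_mul (q.tendsto_condLaplace (monotone_dyadicFloor _)
      (tendsto_dyadicFloor _) R _ hω) (Or.inr (ne_top_of_le_ne_top ENNReal.one_ne_top (hW1 _ _)))

end Model
end HetNet

/-! ### The connection event -/

namespace HetNet

namespace Params

variable {K : ℕ} (q : Params K)

lemma zeta_nonneg {θ : ℝ} (hθ : 0 ≤ θ) (k : Fin K) {r : ℝ} (hr : 0 ≤ r) : 0 ≤ q.zeta θ k r := by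
  have := q.power_pos k
  unfold zeta
  positivity

lemma measurable_zeta (θ : ℝ) (k : Fin K) : Measurable (q.zeta θ k) := by
  unfold zeta
  fun_prop

lemma zeta_mul_gain {θ : ℝ} (hθ : 0 ≤ θ) (k : Fin K) {x : Plane} (hx : x ≠ 0) :
    ENNReal.ofReal (q.zeta θ k ‖x‖) * gain q.α (q.power k) x = ENNReal.ofReal θ := by
  have hx : 0 < ‖x‖ := norm_pos_iff.2 hx
  have hp := q.power_pos k
  rw [gain, ← ENNReal.ofReal_mul (q.zeta_nonneg hθ k hx.le), zeta, Real.rpow_neg hx.le]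
  congr 1
  have : ‖x‖ ^ q.α ≠ 0 := (Real.rpow_pos_of_pos hx _).ne'
  field_simp

/-- A pointwise limit of the dyadic versions. The indicator restricts to `r > 0`, where continuity
in the argument is known; the serving distance is almost surely positive. -/
lemma measurable_condLaplace_indicator {z : ℝ → ℝ≥0} (hz : Measurable z) (R : ℝ) (k : Fin K) :
    Measurable ((Ioi (0 : ℝ)).indicator fun r => q.condLaplace (z r) (z r) (z r) R k r) := by
  refine measurable_of_tendsto_metrizable (f := fun n => (Ioi (0 : ℝ)).indicator fun r =>
    q.condLaplace (dyadicFloor n (z r)) (dyadicFloor n (z r)) (dyadicFloor n (z r)) R k r)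
    (fun n => (q.measurable_condLaplace_dyadicFloor n hz R k).indicator measurableSet_Ioi) ?_
  rw [tendsto_pi_nhds]
  intro r
  by_cases hr : r ∈ Ioi (0 : ℝ)
  · simp only [indicator_of_mem hr]
    exact q.tendsto_condLaplace (monotone_dyadicFloor _) (tendsto_dyadicFloor _) R k hr
  · simp only [indicator_of_notMem hr]
    exact tendsto_const_nhds

lemma noise_add_nonneg : 0 ≤ q.selfInterference + q.noise :=
  add_nonneg (mul_nonneg q.β_nonneg q.powerU_nonneg) q.noise_nonneg

end Params

namespace Model

variable {K : ℕ} {q : Params K} {Ω : Type*} [MeasurableSpace Ω] {P : Measure Ω}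
  (M : Model q Ω P)

lemma measurable_of_serving {A : Type*} [MeasurableSpace A] {F : Fin K × ℕ → Ω → A}
    (hF : ∀ l, Measurable (F l)) : Measurable fun ω => F (M.serving ω) ω :=
  (measurable_from_prod_countable_right (f := fun p : (Fin K × ℕ) × Ω => F p.1 p.2) hF).comp
    (M.measurable_serving.prodMk measurable_id)

lemma ae_fading_pos : ∀ᵐ ω ∂P, ∀ j, 0 < M.fading j ω := by
  refine ae_all_iff.2 fun j => ?_
  have := isProbabilityMeasure_expMeasure zero_lt_one
  have h : expMeasure 1 (Iic 0) = 0 := by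
    have h1 : (expMeasure 1).real (Iic 0) = 0 := by
      rw [← cdf_eq_real, cdf_expMeasure_eq zero_lt_one]
      simp
    simpa [measureReal_eq_zero_iff] using h1
  rw [← M.fading_law j, Measure.map_apply (M.measurable_fading j) measurableSet_Iic] at h
  filter_upwards [measure_eq_zero_iff_ae_notMem.1 h] with ω hω
  exact not_le.1 hω

variable [IsProbabilityMeasure P]

lemma lintegral_mul_condLaplace {z : Fin K → ℝ → ℝ≥0} (hz : ∀ k, Measurable (z k))
    {W : Fin K → ℝ → ℝ≥0∞} (hW : ∀ k, Measurable (W k)) (R : ℝ) :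
    ∫⁻ ω, W (M.tier ω) (M.dist ω) * q.condLaplace (z (M.tier ω) (M.dist ω))
        (z (M.tier ω) (M.dist ω)) (z (M.tier ω) (M.dist ω)) R (M.tier ω) (M.dist ω) ∂P =
      ∑ k, ENNReal.ofReal (q.assocProb k) * ∫⁻ r in Ioi (0 : ℝ), W k r *
        q.condLaplace (z k r) (z k r) (z k r) R k r * ENNReal.ofReal (q.distDensity k r) := by
  set G : Fin K → ℝ → ℝ≥0∞ := fun k =>
    (Ioi (0 : ℝ)).indicator fun r => q.condLaplace (z k r) (z k r) (z k r) R k r with hG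
  have hGpos : ∀ k r, 0 < r → G k r = q.condLaplace (z k r) (z k r) (z k r) R k r := fun k r hr =>
    indicator_of_mem (by exact hr) _
  have hGm : ∀ k, Measurable (G k) := fun k => q.measurable_condLaplace_indicator (hz k) R k
  have h := M.lintegral_comp_serving (W := fun k r => W k r * G k r) fun k => (hW k).mul (hGm k)
  clear_value G
  refine Eq.trans (lintegral_congr_ae ?_) (h.trans (Finset.sum_congr rfl fun k _ =>
    congrArg _ (setLIntegral_congr_fun measurableSet_Ioi fun r hr => ?_)))
  · filter_upwards [M.ae_dist_pos] with ω hω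
    rw [hGpos _ _ hω]
  · rw [hGpos k r hr]

/-- The event of being connected in terms of the power gain of the serving link. -/
lemma ae_le_sinr_iff {θ : ℝ} (hθ : 0 < θ) (τ : ℝ) :
    ∀ᵐ ω ∂P, ENNReal.ofReal θ ≤ M.sinr τ ω ↔
      ENNReal.ofReal (q.zeta θ (M.tier ω) (M.dist ω)) *
        (M.interferenceB ω + (M.interferenceU ω + M.interferenceJ τ ω)) +
        ENNReal.ofReal (q.zeta θ (M.tier ω) (M.dist ω)) *
          ENNReal.ofReal (q.selfInterference + q.noise) ≤
      ENNReal.ofReal (M.fading (.bs (M.serving ω).1 (M.serving ω).2) ω) := by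
  filter_upwards [M.ae_fading_pos, M.ae_bs_ne_zero] with ω hf hb
  set x := M.bs (M.serving ω).1 (M.serving ω).2 ω with hx
  set g := gain q.α (q.power (M.serving ω).1) x with hg
  set z := ENNReal.ofReal (q.zeta θ (M.tier ω) (M.dist ω)) with hz
  set h := ENNReal.ofReal (M.fading (.bs (M.serving ω).1 (M.serving ω).2) ω) with hh
  have hzg : z * g = ENNReal.ofReal θ := q.zeta_mul_gain hθ.le _ (hb (M.serving ω))
  have hθ0 : ENNReal.ofReal θ ≠ 0 := by simpa using hθ
  have hg0 : g ≠ 0 := fun h0 => hθ0 (by rw [← hzg, h0, mul_zero])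
  have hgt : g ≠ ∞ := gain_ne_top _ _ _
  have hh0 : h ≠ 0 := by simpa [hh] using hf _
  have hht : h ≠ ∞ := ENNReal.ofReal_ne_top
  rw [sinr, received_eq (q.power_pos _).le]
  -- The signal power is nonzero and finite, so the division can be cleared even if the denominator
  -- is `0` or `∞`.
  rw [ENNReal.le_div_iff_mul_le (Or.inr (mul_ne_zero hg0 hh0))
    (Or.inr (ENNReal.mul_ne_top hgt hht)), ← hzg, mul_comm z g, mul_assoc,
    ENNReal.mul_le_mul_iff_right hg0 hgt, ← mul_add, add_assoc, add_assoc, add_assoc, add_assoc]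

/-- For a fixed serving index the coefficient of its own gain is zero, so given the locations the
event says that an exponential gain exceeds an independent threshold. Its probability is the mean of
`nexp` of the threshold, from which the noise splits off as a deterministic factor in tier and
distance. -/
lemma measure_le_sinr {θ τ : ℝ} (hθ : 0 < θ) (hτ : 0 < τ) :
    P {ω | ENNReal.ofReal θ ≤ M.sinr τ ω} = ∑ k, ENNReal.ofReal (q.assocProb k) *
      ∫⁻ r in Ioi (0 : ℝ), nexp ((q.zeta θ k r).toNNReal *
          ENNReal.ofReal (q.selfInterference + q.noise)) *
        q.condLaplace (q.zeta θ k r).toNNReal (q.zeta θ k r).toNNReal (q.zeta θ k r).toNNReal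
          (q.guardRadius τ) k r * ENNReal.ofReal (q.distDensity k r) := by
  classical
  set R := q.guardRadius τ with hR
  set N := ENNReal.ofReal (q.selfInterference + q.noise) with hN
  set z : Fin K → ℝ → ℝ≥0 := fun k r => (q.zeta θ k r).toNNReal with hz
  have hzm : ∀ k, Measurable (z k) := fun k => (q.measurable_zeta θ k).real_toNNReal
  set zl : Fin K × ℕ → LocConf K → ℝ≥0∞ := fun l x => z l.1 ‖x.1 l.1 l.2‖ with hzl
  have hzlm : ∀ l, Measurable (zl l) := fun l =>
    ((hzm l.1).comp (f := fun x : LocConf K => ‖x.1 l.1 l.2‖) (by fun_prop)).coe_nnreal_ennreal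
  have hcm : ∀ l j, Measurable fun x => q.nodeCoef (zl l x) (zl l x) (zl l x) R l x j := fun l j =>
    q.measurable_nodeCoef (hzlm l) (hzlm l) (hzlm l) R l j
  set T : Fin K × ℕ → Ω → ℝ≥0∞ := fun l ω =>
    ∑' j, q.nodeCoef (zl l (M.locConf ω)) (zl l (M.locConf ω)) (zl l (M.locConf ω)) R l
      (M.locConf ω) j * ENNReal.ofReal (M.fading j ω) + zl l (M.locConf ω) * N with hT
  have hTm : ∀ l, Measurable (T l) := fun l => (Measurable.tsum fun j =>
    ((hcm l j).comp M.measurable_locConf).mul (M.measurable_fading j).ennreal_ofReal).add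
      (((hzlm l).comp M.measurable_locConf).mul_const N)
  have hTs : ∀ ω, T (M.serving ω) ω = z (M.tier ω) (M.dist ω) * (M.interferenceB ω +
      (M.interferenceU ω + M.interferenceJ τ ω)) + z (M.tier ω) (M.dist ω) * N := by
    intro ω
    simp only [hT, hR]
    rw [M.tsum_nodeCoef_fading, mul_add, mul_add]
    rfl
  have hset : ∀ l : Fin K × ℕ, MeasurableSet {ω | T l ω ≤
      ENNReal.ofReal (M.fading (.bs l.1 l.2) ω)} := fun l =>
    measurableSet_le (hTm l) (M.measurable_fading _).ennreal_ofReal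
  have hSl : ∀ l : Fin K × ℕ, Measurable fun x : LocConf K =>
      if q.Strongest x.1 l then (1 : ℝ≥0∞) else 0 := fun l =>
    Measurable.ite (measurable_fst (measurableSet_strongest l)) measurable_const measurable_const
  have e1 := M.lintegral_eq_tsum_serving (F := fun l => {ω | T l ω ≤
      ENNReal.ofReal (M.fading (.bs l.1 l.2) ω)}.indicator 1) fun l => measurable_one.indicator
          (hset l)
  have e2 := M.lintegral_eq_tsum_serving (F := fun l ω => nexp (T l ω)) fun l =>
    measurable_nexp.comp (hTm l)
  have e3 : ∀ l : Fin K × ℕ, ∫⁻ ω, (if q.Strongest (M.locConf ω).1 l then 1 else 0) *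
      {ω | T l ω ≤ ENNReal.ofReal (M.fading (.bs l.1 l.2) ω)}.indicator 1 ω ∂P =
      ∫⁻ ω, (if q.Strongest (M.locConf ω).1 l then 1 else 0) * nexp (T l ω) ∂P := fun l =>
    lintegral_indicator_fading_loc M.measurable_fading M.fading_law M.fading_indep
      M.measurable_locConf M.fading_indep_locations (hSl l) (hcm l) (l₀ := .bs l.1 l.2)
      (fun x => by simp [Params.nodeCoef]) ((hzlm l).mul_const N)
  simp only [e3] at e1
  rw [← e2] at e1
  have hS : MeasurableSet {ω | T (M.serving ω) ω ≤
      ENNReal.ofReal (M.fading (.bs (M.serving ω).1 (M.serving ω).2) ω)} := by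
    exact measurableSet_le (M.measurable_of_serving hTm) (M.measurable_of_serving
      (F := fun l ω => ENNReal.ofReal (M.fading (.bs l.1 l.2) ω))
      fun l => (M.measurable_fading (.bs l.1 l.2)).ennreal_ofReal)
  calc P {ω | ENNReal.ofReal θ ≤ M.sinr τ ω}
      = P {ω | T (M.serving ω) ω ≤
          ENNReal.ofReal (M.fading (.bs (M.serving ω).1 (M.serving ω).2) ω)} := by
        refine measure_congr ?_
        filter_upwards [M.ae_le_sinr_iff hθ τ] with ω hω
        refine propext (hω.trans ?_)
        change _ ↔ T (M.serving ω) ω ≤ _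
        rw [hTs]
        rfl
    _ = ∫⁻ ω, nexp (T (M.serving ω) ω) ∂P := by
        rw [← lintegral_indicator_one hS]
        exact e1
    _ = ∫⁻ ω, nexp (z (M.tier ω) (M.dist ω) * N) * nexp (z (M.tier ω) (M.dist ω) *
          (M.interferenceB ω + (M.interferenceU ω + M.interferenceJ τ ω))) ∂P := by
        refine lintegral_congr fun ω => ?_
        rw [hTs, add_comm, nexp_add]
    _ = _ := by
        have hW : ∀ k, Measurable fun r => nexp (z k r * N) := fun k =>
          measurable_nexp.comp ((hzm k).coe_nnreal_ennreal.mul_const N)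
        rw [M.lintegral_nexp_mul_interference hτ hzm (W := fun k r => nexp (z k r * N)) hW
          fun k r => nexp_le_one _]
        exact M.lintegral_mul_condLaplace hzm hW _

end Model
end HetNet

/-! ### Closed forms for base stations and users -/

namespace HetNet

lemma one_sub_inv_gain {α s p : ℝ} (hs : 0 ≤ s) (hp : 0 ≤ p) (x : Plane) :
    1 - (1 + (s.toNNReal : ℝ≥0∞) * gain α p x)⁻¹ =
      ENNReal.ofReal (1 - 1 / (1 + s * p * ‖x‖ ^ (-α))) := by
  have h1 : 0 ≤ ‖x‖ ^ (-α) := Real.rpow_nonneg (norm_nonneg x) _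
  have h2 : 0 ≤ s * p * ‖x‖ ^ (-α) := by positivity
  have e : (s.toNNReal : ℝ≥0∞) = ENNReal.ofReal s := rfl
  rw [gain, e, ← ENNReal.ofReal_mul hs, ← mul_assoc, ← ENNReal.ofReal_one,
    ← ENNReal.ofReal_add zero_le_one h2, ← ENNReal.ofReal_inv_of_pos (by positivity),
    ← ENNReal.ofReal_sub _ (by positivity), one_div]

lemma one_sub_one_div_mem {a : ℝ} (ha : 0 ≤ a) : 0 ≤ 1 - 1 / (1 + a) ∧ 1 - 1 / (1 + a) ≤ a ∧
    1 - 1 / (1 + a) ≤ 1 := by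
  have e : 1 - 1 / (1 + a) = a / (1 + a) := by field_simp; ring
  have h : 0 < 1 + a := by positivity
  refine ⟨by rw [e]; positivity, ?_, ?_⟩
  · rw [e]
    exact div_le_self ha (by linarith)
  · have : 0 ≤ 1 / (1 + a) := by positivity
    linarith

/-- The integral over the complement of a disc in polar coordinates. -/
lemma setLIntegral_compl_ball_norm {F : ℝ → ℝ≥0∞} (hF : Measurable F) {D : ℝ} (hD : 0 < D) :
    ∫⁻ x in (Metric.ball (0 : Plane) D)ᶜ, F ‖x‖ =
      ∫⁻ r in Ioi D, ENNReal.ofReal (2 * Real.pi * r) * F r := by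
  have e : ∫⁻ x in (Metric.ball (0 : Plane) D)ᶜ, F ‖x‖ =
      ∫⁻ x : Plane, (Ici D).indicator F ‖x‖ := by
    rw [← lintegral_indicator Metric.isOpen_ball.measurableSet.compl]
    refine lintegral_congr fun x => ?_
    by_cases h : D ≤ ‖x‖
    · rw [indicator_of_mem (by simpa using h), indicator_of_mem (by exact h)]
    · rw [indicator_of_notMem (by simpa using h), indicator_of_notMem (by exact h)]
  rw [e, lintegral_plane_norm (hF.indicator measurableSet_Ici), setLIntegral_congr (Ioi_ae_eq_Ici
      (a := D)),
    ← lintegral_indicator measurableSet_Ioi, ← lintegral_indicator measurableSet_Ici]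
  refine lintegral_congr fun r => ?_
  by_cases h : D ≤ r
  · rw [indicator_of_mem (by exact hD.trans_le h), indicator_of_mem (by exact h),
      indicator_of_mem (by exact h)]
  · simp [indicator, h]

lemma integrableOn_tail {α a D : ℝ} (hα : 2 < α) (ha : 0 ≤ a) (hD : 0 < D) :
    IntegrableOn (fun y => y * (1 - 1 / (1 + a * y ^ (-α)))) (Ioi D) := by
  have hint : IntegrableOn (fun y : ℝ => a * y ^ (1 - α)) (Ioi D) :=
    (integrableOn_Ioi_rpow_of_lt (by linarith) hD).const_mul _
  refine Integrable.mono' hint (Measurable.aestronglyMeasurable (by fun_prop)) ?_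
  refine (ae_restrict_mem measurableSet_Ioi).mono fun y hy => ?_
  have hy : 0 < y := hD.trans hy
  have h0 : 0 ≤ a * y ^ (-α) := by positivity
  obtain ⟨h1, h2, -⟩ := one_sub_one_div_mem h0
  have e : y ^ (1 - α) = y * y ^ (-α) := by
    rw [sub_eq_add_neg, Real.rpow_add hy, Real.rpow_one]
  rw [Real.norm_of_nonneg (mul_nonneg hy.le h1), e]
  calc y * (1 - 1 / (1 + a * y ^ (-α))) ≤ y * (a * y ^ (-α)) := by gcongr
    _ = _ := by ring

/-- Here `c = b + 1`, so the factor `(1 - t) ^ (c - b - 1)` in Euler's integral is trivial and the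
quotient of Gamma values is `b = 1 - 2 / α`. -/
lemma hyp2F1_eq_integral {α κ : ℝ} (hα : 2 < α) :
    hyp2F1 1 (1 - 2 / α) (2 - 2 / α) (-κ) =
      (1 - 2 / α) * ∫ t in Ioo (0 : ℝ) 1, t ^ (-(2 / α)) * (1 + κ * t)⁻¹ := by
  have hb : 0 < 1 - 2 / α := by
    rw [sub_pos, div_lt_one (by linarith)]
    exact hα
  have hc : 2 - 2 / α = (1 - 2 / α) + 1 := by ring
  have hcb : (1 - 2 / α) + 1 - (1 - 2 / α) = 1 := by ring
  rw [hyp2F1, hc, hcb, Real.Gamma_add_one hb.ne', Real.Gamma_one, mul_one,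
    mul_div_cancel_right₀ _ (Real.Gamma_pos_of_pos hb).ne']
  congr 1
  refine integral_congr_ae (.of_forall fun t => ?_)
  simp only [sub_self, Real.rpow_zero, mul_one, Real.rpow_neg_one, neg_mul, sub_neg_eq_add]
  congr 2
  ring

lemma image_rpow_neg_Ioi {α D : ℝ} (hα : 0 < α) (hD : 0 < D) :
    (fun y : ℝ => D ^ α * y ^ (-α)) '' Ioi D = Ioo 0 1 := by
  ext t
  constructor
  · rintro ⟨y, hy, rfl⟩
    have hy : D < y := hy
    have hy0 : 0 < y := hD.trans hy
    refine ⟨by positivity, ?_⟩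
    dsimp only
    rw [Real.rpow_neg hy0.le, ← div_eq_mul_inv, div_lt_one (by positivity)]
    exact Real.rpow_lt_rpow hD.le hy hα
  · rintro ⟨h0, h1⟩
    refine ⟨D * t ^ (-(1 / α)), ?_, ?_⟩
    · have : 1 < t ^ (-(1 / α)) := Real.one_lt_rpow_of_pos_of_lt_one_of_neg h0 h1 (by
        rw [neg_lt_zero]; positivity)
      exact lt_mul_of_one_lt_right hD this
    · dsimp only
      rw [Real.mul_rpow hD.le (by positivity), ← Real.rpow_mul h0.le, ← mul_assoc,
        ← Real.rpow_add hD, add_neg_cancel, Real.rpow_zero, one_mul, neg_mul_neg, one_div,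
        inv_mul_cancel₀ hα.ne', Real.rpow_one]

/-- The mean interference integral in terms of the hypergeometric function. -/
lemma integral_tail_eq_hyp2F1 {α a D : ℝ} (hα : 2 < α) (ha : 0 ≤ a) (hD : 0 < D) :
    ∫ y in Ioi D, y * (1 - 1 / (1 + a * y ^ (-α))) =
      a * D ^ (2 - α) / (α - 2) * hyp2F1 1 (1 - 2 / α) (2 - 2 / α) (-(a / D ^ α)) := by
  have hα0 : 0 < α := by linarith
  have hder : ∀ y ∈ Ioi D, HasDerivWithinAt (fun y : ℝ => D ^ α * y ^ (-α))
      (D ^ α * (-α * y ^ (-α - 1))) (Ioi D) y := fun y hy =>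
    ((Real.hasDerivAt_rpow_const (Or.inl (hD.trans hy).ne')).const_mul _).hasDerivWithinAt
  have hinj : InjOn (fun y : ℝ => D ^ α * y ^ (-α)) (Ioi D) := by
    intro y hy z hz h
    have hy : 0 < y := hD.trans hy
    have hz : 0 < z := hD.trans hz
    have h' : y ^ (-α) = z ^ (-α) := mul_left_cancel₀ (Real.rpow_pos_of_pos hD α).ne' h
    exact (Real.rpow_left_inj hy.le hz.le (neg_ne_zero.2 hα0.ne')).1 h'
  -- The substitution `t = (D / y) ^ α` maps the exterior `y > D` onto the unit interval of Euler's
  -- integral.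
  have key := integral_image_eq_integral_abs_deriv_smul measurableSet_Ioi hder hinj
    fun t => t ^ (-(2 / α)) * (1 + a / D ^ α * t)⁻¹
  rw [image_rpow_neg_Ioi hα0 hD] at key
  rw [hyp2F1_eq_integral hα, key, ← integral_const_mul, ← integral_const_mul]
  refine setIntegral_congr_fun measurableSet_Ioi fun y hy => ?_
  have hy : 0 < y := hD.trans hy
  have hDα := Real.rpow_pos_of_pos hD α
  have hyα := Real.rpow_pos_of_pos hy α
  have e1 : (D ^ α * y ^ (-α)) ^ (-(2 / α)) = D ^ (-2 : ℝ) * y ^ (2 : ℝ) := by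
    rw [Real.mul_rpow hDα.le (Real.rpow_nonneg hy.le _), ← Real.rpow_mul hD.le,
      ← Real.rpow_mul hy.le]
    congr 2 <;> field_simp
  have e2 : a / D ^ α * (D ^ α * y ^ (-α)) = a * y ^ (-α) := by field_simp
  have e3 : |D ^ α * (-α * y ^ (-α - 1))| = D ^ α * (α * y ^ (-α - 1)) := by
    rw [abs_mul, abs_mul, abs_neg, abs_of_pos hDα, abs_of_pos hα0,
      abs_of_pos (Real.rpow_pos_of_pos hy _)]
  have h0 : 0 ≤ a * y ^ (-α) := by positivity
  simp only [smul_eq_mul, e1, e2, e3]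
  rw [Real.rpow_sub hD, Real.rpow_sub_one hy.ne', Real.rpow_neg hD.le, Real.rpow_neg hy.le] at *
  have h1 : 0 < 1 + a * (y ^ α)⁻¹ := by positivity
  simp only [Real.rpow_two]
  have h2 : α - 2 ≠ 0 := by linarith
  have h3 : y ^ α + a ≠ 0 := by positivity
  field_simp
  ring

namespace Params

variable {K : ℕ} (q : Params K)

/-- The exponent of the Laplace transform of the interference from outside a disc. -/
lemma setLIntegral_compl_ball_eq_hyp2F1 {s p D : ℝ} (hs : 0 ≤ s) (hp : 0 ≤ p) (hD : 0 < D) :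
    ∫⁻ x in (Metric.ball (0 : Plane) D)ᶜ, (1 - (1 + (s.toNNReal : ℝ≥0∞) * gain q.α p x)⁻¹) =
      ENNReal.ofReal (2 * Real.pi * (s * p * D ^ (2 - q.α) / (q.α - 2) *
        hyp2F1 1 (1 - 2 / q.α) (2 - 2 / q.α) (-(s * p / D ^ q.α)))) := by
  simp_rw [one_sub_inv_gain hs hp]
  have hm : Measurable fun y : ℝ => ENNReal.ofReal (1 - 1 / (1 + s * p * y ^ (-q.α))) := by fun_prop
  have hsp : 0 ≤ s * p := mul_nonneg hs hp
  rw [setLIntegral_compl_ball_norm hm hD, ← integral_tail_eq_hyp2F1 q.two_lt_α hsp hD,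
    ← integral_const_mul, ofReal_integral_eq_lintegral_ofReal
      ((integrableOn_tail q.two_lt_α hsp hD).const_mul _)]
  · refine setLIntegral_congr_fun measurableSet_Ioi fun y hy => ?_
    have hy : 0 < y := hD.trans hy
    rw [← ENNReal.ofReal_mul (by positivity)]
    congr 1
    ring
  · refine (ae_restrict_mem measurableSet_Ioi).mono fun y hy => ?_
    have hy : 0 < y := hD.trans hy
    exact mul_nonneg (by positivity) (mul_nonneg hy.le (one_sub_one_div_mem (by positivity)).1)

lemma Del_pos (k : Fin K) {r : ℝ} (hr : 0 < r) (t : Fin K) : 0 < q.Del k r t :=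
  mul_pos hr (Real.rpow_pos_of_pos (div_pos (q.power_pos t) (q.power_pos k)) _)

lemma nexp_bsTail {s : ℝ} (hs : 0 ≤ s) (k : Fin K) {r : ℝ} (hr : 0 < r) :
    nexp (q.bsTail s.toNNReal k r) = ENNReal.ofReal (q.laplaceB k r s) := by
  rw [bsTail, nexp_sum, laplaceB, ENNReal.ofReal_prod_of_nonneg fun _ _ => (Real.exp_pos _).le]
  refine Finset.prod_congr rfl fun t _ => ?_
  have hD := q.Del_pos k hr t
  rw [q.setLIntegral_compl_ball_eq_hyp2F1 hs (q.power_pos t).le hD,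
    ← ENNReal.ofReal_mul (q.dens_pos t).le, nexp_ofReal]
  · congr 2
    ring
  · have := q.dens_pos t
    rw [← integral_tail_eq_hyp2F1 q.two_lt_α (mul_nonneg hs (q.power_pos t).le) hD]
    have : 0 ≤ ∫ y in Ioi (q.Del k r t), y * (1 - 1 / (1 + s * q.power t * y ^ (-q.α))) :=
      setIntegral_nonneg measurableSet_Ioi fun y hy => mul_nonneg (hD.trans hy).le
        (one_sub_one_div_mem (mul_nonneg (mul_nonneg hs (q.power_pos t).le)
          (Real.rpow_nonneg (hD.trans hy).le _))).1
    positivity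

/-- Near the origin the middle factor is at most one and the integrand at most `λ_t y`; at infinity
it is at most `λ_t` times the tail integrand of `integrableOn_tail`. -/
lemma integrableOn_userDensity {s : ℝ} (hs : 0 ≤ s) (k : Fin K) (r : ℝ) (t : Fin K) :
    IntegrableOn (fun y => q.userDensity k r t y * (1 - 1 / (1 + s * q.powerU * y ^ (-q.α))) * y)
      (Ioi (0 : ℝ)) := by
  have hsp : 0 ≤ s * q.powerU := mul_nonneg hs q.powerU_nonneg
  have hm : Measurable fun y =>
      q.userDensity k r t y * (1 - 1 / (1 + s * q.powerU * y ^ (-q.α))) * y := by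
    unfold userDensity
    fun_prop
  rw [← Ioc_union_Ioi_eq_Ioi (zero_le_one (α := ℝ))]
  have hbound : ∀ y, 0 < y → 0 ≤ q.userDensity k r t y *
      (1 - 1 / (1 + s * q.powerU * y ^ (-q.α))) * y ∧
      q.userDensity k r t y * (1 - 1 / (1 + s * q.powerU * y ^ (-q.α))) * y ≤
        q.dens t * (y * (1 - 1 / (1 + s * q.powerU * y ^ (-q.α)))) ∧
      q.dens t * (y * (1 - 1 / (1 + s * q.powerU * y ^ (-q.α)))) ≤ q.dens t * y := by
    intro y hy
    obtain ⟨h1, -, h3⟩ := one_sub_one_div_mem (a := s * q.powerU * y ^ (-q.α)) (by positivity)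
    have h4 := q.userDensity_nonneg k r t y
    have h5 := q.userDensity_le k r t y
    have h6 := q.dens_pos t
    refine ⟨by positivity, ?_, ?_⟩
    · rw [mul_assoc, mul_comm (1 - _) y]
      gcongr
    · gcongr
      exact mul_le_of_le_one_right hy.le h3
  refine IntegrableOn.union ?_ ?_
  · refine Integrable.mono' (g := fun y => q.dens t * y)
      ((by fun_prop : Continuous fun y : ℝ => q.dens t * y).integrableOn_Ioc)
      hm.aestronglyMeasurable ((ae_restrict_mem measurableSet_Ioc).mono fun y hy => ?_)
    obtain ⟨h1, h2, h3⟩ := hbound y hy.1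
    rw [Real.norm_of_nonneg h1]
    exact h2.trans h3
  · refine Integrable.mono' ((integrableOn_tail q.two_lt_α hsp zero_lt_one).const_mul (q.dens t))
      hm.aestronglyMeasurable ((ae_restrict_mem measurableSet_Ioi).mono fun y hy => ?_)
    obtain ⟨h1, h2, h3⟩ := hbound y (zero_lt_one.trans hy)
    rw [Real.norm_of_nonneg h1]
    exact h2

lemma nexp_userExponent {s : ℝ} (hs : 0 ≤ s) (k : Fin K) (r : ℝ) :
    nexp (q.userExponent s.toNNReal k r) = ENNReal.ofReal (q.laplaceU k r s) := by
  rw [userExponent, nexp_sum, laplaceU, ENNReal.ofReal_prod_of_nonneg fun _ _ => (Real.exp_pos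
      _).le]
  refine Finset.prod_congr rfl fun t _ => ?_
  have hnn : ∀ y, 0 < y → 0 ≤ q.userDensity k r t y *
      (1 - 1 / (1 + s * q.powerU * y ^ (-q.α))) * y := by
    intro y hy
    have := q.powerU_nonneg
    have h1 := (one_sub_one_div_mem (a := s * q.powerU * y ^ (-q.α)) (by positivity)).1
    have h4 := q.userDensity_nonneg k r t y
    positivity
  have e : ∫⁻ x : Plane, ENNReal.ofReal (q.userDensity k r t ‖x‖) *
      (1 - (1 + (s.toNNReal : ℝ≥0∞) * gain q.α q.powerU x)⁻¹) = ENNReal.ofReal (2 * Real.pi *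
      ∫ y in Ioi (0 : ℝ), q.userDensity k r t y * (1 - 1 / (1 + s * q.powerU * y ^ (-q.α))) * y) :=
          by
    simp_rw [one_sub_inv_gain hs q.powerU_nonneg]
    have hm : Measurable fun y : ℝ => ENNReal.ofReal (q.userDensity k r t y) *
        ENNReal.ofReal (1 - 1 / (1 + s * q.powerU * y ^ (-q.α))) := by
      unfold userDensity
      fun_prop
    rw [lintegral_plane_norm hm, ← integral_const_mul, ofReal_integral_eq_lintegral_ofReal
      ((q.integrableOn_userDensity hs k r t).const_mul _)]
    · refine setLIntegral_congr_fun measurableSet_Ioi fun y hy => ?_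
      have hy : 0 < y := hy
      rw [← ENNReal.ofReal_mul (q.userDensity_nonneg k r t y), ← ENNReal.ofReal_mul (by positivity)]
      congr 1
      ring
    · exact (ae_restrict_mem measurableSet_Ioi).mono fun y hy =>
        mul_nonneg (by positivity) (hnn y hy)
  rw [e, nexp_ofReal]
  have := setIntegral_nonneg (μ := volume) measurableSet_Ioi hnn
  positivity

end Params
end HetNet

/-! ### The hole and the transform of the jammers -/

namespace HetNet

/-- The set is the arc `|φ| ≤ arccos a`. Positivity of `a` keeps it inside the open interval of
angles, and for `a > 1` both sides vanish. -/
lemma volume_le_cos {a : ℝ} (ha : 0 < a) :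
    volume {φ ∈ Ioo (-Real.pi) Real.pi | a ≤ Real.cos φ} = ENNReal.ofReal (2 * Real.arccos a) := by
  have hpi := Real.pi_pos
  rcases le_or_gt a 1 with h1 | h1
  · have e : {φ ∈ Ioo (-Real.pi) Real.pi | a ≤ Real.cos φ} =
        Icc (-Real.arccos a) (Real.arccos a) := by
      have hlt : Real.arccos a < Real.pi :=
        (Real.arccos_le_pi_div_two.2 ha.le).trans_lt (by linarith)
      have hcos : Real.cos (Real.arccos a) = a := Real.cos_arccos (by linarith) h1
      have habs : ∀ φ : ℝ, |φ| ≤ Real.pi → (a ≤ Real.cos φ ↔ |φ| ≤ Real.arccos a) := by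
        intro φ hφ
        rw [← Real.cos_abs φ]
        conv_lhs => rw [← hcos]
        exact Real.strictAntiOn_cos.le_iff_ge ⟨Real.arccos_nonneg a, hlt.le⟩ ⟨abs_nonneg φ, hφ⟩
      ext φ
      rw [mem_Icc, ← abs_le]
      constructor
      · rintro ⟨h2, h3⟩
        exact (habs φ (abs_le.2 ⟨h2.1.le, h2.2.le⟩)).1 h3
      · intro h2
        have h3 : |φ| < Real.pi := h2.trans_lt hlt
        exact ⟨abs_lt.1 h3, (habs φ h3.le).2 h2⟩
    rw [e, Real.volume_Icc]
    congr 1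
    ring
  · have e : {φ ∈ Ioo (-Real.pi) Real.pi | a ≤ Real.cos φ} = ∅ := by
      ext φ
      simp only [mem_sep_iff, mem_empty_iff_false, iff_false, not_and, not_le]
      exact fun _ => (Real.cos_le_one φ).trans_lt h1
    rw [e, Real.arccos_of_one_le h1.le]
    simp

/-- The law of cosines. -/
lemma dist_polarPoint_le_iff {y v R : ℝ} (hy : 0 < y) (hv : 0 < v) (hR : 0 < R) (φ : ℝ) :
    dist (polarPoint y φ) (polarPoint v 0) ≤ R ↔
      (y ^ 2 + v ^ 2 - R ^ 2) / (2 * y * v) ≤ Real.cos φ := by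
  have e : dist (polarPoint y φ) (polarPoint v 0) =
      √(y ^ 2 + v ^ 2 - 2 * y * v * Real.cos φ) := by
    rw [EuclideanSpace.dist_eq]
    congr 1
    simp only [polarPoint, Fin.sum_univ_two, Real.dist_eq, sq_abs, Matrix.cons_val_zero,
      Matrix.cons_val_one, Real.cos_zero, Real.sin_zero, PiLp.toLp_apply]
    nlinarith [Real.sin_sq_add_cos_sq φ]
  rw [e, Real.sqrt_le_left hR.le, div_le_iff₀ (by positivity)]
  constructor <;> intro h <;> linarith

namespace Params

variable {K : ℕ} (q : Params K)

/-- The part of the exponent that is missing because of the hole around `c`. -/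
def holeExponent (s : ℝ≥0) (R : ℝ) (c : Plane) : ℝ≥0∞ :=
  ∫⁻ x : Plane, ENNReal.ofReal q.densJ *
    if R ≤ ‖x‖ ∧ dist x c ≤ R then (1 - (1 + s * gain q.α q.powerJ x)⁻¹) else 0

/-- The exterior of the guard zone is partitioned by the hole around `c`. Stated as a sum, since
subtraction on `[0, ∞]` is truncated. -/
lemma jamExponent_add_holeExponent (s : ℝ≥0) (R : ℝ) (c : Plane) :
    q.jamExponent s R R c + q.holeExponent s R c = ENNReal.ofReal q.densJ *
      ∫⁻ x in (Metric.ball (0 : Plane) R)ᶜ, (1 - (1 + s * gain q.α q.powerJ x)⁻¹) := by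
  classical
  rw [jamExponent, holeExponent, ← lintegral_add_left (q.measurable_jamExponent_integrand s R R c),
    ← lintegral_const_mul' _ _ ENNReal.ofReal_ne_top,
    ← lintegral_indicator Metric.isOpen_ball.measurableSet.compl]
  refine lintegral_congr fun x => ?_
  have hmem : x ∈ (Metric.ball (0 : Plane) R)ᶜ ↔ R ≤ ‖x‖ := by simp
  simp only [indicator_apply, hmem]
  by_cases h1 : R ≤ ‖x‖
  · rcases lt_or_ge R (dist x c) with h2 | h2
    · simp [h1, h2, not_le.2 h2]
    · simp [h1, h2, not_lt.2 h2]
  · simp [h1]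

/-- The reflection across the perpendicular bisector of `c` and `d` fixes the origin, exchanges the
two points and preserves volume, so it suffices to place the hole on the first axis. -/
lemma holeExponent_congr_norm (s : ℝ≥0) (R : ℝ) {c d : Plane} (h : ‖c‖ = ‖d‖) :
    q.holeExponent s R c = q.holeExponent s R d := by
  set ρ := Submodule.reflection (ℝ ∙ (d - c))ᗮ with hρ
  have hρd : ρ d = c := Submodule.reflection_sub h.symm
  have hmp : MeasurePreserving ρ volume volume := ρ.measurePreserving
  rw [holeExponent, holeExponent,
    ← hmp.lintegral_comp_emb ρ.toHomeomorph.measurableEmbedding]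
  refine lintegral_congr fun x => ?_
  have h1 : ‖ρ x‖ = ‖x‖ := ρ.norm_map x
  have h2 : dist (ρ x) c = dist x d := by rw [← hρd, ρ.dist_map]
  simp only [gain, h1, h2]

lemma holeExponent_polarPoint {s : ℝ} (hs : 0 < s) {τ v : ℝ} (hτ : 0 < τ) (hv : 0 < v) :
    q.holeExponent s.toNNReal (q.guardRadius τ) (polarPoint v 0) =
      ENNReal.ofReal (∫ y in (max (v - q.guardRadius τ) (q.guardRadius τ))..(v + q.guardRadius τ),
        2 * y * q.jamDensity' τ v y / (1 + y ^ q.α / (s * q.powerJ))) := by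
  classical
  have hR : 0 < q.guardRadius τ := q.guardRadius_pos hτ
  have hsp : 0 < s * q.powerJ := mul_pos hs q.powerJ_pos
  have hdJ := q.densJ_pos
  have hm : Measurable fun x : Plane => ENNReal.ofReal q.densJ *
      if q.guardRadius τ ≤ ‖x‖ ∧ dist x (polarPoint v 0) ≤ q.guardRadius τ then
        (1 - (1 + (s.toNNReal : ℝ≥0∞) * gain q.α q.powerJ x)⁻¹) else 0 := by
    refine Measurable.const_mul (Measurable.ite ?_ ?_ measurable_const) _
    · have h1 : MeasurableSet {x : Plane | q.guardRadius τ ≤ ‖x‖} :=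
        measurableSet_le (by fun_prop) (by fun_prop)
      have h2 : MeasurableSet {x : Plane | dist x (polarPoint v 0) ≤ q.guardRadius τ} :=
        measurableSet_le (by fun_prop) (by fun_prop)
      exact h1.inter h2
    · exact measurable_const.sub ((measurable_const.add ((measurable_gain _ _).const_mul _)).inv)
  have hle : max (v - q.guardRadius τ) (q.guardRadius τ) ≤ v + q.guardRadius τ :=
    max_le (by linarith) (by linarith)
  have hmI : Measurable fun y => 2 * y * q.jamDensity' τ v y / (1 + y ^ q.α / (s * q.powerJ)) := by
    unfold jamDensity'
    have := Real.continuous_arccos.measurable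
    fun_prop
  have hposI : ∀ y, 0 < y →
      0 ≤ 2 * y * q.jamDensity' τ v y / (1 + y ^ q.α / (s * q.powerJ)) ∧
      2 * y * q.jamDensity' τ v y / (1 + y ^ q.α / (s * q.powerJ)) ≤
        2 * y * (q.densJ * Real.pi) := by
    intro y hy
    unfold jamDensity'
    set A := Real.arccos ((y ^ 2 + v ^ 2 - q.guardRadius τ ^ 2) / (2 * y * v))
    have h1 : 0 ≤ A := Real.arccos_nonneg _
    have h2 : A ≤ Real.pi := Real.arccos_le_pi _
    have h3 : 0 ≤ y ^ q.α / (s * q.powerJ) := by positivity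
    refine ⟨by positivity, (div_le_self (by positivity) (by linarith)).trans ?_⟩
    gcongr
  rw [holeExponent, lintegral_plane_polar hm, intervalIntegral.integral_of_le hle,
    ← integral_Icc_eq_integral_Ioc, ofReal_integral_eq_lintegral_ofReal]
  · rw [← lintegral_indicator measurableSet_Ioi, ← lintegral_indicator measurableSet_Icc]
    refine lintegral_congr fun y => ?_
    by_cases hy : 0 < y
    swap
    · rw [indicator_of_notMem (by exact hy), indicator_of_notMem]
      exact fun h => hy (hR.trans_le ((le_max_right _ _).trans h.1))
    rw [indicator_of_mem (by exact hy)]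
    simp only [norm_polarPoint hy.le, dist_polarPoint_le_iff hy hv hR,
      one_sub_inv_gain hs.le q.powerJ_pos.le]
    set a := (y ^ 2 + v ^ 2 - q.guardRadius τ ^ 2) / (2 * y * v) with ha
    by_cases hyR : q.guardRadius τ ≤ y
    swap
    · rw [indicator_of_notMem fun h => hyR ((le_max_right _ _).trans h.1)]
      simp [hyR]
    -- From `R ≤ y` and `v > 0`, the numerator `y² + v² - R²` is at least `v²`.
    have ha0 : 0 < a := by
      refine div_pos ?_ (by positivity)
      nlinarith
    have e1 : ∫⁻ φ in Ioo (-Real.pi) Real.pi, ENNReal.ofReal q.densJ *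
        (if q.guardRadius τ ≤ y ∧ a ≤ Real.cos φ then
          ENNReal.ofReal (1 - 1 / (1 + s * q.powerJ * y ^ (-q.α))) else 0) =
        ENNReal.ofReal q.densJ * ENNReal.ofReal (1 - 1 / (1 + s * q.powerJ * y ^ (-q.α))) *
          ENNReal.ofReal (2 * Real.arccos a) := by
      rw [← volume_le_cos ha0, ← lintegral_indicator measurableSet_Ioo]
      have hset : MeasurableSet {φ ∈ Ioo (-Real.pi) Real.pi | a ≤ Real.cos φ} :=
        measurableSet_Ioo.inter (measurableSet_le measurable_const Real.measurable_cos)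
      rw [← lintegral_indicator_const hset]
      refine lintegral_congr fun φ => ?_
      by_cases h1 : φ ∈ Ioo (-Real.pi) Real.pi <;> by_cases h2 : a ≤ Real.cos φ
      · rw [indicator_of_mem h1, if_pos ⟨hyR, h2⟩, indicator_of_mem (by exact ⟨h1, h2⟩)]
      · rw [indicator_of_mem h1, if_neg fun h => h2 h.2,
          indicator_of_notMem (by exact fun h => h2 h.2), mul_zero]
      · rw [indicator_of_notMem h1, indicator_of_notMem (by exact fun h => h1 h.1)]
      · rw [indicator_of_notMem h1, indicator_of_notMem (by exact fun h => h1 h.1)]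
    rw [e1]
    have h0 : 0 ≤ 1 - 1 / (1 + s * q.powerJ * y ^ (-q.α)) :=
      (one_sub_one_div_mem (by positivity)).1
    have hfrac : 1 - 1 / (1 + s * q.powerJ * y ^ (-q.α)) = 1 / (1 + y ^ q.α / (s * q.powerJ)) := by
      rw [Real.rpow_neg hy.le]
      have := Real.rpow_pos_of_pos hy q.α
      have h2 : y ^ q.α + s * q.powerJ ≠ 0 := by positivity
      have h3 : s * q.powerJ + y ^ q.α ≠ 0 := by positivity
      generalize s * q.powerJ = b at *
      field_simp
      ring
    rw [← ENNReal.ofReal_mul hdJ.le, ← ENNReal.ofReal_mul (by positivity),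
      ← ENNReal.ofReal_mul hy.le, hfrac]
    by_cases hmem : y ∈ Icc (max (v - q.guardRadius τ) (q.guardRadius τ)) (v + q.guardRadius τ)
    · rw [indicator_of_mem hmem, jamDensity', ← ha]
      congr 1
      ring
    · rw [indicator_of_notMem hmem]
      -- Outside the interval, but with `y ≥ R`, one has `|y - v| ≥ R`: the circle of radius `y`
      -- misses the interior of the hole, and the arccosine is zero.
      have h1 : 1 ≤ a := by
        rw [ha, le_div_iff₀ (by positivity)]
        have : q.guardRadius τ ≤ |y - v| := by
          by_contra hlt
          rw [not_le, abs_lt] at hlt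
          exact hmem ⟨max_le (by linarith) hyR, by linarith⟩
        have := pow_le_pow_left₀ hR.le this 2
        rw [sq_abs] at this
        linarith
      rw [Real.arccos_of_one_le h1]
      simp
  · have hg : IntegrableOn (fun y : ℝ => 2 * y * (q.densJ * Real.pi))
        (Icc (max (v - q.guardRadius τ) (q.guardRadius τ)) (v + q.guardRadius τ)) :=
      (by fun_prop : Continuous fun y : ℝ => 2 * y * (q.densJ * Real.pi)).integrableOn_Icc
    refine Integrable.mono' hg hmI.aestronglyMeasurable
      ((ae_restrict_mem measurableSet_Icc).mono fun y hy => ?_)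
    obtain ⟨h1, h2⟩ := hposI y (hR.trans_le ((le_max_right _ _).trans hy.1))
    rwa [Real.norm_of_nonneg h1]
  · exact (ae_restrict_mem measurableSet_Icc).mono fun y hy =>
      (hposI y (hR.trans_le ((le_max_right _ _).trans hy.1))).1

/-- The exponent of the Laplace transform of the interference from the jammers outside the guard
zone of the typical user. -/
def jamTail (s R : ℝ) : ℝ :=
  2 * Real.pi * q.densJ * (s * q.powerJ * R ^ (2 - q.α) / (q.α - 2)) *
    hyp2F1 1 (1 - 2 / q.α) (2 - 2 / q.α) (-(s * q.powerJ / R ^ q.α))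

/-- The exponent is the full tail minus the contribution of the hole; the latter therefore appears
with a positive sign in the exponential, which is `H`. -/
lemma nexp_jamExponent {s : ℝ} (hs : 0 < s) {τ : ℝ} (hτ : 0 < τ) {c : Plane} (hc : c ≠ 0) :
    nexp (q.jamExponent s.toNNReal (q.guardRadius τ) (q.guardRadius τ) c) =
      ENNReal.ofReal (Real.exp (-q.jamTail s (q.guardRadius τ)) * q.H τ ‖c‖ s) := by
  have hR : 0 < q.guardRadius τ := q.guardRadius_pos hτ
  have hv : 0 < ‖c‖ := norm_pos_iff.2 hc
  have hadd := q.jamExponent_add_holeExponent s.toNNReal (q.guardRadius τ) c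
  rw [q.setLIntegral_compl_ball_eq_hyp2F1 hs.le q.powerJ_pos.le hR,
    ← ENNReal.ofReal_mul q.densJ_pos.le] at hadd
  have etail : q.densJ * (2 * Real.pi * (s * q.powerJ * q.guardRadius τ ^ (2 - q.α) / (q.α - 2) *
      hyp2F1 1 (1 - 2 / q.α) (2 - 2 / q.α) (-(s * q.powerJ / q.guardRadius τ ^ q.α)))) =
      q.jamTail s (q.guardRadius τ) := by
    rw [jamTail]
    ring
  rw [etail] at hadd
  have hhole : q.holeExponent s.toNNReal (q.guardRadius τ) c = ENNReal.ofReal (∫ y in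
      (max (‖c‖ - q.guardRadius τ) (q.guardRadius τ))..(‖c‖ + q.guardRadius τ),
        2 * y * q.jamDensity' τ ‖c‖ y / (1 + y ^ q.α / (s * q.powerJ))) := by
    rw [← q.holeExponent_polarPoint hs hτ hv]
    exact q.holeExponent_congr_norm _ _ (norm_polarPoint hv.le 0).symm
  have hne := q.jamExponent_ne_top s.toNNReal hR (q.guardRadius τ) c
  have hI : 0 ≤ ∫ y in (max (‖c‖ - q.guardRadius τ) (q.guardRadius τ))..(‖c‖ + q.guardRadius τ),
        2 * y * q.jamDensity' τ ‖c‖ y / (1 + y ^ q.α / (s * q.powerJ)) := by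
    refine intervalIntegral.integral_nonneg (max_le (by linarith) (by linarith)) fun y hy => ?_
    have hy : 0 < y := hR.trans_le ((le_max_right _ _).trans hy.1)
    have := q.densJ_pos
    have := q.powerJ_pos
    have := Real.arccos_nonneg ((y ^ 2 + ‖c‖ ^ 2 - q.guardRadius τ ^ 2) / (2 * y * ‖c‖))
    unfold jamDensity'
    positivity
  have hT : 0 ≤ q.jamTail s (q.guardRadius τ) := by
    have h2 : 0 ≤ ∫ y in Ioi (q.guardRadius τ), y * (1 - 1 / (1 + s * q.powerJ * y ^ (-q.α))) :=
      setIntegral_nonneg measurableSet_Ioi fun y hy => mul_nonneg (hR.trans hy).le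
        (one_sub_one_div_mem (mul_nonneg (mul_nonneg hs.le q.powerJ_pos.le)
          (Real.rpow_nonneg (hR.trans hy).le _))).1
    rw [integral_tail_eq_hyp2F1 q.two_lt_α (mul_nonneg hs.le q.powerJ_pos.le) hR] at h2
    rw [← etail]
    have := q.densJ_pos
    positivity
  have hreal : (q.jamExponent s.toNNReal (q.guardRadius τ) (q.guardRadius τ) c).toReal =
      q.jamTail s (q.guardRadius τ) - ∫ y in
        (max (‖c‖ - q.guardRadius τ) (q.guardRadius τ))..(‖c‖ + q.guardRadius τ),
        2 * y * q.jamDensity' τ ‖c‖ y / (1 + y ^ q.α / (s * q.powerJ)) := by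
    have h := congrArg ENNReal.toReal hadd
    rw [hhole, ENNReal.toReal_add hne ENNReal.ofReal_ne_top, ENNReal.toReal_ofReal hI,
      ENNReal.toReal_ofReal hT] at h
    linarith
  rw [nexp_eq_ofReal hne, hreal, H, ← Real.exp_add]
  congr 2
  ring

lemma H_nonneg (τ v s : ℝ) : 0 ≤ q.H τ v s := (Real.exp_pos _).le

lemma holeDensity_nonneg (k : Fin K) (r : ℝ) {v : ℝ} (hv : 0 ≤ v) : 0 ≤ q.holeDensity k r v := by
  have := q.userDensityTotal_nonneg k r v
  unfold holeDensity
  positivity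

lemma jamLaplace_eq_ofReal {s : ℝ} (hs : 0 < s) {τ : ℝ} (hτ : 0 < τ) (k : Fin K) {r : ℝ}
    (hr : 0 < r) : q.jamLaplace s.toNNReal (q.guardRadius τ) (q.guardRadius τ) k r =
      ENNReal.ofReal (q.laplaceJ τ k r s) := by
  set R := q.guardRadius τ with hR
  set E : ℝ := Real.exp (-q.jamTail s R) with hE
  have hEpos : 0 < E := Real.exp_pos _
  -- A measurable function of the radius that equals the constant `E` times `H` for `v > 0`; the
  -- measurability of the integrand is derived from it rather than from the formula for `H`.
  set J : ℝ → ℝ≥0∞ := fun v => nexp (q.jamExponent s.toNNReal R R (polarPoint v 0)) with hJ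
  have hJm : Measurable J := measurable_nexp.comp ((q.measurable_jamExponent _ R R).comp
    (measurable_polarPoint.comp (measurable_id.prodMk measurable_const)))
  have hJH : ∀ c : Plane, c ≠ 0 → nexp (q.jamExponent s.toNNReal R R c) =
      ENNReal.ofReal (E * q.H τ ‖c‖ s) := fun c hc => q.nexp_jamExponent hs hτ hc
  have hJv : ∀ v, 0 < v → J v = ENNReal.ofReal (E * q.H τ v s) := by
    intro v hv
    have hn := norm_polarPoint hv.le 0
    have := hJH (polarPoint v 0) (norm_pos_iff.1 (by rw [hn]; exact hv))
    rw [hn] at this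
    exact this
  have e1 : q.jamLaplace s.toNNReal R R k r = ∫⁻ c : Plane, (fun v =>
      ENNReal.ofReal (q.userDensityTotal k r v) * (nexp (q.holeVoid k r v) * J v)) ‖c‖ := by
    refine lintegral_congr_ae ?_
    have hne : ∀ᵐ c : Plane, c ≠ 0 := by
      simp [ae_iff]
    filter_upwards [hne] with c hc
    rw [nexp_add, hJH c hc, hJv ‖c‖ (norm_pos_iff.2 hc)]
  have hm : Measurable fun v => ENNReal.ofReal (q.userDensityTotal k r v) *
      (nexp (q.holeVoid k r v) * J v) :=
    (q.continuous_userDensityTotal k r).measurable.ennreal_ofReal.mul ((measurable_nexp.comp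
      ((q.measurable_holeVoid k).comp (measurable_const.prodMk measurable_id))).mul hJm)
  have e2 : q.jamLaplace s.toNNReal R R k r =
      ∫⁻ v in Ioi (0 : ℝ), ENNReal.ofReal (E * (q.H τ v s * q.holeDensity k r v)) := by
    rw [e1, lintegral_plane_norm hm]
    refine setLIntegral_congr_fun measurableSet_Ioi fun v hv => ?_
    have hv : 0 < v := hv
    have h1 := q.userDensityTotal_nonneg k r v
    have h2 : 0 ≤ ∫ y in (0 : ℝ)..v, q.userDensityTotal k r y * y :=
      intervalIntegral.integral_nonneg hv.le fun y hy =>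
        mul_nonneg (q.userDensityTotal_nonneg k r y) hy.1
    have h3 := q.H_nonneg τ v s
    rw [hJv v hv, q.holeVoid_eq k r hv.le, nexp_ofReal (by positivity),
      ← ENNReal.ofReal_mul (by positivity), ← ENNReal.ofReal_mul (by positivity),
      ← ENNReal.ofReal_mul (by positivity), holeDensity]
    congr 1
    ring
  have hmeas : AEStronglyMeasurable (fun v => E * (q.H τ v s * q.holeDensity k r v))
      (volume.restrict (Ioi 0)) := by
    have hcont : Continuous fun y => q.userDensityTotal k r y * y :=
      (q.continuous_userDensityTotal k r).mul continuous_id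
    have hprim : Continuous fun v => ∫ y in (0 : ℝ)..v, q.userDensityTotal k r y * y :=
      intervalIntegral.continuous_primitive (fun a b => hcont.intervalIntegrable a b) 0
    have hd : Continuous (q.holeDensity k r) := by
      have := q.continuous_userDensityTotal k r
      unfold holeDensity
      fun_prop
    have h1 : Measurable fun v => (J v).toReal * q.holeDensity k r v :=
      hJm.ennreal_toReal.mul hd.measurable
    refine h1.aestronglyMeasurable.congr ((ae_restrict_mem measurableSet_Ioi).mono fun v hv => ?_)
    have := q.H_nonneg τ v s
    dsimp only
    rw [hJv v hv, ENNReal.toReal_ofReal (by positivity), mul_assoc]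
  have hnn : 0 ≤ᵐ[volume.restrict (Ioi 0)] fun v => E * (q.H τ v s * q.holeDensity k r v) :=
    (ae_restrict_mem measurableSet_Ioi).mono fun v hv => mul_nonneg hEpos.le
      (mul_nonneg (q.H_nonneg τ v s) (q.holeDensity_nonneg k r (le_of_lt hv)))
  have hfin : q.jamLaplace s.toNNReal R R k r ≠ ∞ :=
    ne_top_of_le_ne_top ENNReal.one_ne_top (q.jamLaplace_le_one _ R R k hr)
  have e3 : q.laplaceJ τ k r s = ∫ v in Ioi (0 : ℝ), E * (q.H τ v s * q.holeDensity k r v) := by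
    rw [integral_const_mul]
    rfl
  rw [e3, integral_eq_lintegral_of_nonneg_ae hnn hmeas, ← e2, ENNReal.ofReal_toReal hfin]

/-- The conditional Laplace transforms are given by the analytic expressions. -/
lemma condLaplace_eq_ofReal {s : ℝ} (hs : 0 < s) {τ : ℝ} (hτ : 0 < τ) (k : Fin K) {r : ℝ}
    (hr : 0 < r) : q.condLaplace s.toNNReal s.toNNReal s.toNNReal (q.guardRadius τ) k r =
      ENNReal.ofReal (q.laplaceB k r s) * (ENNReal.ofReal (q.laplaceU k r s) *
        ENNReal.ofReal (q.laplaceJ τ k r s)) := by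
  rw [condLaplace, q.nexp_bsTail hs.le k hr, q.nexp_userExponent hs.le,
    q.jamLaplace_eq_ofReal hs hτ k hr]

end Params
end HetNet

/-! ### Integrability, conditional expectations and the final formula -/

namespace HetNet

namespace Params

variable {K : ℕ} (q : Params K)

lemma laplaceB_nonneg (k : Fin K) (r s : ℝ) : 0 ≤ q.laplaceB k r s :=
  Finset.prod_nonneg fun _ _ => (Real.exp_pos _).le

lemma laplaceU_nonneg (k : Fin K) (r s : ℝ) : 0 ≤ q.laplaceU k r s :=
  Finset.prod_nonneg fun _ _ => (Real.exp_pos _).le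

lemma laplaceJ_nonneg (τ : ℝ) (k : Fin K) (r s : ℝ) : 0 ≤ q.laplaceJ τ k r s :=
  mul_nonneg (Real.exp_pos _).le (setIntegral_nonneg measurableSet_Ioi fun v hv =>
    mul_nonneg (q.H_nonneg τ v s) (q.holeDensity_nonneg k r (le_of_lt hv)))

lemma zeta_pos {θ : ℝ} (hθ : 0 < θ) (k : Fin K) {r : ℝ} (hr : 0 < r) : 0 < q.zeta θ k r := by
  have := q.power_pos k
  unfold zeta
  positivity

lemma ofReal_connIntegrand {θ τ : ℝ} (hθ : 0 < θ) (hτ : 0 < τ) (k : Fin K) {r : ℝ} (hr : 0 < r) :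
    ENNReal.ofReal (q.connIntegrand θ τ k r) = nexp ((q.zeta θ k r).toNNReal *
          ENNReal.ofReal (q.selfInterference + q.noise)) *
        q.condLaplace (q.zeta θ k r).toNNReal (q.zeta θ k r).toNNReal (q.zeta θ k r).toNNReal
          (q.guardRadius τ) k r * ENNReal.ofReal (q.distDensity k r) := by
  have hz := q.zeta_pos hθ k hr
  have hN := q.noise_add_nonneg
  have h1 := q.laplaceB_nonneg k r (q.zeta θ k r)
  have h2 := q.laplaceU_nonneg k r (q.zeta θ k r)
  have h3 := q.laplaceJ_nonneg τ k r (q.zeta θ k r)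
  have e : ((q.zeta θ k r).toNNReal : ℝ≥0∞) = ENNReal.ofReal (q.zeta θ k r) := rfl
  rw [q.condLaplace_eq_ofReal hz hτ k hr, e, ← ENNReal.ofReal_mul hz.le, nexp_ofReal (by
      positivity),
    ← ENNReal.ofReal_mul h2, ← ENNReal.ofReal_mul h1, ← ENNReal.ofReal_mul (by positivity),
    ← ENNReal.ofReal_mul (by positivity), connIntegrand]
  congr 1
  rw [mul_comm (q.zeta θ k r)]
  ring

lemma connIntegrand_nonneg (θ τ : ℝ) [Nonempty (Fin K)] (k : Fin K) {r : ℝ} (hr : 0 < r) :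
    0 ≤ q.connIntegrand θ τ k r := by
  have h1 := q.laplaceB_nonneg k r (q.zeta θ k r)
  have h2 := q.laplaceU_nonneg k r (q.zeta θ k r)
  have h3 := q.laplaceJ_nonneg τ k r (q.zeta θ k r)
  have h4 := q.distDensity_nonneg k hr.le
  unfold connIntegrand
  positivity

lemma lintegral_connIntegrand_le {θ τ : ℝ} [Nonempty (Fin K)] (hθ : 0 < θ) (hτ : 0 < τ)
    (k : Fin K) : ∫⁻ r in Ioi (0 : ℝ), ENNReal.ofReal (q.connIntegrand θ τ k r) ≤ 1 := by
  rw [← q.lintegral_distDensity k]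
  refine setLIntegral_mono' measurableSet_Ioi fun r hr => ?_
  rw [q.ofReal_connIntegrand hθ hτ k hr]
  exact mul_le_of_le_one_left' (mul_le_one' (nexp_le_one _) (q.condLaplace_le_one _ _ _ _ k hr))

/-- The noise factor and the product of transforms are at most one, so the integrand is dominated by
the serving distance density. -/
lemma integrableOn_connIntegrand {θ τ : ℝ} [Nonempty (Fin K)] (hθ : 0 < θ) (hτ : 0 < τ)
    (k : Fin K) : IntegrableOn (q.connIntegrand θ τ k) (Ioi 0) := by
  have hz : Measurable fun r => (q.zeta θ k r).toNNReal := (q.measurable_zeta θ k).real_toNNReal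
  have hm : Measurable fun r => (nexp ((q.zeta θ k r).toNNReal *
      ENNReal.ofReal (q.selfInterference + q.noise)) * (Ioi (0 : ℝ)).indicator
        (fun r => q.condLaplace (q.zeta θ k r).toNNReal (q.zeta θ k r).toNNReal
          (q.zeta θ k r).toNNReal (q.guardRadius τ) k r) r *
        ENNReal.ofReal (q.distDensity k r)).toReal :=
    (((measurable_nexp.comp (hz.coe_nnreal_ennreal.mul_const _)).mul
      (q.measurable_condLaplace_indicator hz _ k)).mul
        (q.measurable_distDensity k).ennreal_ofReal).ennreal_toReal
  have hae : AEStronglyMeasurable (q.connIntegrand θ τ k) (volume.restrict (Ioi 0)) := by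
    refine hm.aestronglyMeasurable.congr ((ae_restrict_mem measurableSet_Ioi).mono fun r hr => ?_)
    dsimp only
    rw [indicator_of_mem hr, ← q.ofReal_connIntegrand hθ hτ k hr,
      ENNReal.toReal_ofReal (q.connIntegrand_nonneg θ τ k hr)]
  refine ⟨hae, ?_⟩
  rw [hasFiniteIntegral_iff_ofReal ((ae_restrict_mem measurableSet_Ioi).mono fun r hr =>
    q.connIntegrand_nonneg θ τ k hr)]
  exact (q.lintegral_connIntegrand_le hθ hτ k).trans_lt ENNReal.one_lt_top

end Params

namespace Model

variable {K : ℕ} {q : Params K} {Ω : Type*} [MeasurableSpace Ω] {P : Measure Ω}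
  [IsProbabilityMeasure P] (M : Model q Ω P)

lemma measure_tier_inter_dist (k : Fin K) {S : Set ℝ} (hS : MeasurableSet S) :
    P ({ω | M.tier ω = k} ∩ M.dist ⁻¹' S) = ENNReal.ofReal (q.assocProb k) *
      ∫⁻ r in Ioi (0 : ℝ), S.indicator (fun r => ENNReal.ofReal (q.distDensity k r)) r := by
  have hm : MeasurableSet ({ω | M.tier ω = k} ∩ M.dist ⁻¹' S) :=
    (M.measurable_tier (measurableSet_singleton k)).inter (M.measurable_dist hS)
  have hW : ∀ k', Measurable fun r => if k' = k then S.indicator (1 : ℝ → ℝ≥0∞) r else 0 := by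
    intro k'
    split_ifs
    · exact measurable_one.indicator hS
    · exact measurable_const
  have h := M.lintegral_comp_serving hW
  rw [Finset.sum_eq_single k (fun k' _ hk' => by simp [hk']) (by simp)] at h
  rw [← lintegral_indicator_one hm]
  refine Eq.trans (lintegral_congr fun ω => ?_) (h.trans ?_)
  · by_cases h1 : M.tier ω = k <;> by_cases h2 : M.dist ω ∈ S <;> simp [indicator, h1, h2]
  · congr 1
    refine lintegral_congr fun r => ?_
    by_cases h2 : r ∈ S <;> simp [indicator, h2]

lemma measure_tier (k : Fin K) : P {ω | M.tier ω = k} = ENNReal.ofReal (q.assocProb k) := by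
  have hK := M.nonempty_tier
  have h := M.measure_tier_inter_dist k MeasurableSet.univ
  simpa [q.lintegral_distDensity] using h

lemma map_dist_cond_tier (k : Fin K) : (P[|{ω | M.tier ω = k}]).map M.dist =
      (volume.restrict (Ioi 0)).withDensity fun r => ENNReal.ofReal (q.distDensity k r) := by
  have hK := M.nonempty_tier
  ext S hS
  have hpos : ENNReal.ofReal (q.assocProb k) ≠ 0 := by simpa using q.assocProb_pos k
  have hA : MeasurableSet {ω | M.tier ω = k} := M.measurable_tier (measurableSet_singleton k)
  rw [Measure.map_apply M.measurable_dist hS, cond_apply hA, M.measure_tier_inter_dist k hS,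
      M.measure_tier,
    ← mul_assoc, ENNReal.inv_mul_cancel hpos ENNReal.ofReal_ne_top, one_mul,
    withDensity_apply _ hS, ← lintegral_indicator hS]

omit [IsProbabilityMeasure P] in
lemma sigmaServing_le : M.sigmaServing ≤ ‹MeasurableSpace Ω› :=
  (M.measurable_tier.prodMk M.measurable_dist).comap_le

/-- Taking `W` to be the indicator of a set of pairs `(k, r)` tests the identity on all events of
`sigmaServing`, which characterizes the conditional expectation. The function `Λ` carries the
measurability; `L` needs to agree with it only for `r > 0`, which holds almost surely. -/
lemma isCondLaplace_of_lintegral {I : Ω → ℝ≥0∞} (hI : Measurable I) {L : Fin K → ℝ → ℝ → ℝ}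
    (hL : ∀ k r s, 0 ≤ L k r s) {Λ : ℝ → Fin K → ℝ → ℝ≥0∞} (hΛ : ∀ s k, Measurable (Λ s k))
    (hΛL : ∀ s, 0 < s → ∀ k r, 0 < r → Λ s k r = ENNReal.ofReal (L k r s))
    (h : ∀ s, 0 < s → ∀ W : Fin K → ℝ → ℝ≥0∞, (∀ k, Measurable (W k)) →
      ∫⁻ ω, W (M.tier ω) (M.dist ω) * nexp (ENNReal.ofReal s * I ω) ∂P =
        ∫⁻ ω, W (M.tier ω) (M.dist ω) * Λ s (M.tier ω) (M.dist ω) ∂P) :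
    M.IsCondLaplace I L := by
  intro s hs
  have hIm : Measurable fun ω => nexp (ENNReal.ofReal s * I ω) :=
    measurable_nexp.comp (hI.const_mul _)
  have hpair : Measurable fun p : Fin K × ℝ => Λ s p.1 p.2 :=
    measurable_from_prod_countable_right (hΛ s)
  have hΛm : Measurable[M.sigmaServing] fun ω => Λ s (M.tier ω) (M.dist ω) :=
    hpair.comp (comap_measurable fun ω => (M.tier ω, M.dist ω))
  have hΛm' : Measurable fun ω => Λ s (M.tier ω) (M.dist ω) := M.measurable_comp_serving (hΛ s)
  have hset : ∀ S, MeasurableSet[M.sigmaServing] S →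
      ∫⁻ ω in S, nexp (ENNReal.ofReal s * I ω) ∂P =
        ∫⁻ ω in S, Λ s (M.tier ω) (M.dist ω) ∂P := by
    rintro S ⟨S', hS', rfl⟩
    have hS := M.sigmaServing_le _ ⟨S', hS', rfl⟩
    have h1 := h s hs (fun k r => S'.indicator 1 (k, r)) fun k =>
      (measurable_one.indicator hS').comp measurable_prodMk_left
    rw [← lintegral_indicator hS, ← lintegral_indicator hS]
    refine Eq.trans (lintegral_congr fun ω => ?_) (h1.trans (lintegral_congr fun ω => ?_))
    · by_cases hω : (M.tier ω, M.dist ω) ∈ S' <;> simp [indicator, hω]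
    · by_cases hω : (M.tier ω, M.dist ω) ∈ S' <;> simp [indicator, hω]
  have hfin : ∫⁻ ω, Λ s (M.tier ω) (M.dist ω) ∂P ≤ 1 := by
    have h1 := hset univ MeasurableSet.univ
    rw [Measure.restrict_univ] at h1
    rw [← h1]
    calc _ ≤ ∫⁻ _, 1 ∂P := lintegral_mono fun ω => nexp_le_one _
      _ = 1 := by simp
  have hlt : ∀ᵐ ω ∂P, Λ s (M.tier ω) (M.dist ω) < ∞ :=
    ae_lt_top hΛm' (hfin.trans_lt ENNReal.one_lt_top).ne
  have hexp : (fun ω => expNeg (ENNReal.ofReal s * I ω)) =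
      fun ω => (nexp (ENNReal.ofReal s * I ω)).toReal := funext fun ω => (toReal_nexp _).symm
  have hint1 : Integrable (fun ω => (nexp (ENNReal.ofReal s * I ω)).toReal) P :=
    integrable_toReal_of_lintegral_ne_top hIm.aemeasurable
      (ne_top_of_le_ne_top ENNReal.one_ne_top (by
        calc _ ≤ ∫⁻ _, 1 ∂P := lintegral_mono fun ω => nexp_le_one _
          _ = 1 := by simp))
  have hint2 : Integrable (fun ω => (Λ s (M.tier ω) (M.dist ω)).toReal) P :=
    integrable_toReal_of_lintegral_ne_top hΛm'.aemeasurable (hfin.trans_lt ENNReal.one_lt_top).ne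
  rw [hexp]
  have key := ae_eq_condExp_of_forall_setIntegral_eq M.sigmaServing_le hint1
    (g := fun ω => (Λ s (M.tier ω) (M.dist ω)).toReal) (fun S _ _ => hint2.integrableOn)
    (fun S hS _ => by
      rw [integral_toReal hΛm'.aemeasurable (ae_restrict_of_ae hlt),
        integral_toReal hIm.aemeasurable (.of_forall fun ω => (nexp_ne_top _).lt_top), hset S hS])
    hΛm.ennreal_toReal.stronglyMeasurable.aestronglyMeasurable
  refine key.symm.trans ?_
  filter_upwards [M.ae_dist_pos] with ω hω
  rw [hΛL s hs _ _ hω, ENNReal.toReal_ofReal (hL _ _ _)]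

/-- The user and jammer parameters are zero, which makes their factors one. The guard zone parameter
`1` is therefore an arbitrary positive choice. -/
lemma isCondLaplace_interferenceB : M.IsCondLaplace M.interferenceB q.laplaceB := by
  refine M.isCondLaplace_of_lintegral M.measurable_interferenceB q.laplaceB_nonneg
    (Λ := fun s k r => q.condLaplace s.toNNReal 0 0 (q.guardRadius 1) k r)
    (fun s k => q.measurable_condLaplace _ _ _ _ k) (fun s hs k r hr => ?_) fun s hs W hW => ?_
  · rw [Params.condLaplace, q.userExponent_zero, q.jamLaplace_zero _ _ k hr, nexp_zero, mul_one,
      mul_one, q.nexp_bsTail hs.le k hr]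
  · rw [← M.lintegral_nexp_interference s.toNNReal 0 0 one_pos hW]
    simp [ENNReal.ofReal]

lemma isCondLaplace_interferenceU : M.IsCondLaplace M.interferenceU q.laplaceU := by
  refine M.isCondLaplace_of_lintegral M.measurable_interferenceU q.laplaceU_nonneg
    (Λ := fun s k r => q.condLaplace 0 s.toNNReal 0 (q.guardRadius 1) k r)
    (fun s k => q.measurable_condLaplace _ _ _ _ k) (fun s hs k r hr => ?_) fun s hs W hW => ?_
  · rw [Params.condLaplace, q.bsTail_zero, q.jamLaplace_zero _ _ k hr, nexp_zero, mul_one,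
      one_mul, q.nexp_userExponent hs.le]
  · rw [← M.lintegral_nexp_interference 0 s.toNNReal 0 one_pos hW]
    simp [ENNReal.ofReal]

lemma isCondLaplace_interferenceJ {τ : ℝ} (hτ : 0 < τ) :
    M.IsCondLaplace (M.interferenceJ τ) (q.laplaceJ τ) := by
  refine M.isCondLaplace_of_lintegral (M.measurable_interferenceJ τ) (q.laplaceJ_nonneg τ)
    (Λ := fun s k r => q.condLaplace 0 0 s.toNNReal (q.guardRadius τ) k r)
    (fun s k => q.measurable_condLaplace _ _ _ _ k) (fun s hs k r hr => ?_) fun s hs W hW => ?_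
  · rw [Params.condLaplace, q.bsTail_zero, q.userExponent_zero, nexp_zero, one_mul, one_mul,
      q.jamLaplace_eq_ofReal hs hτ k hr]
  · rw [← M.lintegral_nexp_interference 0 0 s.toNNReal hτ hW]
    simp [ENNReal.ofReal]

lemma connProb_eq {θ τ : ℝ} (hθ : 0 < θ) (hτ : 0 < τ) :
    M.connProb θ τ = ∑ k, q.assocProb k * ∫ r in Ioi 0, q.connIntegrand θ τ k r := by
  have hK := M.nonempty_tier
  have e : ∀ k, ∫⁻ r in Ioi (0 : ℝ), nexp ((q.zeta θ k r).toNNReal *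
          ENNReal.ofReal (q.selfInterference + q.noise)) *
        q.condLaplace (q.zeta θ k r).toNNReal (q.zeta θ k r).toNNReal (q.zeta θ k r).toNNReal
          (q.guardRadius τ) k r * ENNReal.ofReal (q.distDensity k r) =
      ENNReal.ofReal (∫ r in Ioi 0, q.connIntegrand θ τ k r) := by
    intro k
    rw [ofReal_integral_eq_lintegral_ofReal (q.integrableOn_connIntegrand hθ hτ k)
      ((ae_restrict_mem measurableSet_Ioi).mono fun r hr => q.connIntegrand_nonneg θ τ k hr)]
    exact setLIntegral_congr_fun measurableSet_Ioi fun r hr =>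
      (q.ofReal_connIntegrand hθ hτ k hr).symm
  have hnn : ∀ k, 0 ≤ ∫ r in Ioi 0, q.connIntegrand θ τ k r := fun k =>
    setIntegral_nonneg measurableSet_Ioi fun r hr => q.connIntegrand_nonneg θ τ k hr
  rw [connProb, measureReal_def, M.measure_le_sinr hθ hτ]
  simp only [e]
  rw [ENNReal.toReal_sum fun k _ => ENNReal.mul_ne_top ENNReal.ofReal_ne_top ENNReal.ofReal_ne_top]
  refine Finset.sum_congr rfl fun k _ => ?_
  rw [ENNReal.toReal_mul, ENNReal.toReal_ofReal (q.assocProb_pos k).le,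
    ENNReal.toReal_ofReal (hnn k)]

end Model
end HetNet

end

theorem theorem1 {K : ℕ} (q : HetNet.Params K)
    {Ω : Type*} [MeasurableSpace Ω] (P : Measure Ω) [IsProbabilityMeasure P]
    (M : HetNet.Model q Ω P) (θ τ : ℝ) (hθ : 0 < θ) (hτ : 0 < τ) :
    (∀ k, P.real {ω | M.tier ω = k} = q.assocProb k) ∧
    (∀ k, (P[|{ω | M.tier ω = k}]).map M.dist =
      (volume.restrict (Ioi 0)).withDensity fun r => ENNReal.ofReal (q.distDensity k r)) ∧
    M.IsCondLaplace M.interferenceB q.laplaceB ∧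
    M.IsCondLaplace M.interferenceU q.laplaceU ∧
    M.IsCondLaplace (M.interferenceJ τ) (q.laplaceJ τ) ∧
    (∀ k, IntegrableOn (q.connIntegrand θ τ k) (Ioi 0)) ∧
    M.connProb θ τ = ∑ k, q.assocProb k * ∫ r in Ioi 0, q.connIntegrand θ τ k r := by
  have hK := M.nonempty_tier
  refine ⟨fun k => ?_, M.map_dist_cond_tier, M.isCondLaplace_interferenceB,
    M.isCondLaplace_interferenceU, M.isCondLaplace_interferenceJ hτ,
    q.integrableOn_connIntegrand hθ hτ, M.connProb_eq hθ hτ⟩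
  rw [measureReal_def, M.measure_tier, ENNReal.toReal_ofReal (q.assocProb_pos k).le]
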